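/- Let $s\ge 1$, let $\boldsymbol P=-i\nabla$ and $\boldsymbol Q$ be the momentum and position operators on $L^2(\mathbb R^s)$, and let $V:\mathbb R^s\to[0,\infty)$ be continuous with $V(x)\to\infty$ as $|x|\to\infty$, such that $L\mapsto V_L(x):=L^{-2}V(x/L)$ is monotonically decreasing on $(0,\infty)$ for every $x$. For $0<L<\infty$ let $h_L=\boldsymbol P^2+V_L(\boldsymbol Q)$ be the self-adjoint operator on $L^2(\mathbb R^s)$ given by the form sum, let $\epsilon_{L,1}=\inf\sigma(h_L)$ be its ground state energy, and let $E_{L,1}$ be the orthogonal projection onto the ground state eigenspace $\ker(h_L-\epsilon_{L,1})$. Put $h_\infty=\boldsymbol P^2$ and $\epsilon_{\infty,1}=0$. For $L\in(0,\infty]$, $\beta>0$, $\mu<\epsilon_{L,1}$ and $f,g\in L^2(\mathbb R^s)$ put $$\langle f,g\rangle_{\beta,\mu,L}=\tfrac12\Big(\big\langle f,\,e^{\beta(h_L-\mu)}\big(e^{\beta(h_L-\mu)}-1\big)^{-1}g\big\rangle+\big\langle g,\,\big(e^{\beta(h_L-\mu)}-1\big)^{-1}f\big\rangle\Big),$$ where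 $\langle\cdot,\cdot\rangle$ is the scalar product of $L^2(\mathbb R^s)$, antilinear in its first argument. **(i)** Let $\beta>0$, $\mu<0$ and $t\in\mathbb R$. Then for all $f,g\in L^2(\mathbb R^s)$ $$\lim_{L\to\infty}\langle f,e^{it(h_L-\mu)}g\rangle_{\beta,\mu,L}=\langle f,e^{it(h_\infty-\mu)}g\rangle_{\beta,\mu,\infty}.$$ **(ii)** Let $L\in(0,\infty]$. Put $\mathcal D_L=(1-E_{L,1})L^2(\mathbb R^s)$ if $L<\infty$, and let $\mathcal D_\infty$ be the domain of $|\boldsymbol P|^{-1}$. Then $\mathcal D_L$ is a complex subspace of $L^2(\mathbb R^s)$ that is stable under $e^{ith_L}$ for all $t\in\mathbb R$. For all $\beta>0$ and $f,g\in\mathcal D_L$ the limits $$\lim_{\mu\nearrow\epsilon_{L,1}}\langle f,e^{it(h_L-\mu)}g\rangle_{\beta,\mu,L},\qquad t\in\mathbb R,$$ exist and are continuous in $t$. On the other hand, for all $\beta>0$ and $f\in L^2(\mathbb R^s)\setminus\mathcal D_L$ the numbers $\langle f,f\rangle_{\beta,\mu,L}$ are real and $$\lim_{\mu\nearrow\epsilon_{L,1}}\langle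 f,f\rangle_{\beta,\mu,L}=+\infty.$$ -/

import Mathlib

open MeasureTheory Filter Topology
open scoped FourierTransform InnerProductSpace

noncomputable section

namespace BoseGas

section Operators

variable {H : Type*} [NormedAddCommGroup H] [InnerProductSpace ℂ H] [CompleteSpace H]

/-- `R` is the (everywhere defined, bounded) inverse of `A - z`. -/
def IsResolventAt (A : H →ₗ.[ℂ] H) (z : ℂ) (R : H →L[ℂ] H) : Prop :=
  (∀ f : H, ∃ hf : R f ∈ A.domain, A ⟨R f, hf⟩ - z • R f = f) ∧
    ∀ u : A.domain, R (A u - z • (u : H)) = u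

/-- The real points of the spectrum of an unbounded operator `A`: those `x` for which `A - x` has
no bounded everywhere defined inverse. -/
def realSpectrum (A : H →ₗ.[ℂ] H) : Set ℝ :=
  {x | ¬ ∃ R : H →L[ℂ] H, IsResolventAt A (x : ℂ) R}

/-- The ground state energy of `A`: the infimum of the spectrum. -/
def groundEnergy (A : H →ₗ.[ℂ] H) : ℝ := sInf (realSpectrum A)

/-- The space of all `f` in the domain of `A` with `A f = c f`. -/
def eigenspace (A : H →ₗ.[ℂ] H) (c : ℝ) : Submodule ℂ H :=
  A.graph.comap (LinearMap.id.prod ((c : ℂ) • LinearMap.id))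

/-- The orthogonal projection onto the ground state space of `A`, that is, onto the eigenspace
of the lowest point of the spectrum. (The eigenspace of a self-adjoint operator is closed, so that
taking the closure changes nothing.) -/
def groundProj (A : H →ₗ.[ℂ] H) : H →L[ℂ] H :=
  (eigenspace A (groundEnergy A)).topologicalClosure.starProjection

open Classical in
/-- The bounded operator `(A + 1)⁻¹`; it exists for every self-adjoint `A ≥ 0`. -/
def resolventOne (A : H →ₗ.[ℂ] H) : H →L[ℂ] H :=
  if h : ∃ R : H →L[ℂ] H, IsResolventAt A (-1) R then h.choose else 0

/-- Functional calculus of a self-adjoint operator `A ≥ 0`, for functions `F` that are continuous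
and bounded on the spectrum of `A`. With `T = (A + 1)⁻¹`, the bounded operator `F(A) T` is the
continuous function `z ↦ z F(z⁻¹ - 1)`, vanishing at `0`, of the bounded self-adjoint operator `T`.
Since `T` has dense range and `‖F(A) T f‖ ≤ sup |F| ‖T f‖`, this determines `F(A)`. -/
def funCalc (A : H →ₗ.[ℂ] H) (F : ℝ → ℂ) : H →L[ℂ] H :=
  (cfc (fun z : ℂ => z * F (z.re⁻¹ - 1)) (resolventOne A)).toLinearMap.extendOfNorm
    (resolventOne A).toLinearMap

/-- The defining relation of the functional calculus. -/
theorem funCalc_resolventOne (A : H →ₗ.[ℂ] H) (F : ℝ → ℂ)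
    (hT : IsSelfAdjoint (resolventOne A)) (hd : DenseRange (resolventOne A)) (C : ℝ)
    (hc : ContinuousOn (fun z : ℂ => z * F (z.re⁻¹ - 1)) (spectrum ℂ (resolventOne A)))
    (hC : ∀ z ∈ spectrum ℂ (resolventOne A), ‖z * F (z.re⁻¹ - 1)‖ ≤ C * ‖z‖) (f : H) :
    funCalc A F (resolventOne A f) =
      cfc (fun z : ℂ => z * F (z.re⁻¹ - 1)) (resolventOne A) f := by
  refine LinearMap.extendOfNorm_eq hd ⟨|C|, fun f => ?_⟩ f
  set T := resolventOne A
  set G : ℂ → ℂ := fun z => z * F (z.re⁻¹ - 1)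
  let k : ℂ → ℂ := fun z => ((√(C ^ 2 * ‖z‖ ^ 2 - ‖G z‖ ^ 2) : ℝ) : ℂ)
  have hk : ContinuousOn k (spectrum ℂ T) := by
    refine Complex.continuous_ofReal.comp_continuousOn (Real.continuous_sqrt.comp_continuousOn ?_)
    exact (by fun_prop : Continuous fun z : ℂ => C ^ 2 * ‖z‖ ^ 2).continuousOn.sub (hc.norm.pow 2)
  have hn : IsStarNormal T := hT.isStarNormal
  have key : star (cfc G T) * cfc G T + star (cfc k T) * cfc k T =
      ((C ^ 2 : ℝ) : ℂ) • (star T * T) := by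
    have hid : T = cfc (fun z : ℂ => z) T := (cfc_id' ℂ T).symm
    have e : star T * T = cfc (fun z : ℂ => star z * z) T := by
      rw [cfc_mul (fun z : ℂ => star z) (fun z => z) T, cfc_star, cfc_id' ℂ T]
    rw [e, ← cfc_star, ← cfc_star, ← cfc_mul (fun z => star (G z)) G T hc.star hc,
      ← cfc_mul (fun z => star (k z)) k T hk.star hk,
      ← cfc_add T (fun z => star (G z) * G z) (fun z => star (k z) * k z) (hc.star.mul hc)
        (hk.star.mul hk), ← cfc_smul (((C ^ 2 : ℝ) : ℂ)) (fun z : ℂ => star z * z) T]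
    refine cfc_congr fun z hz => ?_
    have h0 : 0 ≤ C ^ 2 * ‖z‖ ^ 2 - ‖G z‖ ^ 2 := by
      have := pow_le_pow_left₀ (norm_nonneg _) (hC z hz) 2
      rw [mul_pow] at this
      linarith
    have h1 : ∀ w : ℂ, star w * w = ((‖w‖ ^ 2 : ℝ) : ℂ) := fun w => by
      rw [Complex.star_def, Complex.conj_mul']; push_cast; rfl
    simp only [h1, smul_eq_mul]
    rw [← Complex.ofReal_add, ← Complex.ofReal_mul]
    congr 1
    simp only [k, Complex.norm_real, Real.norm_eq_abs, sq_abs, Real.sq_sqrt h0]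
    ring
  have h1 : ∀ S : H →L[ℂ] H, ⟪f, (star S * S) f⟫_ℂ = ((‖S f‖ ^ 2 : ℝ) : ℂ) := fun S => by
    change ⟪f, ContinuousLinearMap.adjoint S (S f)⟫_ℂ = _
    rw [ContinuousLinearMap.adjoint_inner_right, inner_self_eq_norm_sq_to_K]
    push_cast; rfl
  have h2 := congrArg (fun B : H →L[ℂ] H => ⟪f, B f⟫_ℂ) key
  change ⟪f, (star (cfc G T) * cfc G T) f + (star (cfc k T) * cfc k T) f⟫_ℂ =
    ⟪f, ((C ^ 2 : ℝ) : ℂ) • (star T * T) f⟫_ℂ at h2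
  rw [inner_add_right, inner_smul_right, h1, h1, h1] at h2
  norm_cast at h2
  have h3 : ‖cfc G T f‖ ^ 2 ≤ (|C| * ‖T f‖) ^ 2 := by
    rw [mul_pow, sq_abs]
    nlinarith [sq_nonneg ‖cfc k T f‖, h2]
  exact abs_le_of_sq_le_sq' h3 (by positivity) |>.2

/-- The unitary operator `e^{it(A - μ)}`. -/
def evol (A : H →ₗ.[ℂ] H) (μ t : ℝ) : H →L[ℂ] H :=
  funCalc A (fun ε => Complex.exp (Complex.I * (t * (ε - μ) : ℝ)))

/-- The operator `(e^{β(A - μ)} - 1)⁻¹`, for `μ` below the spectrum of `A`. -/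
def boseOp (A : H →ₗ.[ℂ] H) (β μ : ℝ) : H →L[ℂ] H :=
  funCalc A (fun ε => (((Real.exp (β * (ε - μ)) - 1)⁻¹ : ℝ) : ℂ))

/-- The operator `e^{β(A - μ)} (e^{β(A - μ)} - 1)⁻¹`, for `μ` below the spectrum of `A`. -/
def expBoseOp (A : H →ₗ.[ℂ] H) (β μ : ℝ) : H →L[ℂ] H :=
  funCalc A (fun ε => ((Real.exp (β * (ε - μ)) * (Real.exp (β * (ε - μ)) - 1)⁻¹ : ℝ) : ℂ))

/-- The thermal scalar product `⟨f, g⟩_{β, μ}` for the single particle Hamiltonian `A`. -/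
def thermal (A : H →ₗ.[ℂ] H) (β μ : ℝ) (f g : H) : ℂ :=
  (1 / 2) * (⟪f, expBoseOp A β μ g⟫_ℂ + ⟪g, boseOp A β μ f⟫_ℂ)

/-- The behaviour of the thermal scalar products of `A` as `μ ↗ ε`, relative to the subspace `D`. -/
structure HasCriticalLimits (A : H →ₗ.[ℂ] H) (ε : ℝ) (D : Submodule ℂ H) : Prop where
  /-- `D` is stable under `e^{itA}`. -/
  stable : ∀ (t : ℝ), ∀ f ∈ D, evol A 0 t f ∈ D
  /-- On `D` the two-point functions have limits, which are continuous in `t`. -/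
  tendsto : ∀ β : ℝ, 0 < β → ∀ f ∈ D, ∀ g ∈ D, ∃ ℓ : ℝ → ℂ, Continuous ℓ ∧
    ∀ t : ℝ, Tendsto (fun μ : ℝ => thermal A β μ f (evol A μ t g)) (𝓝[<] ε) (𝓝 (ℓ t))
  /-- Off `D` the (real) number `⟨f, f⟩_{β, μ}` tends to `+∞`. -/
  diverges : ∀ β : ℝ, 0 < β → ∀ f : H, f ∉ D →
    (∀ μ : ℝ, μ < ε → (thermal A β μ f f).im = 0) ∧
      Tendsto (fun μ : ℝ => (thermal A β μ f f).re) (𝓝[<] ε) atTop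

end Operators

section Schroedinger

/-- Configuration (and momentum) space `ℝˢ`. -/
abbrev Space (s : ℕ) : Type := EuclideanSpace ℝ (Fin s)

/-- The single particle space `L²(ℝˢ)`. -/
abbrev L2 (s : ℕ) : Type := Lp ℂ 2 (volume : Measure (Space s))

variable {s : ℕ}

theorem coeFn_mul_add (w : Space s → ℝ) (f g : L2 s) :
    (fun x => (w x : ℂ) * (f + g : L2 s) x) =ᵐ[volume]
      ((fun x => (w x : ℂ) * f x) + fun x => (w x : ℂ) * g x) := by
  filter_upwards [Lp.coeFn_add f g] with x hx
  rw [hx, Pi.add_apply, Pi.add_apply, mul_add]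

theorem coeFn_mul_smul (w : Space s → ℝ) (c : ℂ) (f : L2 s) :
    (fun x => (w x : ℂ) * (c • f : L2 s) x) =ᵐ[volume] (c • fun x => (w x : ℂ) * f x) := by
  filter_upwards [Lp.coeFn_smul c f] with x hx
  rw [hx, Pi.smul_apply, Pi.smul_apply, smul_eq_mul, smul_eq_mul, mul_left_comm]

/-- `{f ∈ L² | w f ∈ L²}`. -/
def positionDomain (w : Space s → ℝ) : Submodule ℂ (L2 s) where
  carrier := {f | MemLp (fun x => (w x : ℂ) * f x) 2 volume}
  zero_mem' := by
    refine (MemLp.zero (p := 2) (μ := volume) (ε := ℂ)).ae_eq ?_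
    filter_upwards [Lp.coeFn_zero ℂ 2 (volume : Measure (Space s))] with x hx
    rw [hx]; simp
  add_mem' := by
    intro f g hf hg
    exact (MemLp.add hf hg).ae_eq (coeFn_mul_add w f g).symm
  smul_mem' := by
    intro c f hf
    exact (MemLp.const_smul hf c).ae_eq (coeFn_mul_smul w c f).symm

theorem mem_positionDomain {w : Space s → ℝ} {f : L2 s} :
    f ∈ positionDomain w ↔ MemLp (fun x => (w x : ℂ) * f x) 2 volume := Iff.rfl

/-- The operator `w(Q)` of multiplication by the real function `w` on its maximal domain
`{f ∈ L² | w f ∈ L²}`. -/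
def positionFn (w : Space s → ℝ) : L2 s →ₗ.[ℂ] L2 s where
  domain := positionDomain w
  toFun :=
    { toFun := fun f => MemLp.toLp (fun x => (w x : ℂ) * (f : L2 s) x) (mem_positionDomain.mp f.2)
      map_add' := by
        intro f g
        exact (MemLp.toLp_congr _ ((mem_positionDomain.mp f.2).add (mem_positionDomain.mp g.2)) (coeFn_mul_add w f g)).trans
          (MemLp.toLp_add _ _)
      map_smul' := by
        intro c f
        exact (MemLp.toLp_congr _ ((mem_positionDomain.mp f.2).const_smul c)
          (coeFn_mul_smul w c f)).trans (MemLp.toLp_const_smul _ _) }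

/-- The operator `w(P)` for the momentum operator `P = -i∇` and a real function `w`, on its maximal
domain. The Fourier transform `f ↦ ∫ f(x) e^{-2πi x·ξ} dx` turns `P` into multiplication
by `2πξ`. -/
def momentumFn (w : Space s → ℝ) : L2 s →ₗ.[ℂ] L2 s where
  domain := (positionFn (fun ξ => w ((2 * Real.pi) • ξ))).domain.comap
    (Lp.fourierTransformₗᵢ (Space s) ℂ).toLinearEquiv.toLinearMap
  toFun :=
    { toFun := fun f => (Lp.fourierTransformₗᵢ (Space s) ℂ).symm
        (positionFn (fun ξ => w ((2 * Real.pi) • ξ))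
          ⟨Lp.fourierTransformₗᵢ (Space s) ℂ f, f.2⟩)
      map_add' := by
        intro f g
        rw [← map_add, ← LinearPMap.map_add]
        congr 3
        exact map_add _ _ _
      map_smul' := by
        intro c f
        rw [RingHom.id_apply, ← map_smul, ← LinearPMap.map_smul]
        congr 3
        exact map_smul _ _ _ }

/-- `|P|`. -/
def absP (s : ℕ) : L2 s →ₗ.[ℂ] L2 s := momentumFn (fun p => ‖p‖)

/-- `|P|⁻¹`. -/
def absPInv (s : ℕ) : L2 s →ₗ.[ℂ] L2 s := momentumFn (fun p => ‖p‖⁻¹)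

/-- `√V(Q)`. -/
def sqrtV (V : Space s → ℝ) : L2 s →ₗ.[ℂ] L2 s := positionFn (fun x => √(V x))

/-- The graph of `P² + V(Q)`, for `V ≥ 0`: all pairs `(u, w)` with `u` in the form domain
`D(|P|) ∩ D(√V(Q))` and `⟨|P| v, |P| u⟩ + ⟨√V v, √V u⟩ = ⟨v, w⟩` for all `v` in the form domain. -/
def hamiltonianGraph (V : Space s → ℝ) : Submodule ℂ (L2 s × L2 s) where
  carrier := {p | ∃ (h₁ : p.1 ∈ (absP s).domain) (h₂ : p.1 ∈ (sqrtV V).domain),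
    ∀ (v : L2 s) (k₁ : v ∈ (absP s).domain) (k₂ : v ∈ (sqrtV V).domain),
      ⟪absP s ⟨v, k₁⟩, absP s ⟨p.1, h₁⟩⟫_ℂ + ⟪sqrtV V ⟨v, k₂⟩, sqrtV V ⟨p.1, h₂⟩⟫_ℂ = ⟪v, p.2⟫_ℂ}
  zero_mem' := by
    refine ⟨Submodule.zero_mem _, Submodule.zero_mem _, fun v k₁ k₂ => ?_⟩
    have e₁ : absP s ⟨(0 : L2 s × L2 s).1, Submodule.zero_mem _⟩ = 0 := (absP s).map_zero
    have e₂ : sqrtV V ⟨(0 : L2 s × L2 s).1, Submodule.zero_mem _⟩ = 0 := (sqrtV V).map_zero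
    rw [e₁, e₂]; simp
  add_mem' := by
    rintro p q ⟨h₁, h₂, hp⟩ ⟨h₁', h₂', hq⟩
    refine ⟨Submodule.add_mem _ h₁ h₁', Submodule.add_mem _ h₂ h₂', fun v k₁ k₂ => ?_⟩
    have e₁ : absP s ⟨(p + q).1, Submodule.add_mem _ h₁ h₁'⟩ =
      absP s ⟨p.1, h₁⟩ + absP s ⟨q.1, h₁'⟩ := (absP s).map_add ⟨p.1, h₁⟩ ⟨q.1, h₁'⟩
    have e₂ : sqrtV V ⟨(p + q).1, Submodule.add_mem _ h₂ h₂'⟩ =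
      sqrtV V ⟨p.1, h₂⟩ + sqrtV V ⟨q.1, h₂'⟩ := (sqrtV V).map_add ⟨p.1, h₂⟩ ⟨q.1, h₂'⟩
    rw [e₁, e₂, Prod.snd_add, inner_add_right, inner_add_right, inner_add_right,
      ← hp v k₁ k₂, ← hq v k₁ k₂]
    ring
  smul_mem' := by
    rintro c p ⟨h₁, h₂, hp⟩
    refine ⟨Submodule.smul_mem _ c h₁, Submodule.smul_mem _ c h₂, fun v k₁ k₂ => ?_⟩
    have e₁ : absP s ⟨(c • p).1, Submodule.smul_mem _ c h₁⟩ = c • absP s ⟨p.1, h₁⟩ :=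
      (absP s).map_smul c ⟨p.1, h₁⟩
    have e₂ : sqrtV V ⟨(c • p).1, Submodule.smul_mem _ c h₂⟩ = c • sqrtV V ⟨p.1, h₂⟩ :=
      (sqrtV V).map_smul c ⟨p.1, h₂⟩
    rw [e₁, e₂, Prod.smul_snd, inner_smul_right, inner_smul_right, inner_smul_right,
      ← hp v k₁ k₂]
    ring

/-- The self-adjoint operator `P² + V(Q)` in `L²(ℝˢ)`, for a continuous potential `V ≥ 0`: the
operator of the closed quadratic form `‖|P| u‖² + ‖√V u‖²`. For `V = 0` it is `P²`. -/
def hamiltonian (V : Space s → ℝ) : L2 s →ₗ.[ℂ] L2 s := (hamiltonianGraph V).toLinearPMap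

/-- The scaled potential `V_L(x) = L⁻² V(x / L)`. -/
def scaledV (V : Space s → ℝ) (L : ℝ) : Space s → ℝ := fun x => (L ^ 2)⁻¹ * V (L⁻¹ • x)

/-- The Hamiltonian `h_L = P² + V_L(Q)` of a particle in the trap of size `L`. -/
def trapH (V : Space s → ℝ) (L : ℝ) : L2 s →ₗ.[ℂ] L2 s := hamiltonian (scaledV V L)

/-- The Hamiltonian `h_∞ = P²`. -/
def freeH (s : ℕ) : L2 s →ₗ.[ℂ] L2 s := hamiltonian (fun _ => 0)

end Schroedinger

end BoseGas

end

/-!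
Everything is reduced to the resolvents `T = (h + 1)⁻¹`. For a self-adjoint operator `A ≥ c ≥ 0` the
functional calculus `F(A)` is determined on the dense range of `T` by continuous functions of the
positive operator `T`, whose spectrum lies in `[0, (1 + c)⁻¹]`; Weierstrass approximation therefore
carries information from polynomials in `T` over to `F(A)`. The relation
`e^y (e^y - 1)⁻¹ = 1 + (e^y - 1)⁻¹` writes the thermal scalar product in terms of
`b_μ = (e^{β(A - μ)} - 1)⁻¹` alone.

*Resolvents.* `(P² + V + 1)⁻¹ f` is the first component of the projection of `(f, 0, 0)` onto the
closed space of all `(u, |P| u, √V u)` (`isPosResolvent_hamiltonian`), which represents the form sum.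

*Thermodynamic limit.* The functions `(1 + P²) v` with a test function `v` are dense, and
`(h_L + 1)⁻¹ (1 + P²) v = v - (h_L + 1)⁻¹ V_L v` with `‖V_L v‖ = O(L⁻²)`. So `h_L → P²` in the
strong resolvent sense (`tendsto_resolvent`), which implies strong convergence of bounded continuous
functions (`tendsto_funCalc_apply`), hence of the two-point functions (`tendsto_thermal`).

*Finite trap.* Since `V → ∞`, a vector with bounded `|P| u` and `√V u` is concentrated, up to a
small error, in a bounded set of phase space, so `(h_L + 1)⁻¹` is a norm limit of products of a
bounded operator and the Hilbert–Schmidt operators `χ(aQ) χ(aP / 2π)`, and is compact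
(`isCompactOperator_resolvent`). Consequently `‖T‖` is an eigenvalue of `T`, the ground state energy
is `‖T‖⁻¹ - 1`, and there is a gap above it (`IsPosResolvent.exists_gap`). Orthogonally to the ground
states only the values of `e^{β(x - μ)} - 1` above the gap matter, and `b_μ` converges strongly; on a
ground state it is multiplication by a number which tends to infinity
(`IsPosResolvent.hasCriticalLimits`).

*No trap.* In momentum space `b_μ` is multiplication by `(e^{β(|p|² - μ)} - 1)⁻¹`
(`isMulBy_funCalc`). On `D(|P|⁻¹)` the bound `m (e^{β(m - μ)} - 1)⁻¹ ≤ β⁻¹` allows dominated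
convergence. Conversely, `⟨f, b_μ f⟩` increases with `μ`, and if it stays bounded, then Fatou's lemma
and `y⁻¹ ≤ 1 + (e^y - 1)⁻¹` give `|p|⁻¹ f̂ ∈ L²` (`mem_domain_absPInv_of_bounded`).
-/

noncomputable section

namespace BoseGas

/-! ### The resolvent and continuous functional calculus -/

section FunctionalCalculus

variable {H : Type*} [NormedAddCommGroup H] [InnerProductSpace ℂ H]

/-- The interval `[0, (1 + c)⁻¹]` inside `ℂ`; it contains the spectrum of `(A + 1)⁻¹` when `A ≥ c`. -/
def resolventInterval (c : ℝ) : Set ℂ := Complex.ofReal '' Set.Icc 0 (1 + c)⁻¹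

/-- The function `z ↦ z F(z⁻¹ - 1)` which represents `F(A) (A + 1)⁻¹` as a function of the
resolvent `(A + 1)⁻¹`. -/
def resolventSymbol (F : ℝ → ℂ) : ℂ → ℂ := fun z => z * F (z.re⁻¹ - 1)

/-- `T` is the resolvent `(A + 1)⁻¹` of a self-adjoint operator `A ≥ c`, where `c ≥ 0`. -/
structure IsPosResolvent (A : H →ₗ.[ℂ] H) (c : ℝ) (T : H →L[ℂ] H) : Prop where
  resolvent : IsResolventAt A (-1) T
  pos : T.IsPositive
  dense : DenseRange T
  bound_nonneg : 0 ≤ c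
  norm_le : ‖T‖ ≤ (1 + c)⁻¹

/-- `F` is continuous and bounded by `C` on `[c, ∞)`. -/
structure IsBddSymbol (F : ℝ → ℂ) (c C : ℝ) : Prop where
  cont : ContinuousOn F (Set.Ici c)
  bound : ∀ x, c ≤ x → ‖F x‖ ≤ C

theorem IsBddSymbol.nonneg {F : ℝ → ℂ} {c C : ℝ} (hF : IsBddSymbol F c C) : 0 ≤ C :=
  (norm_nonneg _).trans (hF.bound c le_rfl)

theorem IsBddSymbol.conj {F : ℝ → ℂ} {c C : ℝ} (hF : IsBddSymbol F c C) :
    IsBddSymbol (fun x => star (F x)) c C :=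
  ⟨hF.cont.star, fun x hx => by simpa using hF.bound x hx⟩

theorem IsBddSymbol.add {F G : ℝ → ℂ} {c C D : ℝ} (hF : IsBddSymbol F c C)
    (hG : IsBddSymbol G c D) : IsBddSymbol (fun x => F x + G x) c (C + D) :=
  ⟨hF.cont.add hG.cont, fun x hx =>
    (norm_add_le _ _).trans (add_le_add (hF.bound x hx) (hG.bound x hx))⟩

theorem IsBddSymbol.const_mul {F : ℝ → ℂ} {c C : ℝ} (hF : IsBddSymbol F c C) (a : ℂ) :
    IsBddSymbol (fun x => a * F x) c (‖a‖ * C) :=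
  ⟨continuousOn_const.mul hF.cont, fun x hx => by
    rw [norm_mul]; exact mul_le_mul_of_nonneg_left (hF.bound x hx) (norm_nonneg _)⟩

theorem isBddSymbol_const (a : ℂ) (c : ℝ) : IsBddSymbol (fun _ => a) c ‖a‖ :=
  ⟨continuousOn_const, fun _ _ => le_rfl⟩

theorem le_inv_sub_one {c x : ℝ} (hc : 0 ≤ c) (h0 : 0 < x) (hx : x ≤ (1 + c)⁻¹) :
    c ≤ x⁻¹ - 1 := by
  have : 1 + c ≤ x⁻¹ := by
    rw [le_inv_comm₀ (by linarith) h0]; exact hx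
  linarith

theorem IsBddSymbol.norm_resolventSymbol_le {F : ℝ → ℂ} {c C : ℝ} (hF : IsBddSymbol F c C)
    (hc : 0 ≤ c) {z : ℂ} (hz : z ∈ resolventInterval c) :
    ‖resolventSymbol F z‖ ≤ C * ‖z‖ := by
  obtain ⟨x, hx, rfl⟩ := hz
  rcases hx.1.eq_or_lt with h0 | h0
  · simp [resolventSymbol, ← h0]
  · simp only [resolventSymbol, norm_mul, Complex.ofReal_re]
    rw [mul_comm]
    exact mul_le_mul_of_nonneg_right (hF.bound _ (le_inv_sub_one hc h0 hx.2)) (norm_nonneg _)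

theorem IsBddSymbol.continuousOn_resolventSymbol {F : ℝ → ℂ} {c C : ℝ} (hF : IsBddSymbol F c C)
    (hc : 0 ≤ c) : ContinuousOn (resolventSymbol F) (resolventInterval c) := by
  intro z hz
  obtain ⟨x, hx, rfl⟩ := id hz
  rcases hx.1.eq_or_lt with h0 | h0
  · -- at the origin the factor `z` beats the bounded factor `F(z⁻¹ - 1)`
    subst h0
    have h1 : resolventSymbol F ((0 : ℝ) : ℂ) = 0 := by simp [resolventSymbol]
    rw [ContinuousWithinAt, h1]
    refine squeeze_zero_norm' (a := fun z => C * ‖z‖) ?_ ?_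
    · filter_upwards [self_mem_nhdsWithin] with w hw using hF.norm_resolventSymbol_le hc hw
    · have : Continuous fun z : ℂ => C * ‖z‖ := by fun_prop
      simpa using (this.tendsto ((0 : ℝ) : ℂ)).mono_left nhdsWithin_le_nhds
  · refine continuousWithinAt_id.mul ?_
    have h2 : ContinuousWithinAt (fun z : ℂ => z.re⁻¹ - 1) (resolventInterval c) (x : ℂ) := by
      refine ContinuousAt.continuousWithinAt ?_
      refine ContinuousAt.sub ?_ continuousAt_const
      exact Complex.continuous_re.continuousAt.inv₀ (by simpa using h0.ne')
    have h3 := (hF.cont ((x : ℂ).re⁻¹ - 1)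
      (by simpa using le_inv_sub_one hc h0 hx.2))
    -- near a positive point the substitution stays in `[c, ∞)`
    have h4 : ∀ᶠ w in 𝓝[resolventInterval c] (x : ℂ), w.re⁻¹ - 1 ∈ Set.Ici c := by
      have h5 : ∀ᶠ w : ℂ in 𝓝[resolventInterval c] (x : ℂ), 0 < w.re :=
        nhdsWithin_le_nhds (Complex.continuous_re.continuousAt.eventually
          (lt_mem_nhds (by simpa using h0)))
      filter_upwards [h5, self_mem_nhdsWithin] with w hw1 hw2
      obtain ⟨y, hy, rfl⟩ := hw2
      exact le_inv_sub_one hc (by simpa using hw1) (by simpa using hy.2)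
    exact Filter.Tendsto.comp h3 (tendsto_nhdsWithin_iff.2 ⟨h2, h4⟩)

/-- The bounded inverse of `A - z` is unique. -/
theorem IsResolventAt.unique {A : H →ₗ.[ℂ] H} {z : ℂ} {R S : H →L[ℂ] H}
    (hR : IsResolventAt A z R) (hS : IsResolventAt A z S) : R = S := by
  ext f
  obtain ⟨h, e⟩ := hR.1 f
  have := hS.2 ⟨R f, h⟩
  rw [e] at this
  exact this.symm

theorem IsPosResolvent.resolventOne_eq {A : H →ₗ.[ℂ] H} {c : ℝ} {T : H →L[ℂ] H}
    (h : IsPosResolvent A c T) : resolventOne A = T := by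
  have hex : ∃ R : H →L[ℂ] H, IsResolventAt A (-1) R := ⟨T, h.resolvent⟩
  rw [resolventOne, dif_pos hex]
  exact hex.choose_spec.unique h.resolvent

/-- Bounded operators are determined by their values on the range of the resolvent. -/
theorem IsPosResolvent.ext_of_dense {A : H →ₗ.[ℂ] H} {c : ℝ} {T : H →L[ℂ] H}
    (h : IsPosResolvent A c T) {B B' : H →L[ℂ] H} (hB : ∀ f, B (T f) = B' (T f)) : B = B' := by
  ext f
  exact h.dense.induction_on (p := fun f => B f = B' f) f
    (isClosed_eq (by fun_prop) (by fun_prop)) hB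

variable [CompleteSpace H]

namespace IsPosResolvent

variable {A : H →ₗ.[ℂ] H} {c : ℝ} {T : H →L[ℂ] H}

theorem isSelfAdjoint (h : IsPosResolvent A c T) : IsSelfAdjoint T := h.pos.isSelfAdjoint

theorem isStarNormal (h : IsPosResolvent A c T) : IsStarNormal T := h.isSelfAdjoint.isStarNormal

end IsPosResolvent

theorem spectrum_subset_resolventInterval {T : H →L[ℂ] H} {c : ℝ} (hT : T.IsPositive)
    (hn : ‖T‖ ≤ (1 + c)⁻¹) : spectrum ℂ T ⊆ resolventInterval c := by
  intro z hz
  have h1 : z = ((z.re : ℝ) : ℂ) := hT.isSelfAdjoint.mem_spectrum_eq_re hz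
  have h0 : (0 : H →L[ℂ] H) ≤ T := (ContinuousLinearMap.nonneg_iff_isPositive T).2 hT
  have h2 : z.re ∈ spectrum ℝ T := by
    rw [h1] at hz
    exact spectrum.of_algebraMap_mem (R := ℝ) ℂ hz
  refine ⟨z.re, ⟨spectrum_nonneg_of_nonneg h0 h2, ?_⟩, h1.symm⟩
  rcases subsingleton_or_nontrivial (H →L[ℂ] H) with hs | hs
  · simp [spectrum.of_subsingleton] at hz
  have := spectrum.norm_le_norm_of_mem hz
  exact (Complex.re_le_norm z).trans (this.trans hn)

open Polynomial in
/-- Weierstrass approximation on a real interval by polynomials with complex coefficients. -/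
theorem exists_polynomial_near {G : ℂ → ℂ} {c : ℝ} (hG : ContinuousOn G (resolventInterval c))
    {ε : ℝ} (hε : 0 < ε) :
    ∃ q : ℂ[X], ∀ z ∈ resolventInterval c, ‖G z - q.eval z‖ ≤ ε := by
  have hG' : ContinuousOn (fun x : ℝ => G x) (Set.Icc 0 (1 + c)⁻¹) :=
    hG.comp Complex.continuous_ofReal.continuousOn fun x hx => ⟨x, hx, rfl⟩
  obtain ⟨p, hp⟩ := exists_polynomial_near_of_continuousOn 0 (1 + c)⁻¹ (fun x : ℝ => (G x).re)
    (Complex.continuous_re.comp_continuousOn hG') (ε / 2) (by positivity)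
  obtain ⟨r, hr⟩ := exists_polynomial_near_of_continuousOn 0 (1 + c)⁻¹ (fun x : ℝ => (G x).im)
    (Complex.continuous_im.comp_continuousOn hG') (ε / 2) (by positivity)
  refine ⟨p.map Complex.ofRealHom + C Complex.I * r.map Complex.ofRealHom, ?_⟩
  rintro _ ⟨x, hx, rfl⟩
  have h1 : (p.map Complex.ofRealHom).eval (x : ℂ) = ((p.eval x : ℝ) : ℂ) := by
    rw [← Complex.ofRealHom_eq_coe x, eval_map, eval₂_hom]; rfl
  have h2 : (r.map Complex.ofRealHom).eval (x : ℂ) = ((r.eval x : ℝ) : ℂ) := by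
    rw [← Complex.ofRealHom_eq_coe x, eval_map, eval₂_hom]; rfl
  rw [eval_add, eval_mul, eval_C, h1, h2]
  refine (Complex.norm_le_abs_re_add_abs_im _).trans ?_
  have e1 := hp x hx
  have e2 := hr x hx
  rw [abs_sub_comm] at e1 e2
  simp only [Complex.sub_re, Complex.add_re, Complex.ofReal_re, Complex.mul_re, Complex.I_re,
    Complex.I_im, Complex.ofReal_im, Complex.sub_im, Complex.add_im, Complex.mul_im]
  ring_nf at e1 e2 ⊢
  linarith

/-- The Weierstrass approximants of a symbol, evaluated at `T`, approximate its functional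
calculus in norm. -/
theorem norm_cfc_sub_aeval_le {T : H →L[ℂ] H} {c : ℝ} (hT : T.IsPositive)
    (hn : ‖T‖ ≤ (1 + c)⁻¹) {G : ℂ → ℂ} (hG : ContinuousOn G (resolventInterval c))
    {q : Polynomial ℂ} {ε : ℝ} (hε : 0 ≤ ε)
    (hq : ∀ z ∈ resolventInterval c, ‖G z - q.eval z‖ ≤ ε) :
    ‖cfc G T - Polynomial.aeval T q‖ ≤ ε := by
  have hs := spectrum_subset_resolventInterval hT hn
  have hN : IsStarNormal T := hT.isSelfAdjoint.isStarNormal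
  rw [← cfc_polynomial q T, ← cfc_sub G (fun z => q.eval z) T (hG.mono hs)
    q.continuous.continuousOn]
  exact norm_cfc_le hε fun z hz => hq z (hs hz)

/-- If `T e = λ e` then `G(T) e = G(λ) e`. -/
theorem cfc_apply_of_eigenvector {T : H →L[ℂ] H} {c : ℝ} (hT : T.IsPositive)
    (hn : ‖T‖ ≤ (1 + c)⁻¹) {G : ℂ → ℂ} (hG : ContinuousOn G (resolventInterval c))
    {e : H} {z : ℂ} (hz : z ∈ resolventInterval c) (he : T e = z • e) :
    cfc G T e = G z • e := by
  have hpoly : ∀ q : Polynomial ℂ, Polynomial.aeval T q e = q.eval z • e := by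
    intro q
    induction q using Polynomial.induction_on with
    | C a => simp [Algebra.algebraMap_eq_smul_one]
    | add p q hp hq => simp [hp, hq, add_smul]
    | monomial n a h =>
      have : ∀ k : ℕ, (T ^ k) e = z ^ k • e := by
        intro k
        induction k with
        | zero => simp
        | succ k ih => rw [pow_succ', mul_apply_eq_comp, ih, map_smul, he, smul_smul,
            pow_succ]
      simp [Algebra.algebraMap_eq_smul_one, this, smul_smul]
  rw [← sub_eq_zero, ← norm_le_zero_iff]
  refine le_of_forall_pos_le_add fun ε hε => ?_
  have hd : 0 < ε / (2 * (‖e‖ + 1)) := by positivity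
  obtain ⟨q, hq⟩ := exists_polynomial_near hG hd
  have h1 := norm_cfc_sub_aeval_le hT hn hG hd.le hq
  have h2 : cfc G T e - G z • e =
      (cfc G T - Polynomial.aeval T q) e - (G z - q.eval z) • e := by
    rw [sub_apply, hpoly, sub_smul]; abel
  rw [h2]
  have h3 : ‖(cfc G T - Polynomial.aeval T q) e‖ ≤ ε / (2 * (‖e‖ + 1)) * ‖e‖ :=
    (ContinuousLinearMap.le_opNorm _ _).trans (by gcongr)
  have h4 : ‖(G z - q.eval z) • e‖ ≤ ε / (2 * (‖e‖ + 1)) * ‖e‖ := by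
    rw [norm_smul]; gcongr; exact hq z hz
  have h5 : ε / (2 * (‖e‖ + 1)) * ‖e‖ ≤ ε / 2 := by
    rw [div_mul_eq_mul_div, div_le_div_iff₀ (by positivity) (by positivity)]
    nlinarith [norm_nonneg e]
  linarith [norm_sub_le ((cfc G T - Polynomial.aeval T q) e) ((G z - q.eval z) • e)]

/-- The continuous functional calculus is strongly continuous. -/
theorem tendsto_cfc_apply {ι : Type*} {l : Filter ι} {T : ι → H →L[ℂ] H} {S : H →L[ℂ] H} {c : ℝ}
    (hT : ∀ᶠ i in l, (T i).IsPositive ∧ ‖T i‖ ≤ (1 + c)⁻¹) (hS : S.IsPositive)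
    (hSn : ‖S‖ ≤ (1 + c)⁻¹) (hlim : ∀ f, Tendsto (fun i => T i f) l (𝓝 (S f)))
    {G : ℂ → ℂ} (hG : ContinuousOn G (resolventInterval c)) (f : H) :
    Tendsto (fun i => cfc G (T i) f) l (𝓝 (cfc G S f)) := by
  have hpow : ∀ k : ℕ, ∀ f, Tendsto (fun i => (T i ^ k) f) l (𝓝 ((S ^ k) f)) := by
    intro k
    induction k with
    | zero => intro f; simpa using tendsto_const_nhds
    | succ k ih =>
      intro f
      simp only [pow_succ', mul_apply_eq_comp]
      have h1 : Tendsto (fun i => T i ((T i ^ k) f - (S ^ k) f)) l (𝓝 0) := by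
        refine squeeze_zero_norm' (a := fun i => (1 + c)⁻¹ * ‖(T i ^ k) f - (S ^ k) f‖) ?_ ?_
        · filter_upwards [hT] with i hi
          exact (ContinuousLinearMap.le_opNorm _ _).trans (by gcongr; exact hi.2)
        · have := ((ih f).sub_const ((S ^ k) f)).norm.const_mul ((1 + c)⁻¹)
          simpa using this
      have := h1.add (hlim ((S ^ k) f))
      simpa using this
  have hpoly : ∀ q : Polynomial ℂ, Tendsto (fun i => Polynomial.aeval (T i) q f) l
      (𝓝 (Polynomial.aeval S q f)) := by
    intro q
    induction q using Polynomial.induction_on with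
    | C a => simpa [Algebra.algebraMap_eq_smul_one] using tendsto_const_nhds
    | add p q hp hq => simpa using hp.add hq
    | monomial n a h =>
      simpa [Algebra.algebraMap_eq_smul_one] using (hpow (n + 1) f).const_smul a
  rw [Metric.tendsto_nhds]
  intro ε hε
  have hd : 0 < ε / (4 * (‖f‖ + 1)) := by positivity
  obtain ⟨q, hq⟩ := exists_polynomial_near hG hd
  have h5 : ε / (4 * (‖f‖ + 1)) * ‖f‖ ≤ ε / 4 := by
    rw [div_mul_eq_mul_div, div_le_div_iff₀ (by positivity) (by positivity)]
    nlinarith [norm_nonneg f]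
  have key : ∀ B : H →L[ℂ] H, B.IsPositive → ‖B‖ ≤ (1 + c)⁻¹ →
      ‖cfc G B f - Polynomial.aeval B q f‖ ≤ ε / 4 := fun B hB hBn => by
    rw [← sub_apply]
    exact (ContinuousLinearMap.le_opNorm _ _).trans
      ((mul_le_mul_of_nonneg_right (norm_cfc_sub_aeval_le hB hBn hG hd.le hq)
        (norm_nonneg f)).trans h5)
  filter_upwards [hT, Metric.tendsto_nhds.1 (hpoly q) (ε / 4) (by positivity)] with i hi hi2
  rw [dist_eq_norm] at hi2 ⊢
  have e : cfc G (T i) f - cfc G S f = (cfc G (T i) f - Polynomial.aeval (T i) q f) +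
      (Polynomial.aeval (T i) q f - Polynomial.aeval S q f) -
      (cfc G S f - Polynomial.aeval S q f) := by abel
  rw [e]
  have a1 := key _ hi.1 hi.2
  have a2 := key _ hS hSn
  have a3 := norm_sub_le ((cfc G (T i) f - Polynomial.aeval (T i) q f) +
      (Polynomial.aeval (T i) q f - Polynomial.aeval S q f)) (cfc G S f - Polynomial.aeval S q f)
  have a4 := norm_add_le (cfc G (T i) f - Polynomial.aeval (T i) q f)
      (Polynomial.aeval (T i) q f - Polynomial.aeval S q f)
  linarith

open scoped ComplexOrder in
/-- If `|G| ≤ |K|` on the spectrum then `‖G(T) f‖ ≤ ‖K(T) f‖`. -/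
theorem norm_cfc_apply_le {T : H →L[ℂ] H} (hT : IsSelfAdjoint T) {G K : ℂ → ℂ}
    (hG : ContinuousOn G (spectrum ℂ T)) (hK : ContinuousOn K (spectrum ℂ T))
    (hle : ∀ z ∈ spectrum ℂ T, ‖G z‖ ≤ ‖K z‖) (f : H) : ‖cfc G T f‖ ≤ ‖cfc K T f‖ := by
  have hN : IsStarNormal T := hT.isStarNormal
  have hsq : ∀ B : H →L[ℂ] H, ‖B f‖ ^ 2 = RCLike.re ⟪(star B * B) f, f⟫_ℂ := fun B => by
    change _ = RCLike.re ⟪ContinuousLinearMap.adjoint B (B f), f⟫_ℂ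
    rw [ContinuousLinearMap.adjoint_inner_left, inner_self_eq_norm_sq]
  have h1 : (0 : H →L[ℂ] H) ≤ star (cfc K T) * cfc K T - star (cfc G T) * cfc G T := by
    rw [← cfc_star, ← cfc_star, ← cfc_mul (fun z => star (G z)) G T hG.star hG,
      ← cfc_mul (fun z => star (K z)) K T hK.star hK,
      ← cfc_sub (fun z => star (K z) * K z) (fun z => star (G z) * G z) T (hK.star.mul hK)
        (hG.star.mul hG)]
    refine cfc_nonneg fun z hz => ?_
    have e : ∀ w : ℂ, star w * w = ((‖w‖ ^ 2 : ℝ) : ℂ) := fun w => by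
      rw [Complex.star_def, Complex.conj_mul']; push_cast; rfl
    rw [e, e, ← Complex.ofReal_sub]
    exact Complex.zero_le_real.2 (sub_nonneg.2 (pow_le_pow_left₀ (norm_nonneg _) (hle z hz) 2))
  have h2 := ((ContinuousLinearMap.nonneg_iff_isPositive _).1 h1).re_inner_nonneg_left f
  rw [sub_apply, inner_sub_left, map_sub, ← hsq, ← hsq] at h2
  exact (sq_le_sq₀ (norm_nonneg _) (norm_nonneg _)).1 (by linarith)

end FunctionalCalculus

/-! ### Bounded functions of a positive self-adjoint operator -/

section FunctionalCalculus

variable {H : Type*} [NormedAddCommGroup H] [InnerProductSpace ℂ H] [CompleteSpace H]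

namespace IsPosResolvent

variable {A : H →ₗ.[ℂ] H} {c C : ℝ} {T : H →L[ℂ] H} {F G : ℝ → ℂ}

theorem spectrum_subset (h : IsPosResolvent A c T) : spectrum ℂ T ⊆ resolventInterval c :=
  spectrum_subset_resolventInterval h.pos h.norm_le

theorem continuousOn (h : IsPosResolvent A c T) (hF : IsBddSymbol F c C) :
    ContinuousOn (resolventSymbol F) (spectrum ℂ T) :=
  (hF.continuousOn_resolventSymbol h.bound_nonneg).mono h.spectrum_subset

/-- On the range of the resolvent, `F(A)` is the continuous functional calculus of the resolvent. -/
theorem funCalc_apply (h : IsPosResolvent A c T) (hF : IsBddSymbol F c C) (f : H) :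
    funCalc A F (T f) = cfc (resolventSymbol F) T f := by
  have e := h.resolventOne_eq
  have := funCalc_resolventOne A F (by rw [e]; exact h.isSelfAdjoint) (by rw [e]; exact h.dense) C
    (by rw [e]; exact h.continuousOn hF)
    (by rw [e]; exact fun z hz => hF.norm_resolventSymbol_le h.bound_nonneg (h.spectrum_subset hz))
    f
  rw [e] at this
  exact this

theorem norm_funCalc_le (h : IsPosResolvent A c T) (hF : IsBddSymbol F c C) (f : H) :
    ‖funCalc A F f‖ ≤ C * ‖f‖ := by
  refine h.dense.induction_on (p := fun f => ‖funCalc A F f‖ ≤ C * ‖f‖) f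
    (isClosed_le (by fun_prop) (by fun_prop)) fun f => ?_
  have hN := h.isStarNormal
  rw [h.funCalc_apply hF]
  have h1 := norm_cfc_apply_le h.isSelfAdjoint (G := resolventSymbol F) (K := fun z => (C : ℂ) * z)
    (h.continuousOn hF) (by fun_prop) (fun z hz => by
      rw [norm_mul, Complex.norm_real, Real.norm_of_nonneg hF.nonneg]
      exact hF.norm_resolventSymbol_le h.bound_nonneg (h.spectrum_subset hz)) f
  rw [cfc_const_mul (C : ℂ) (fun z => z) T, cfc_id' ℂ T, smul_apply, norm_smul,
    Complex.norm_real, Real.norm_of_nonneg hF.nonneg] at h1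
  exact h1

theorem funCalc_add (h : IsPosResolvent A c T) {D : ℝ} (hF : IsBddSymbol F c C)
    (hG : IsBddSymbol G c D) :
    funCalc A (fun x => F x + G x) = funCalc A F + funCalc A G := by
  refine h.ext_of_dense fun f => ?_
  have hN := h.isStarNormal
  rw [add_apply, h.funCalc_apply hF, h.funCalc_apply hG,
    h.funCalc_apply (hF.add hG), ← add_apply,
    ← cfc_add T _ _ (h.continuousOn hF) (h.continuousOn hG)]
  congr 2
  ext z
  simp [resolventSymbol, mul_add]

theorem funCalc_const_mul (h : IsPosResolvent A c T) (hF : IsBddSymbol F c C) (a : ℂ) :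
    funCalc A (fun x => a * F x) = a • funCalc A F := by
  refine h.ext_of_dense fun f => ?_
  have hN := h.isStarNormal
  rw [smul_apply, h.funCalc_apply hF,
    h.funCalc_apply (hF.const_mul a), ← smul_apply,
    ← cfc_smul a _ T (h.continuousOn hF)]
  congr 2
  ext z
  simp [resolventSymbol]; ring

theorem funCalc_one (h : IsPosResolvent A c T) : funCalc A (fun _ => 1) = 1 := by
  refine h.ext_of_dense fun f => ?_
  have hN := h.isStarNormal
  rw [h.funCalc_apply (isBddSymbol_const 1 c)]
  have : resolventSymbol (fun _ => 1) = fun z => z := by ext z; simp [resolventSymbol]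
  rw [this, cfc_id' ℂ T]; simp

theorem funCalc_congr (h : IsPosResolvent A c T) (hF : IsBddSymbol F c C)
    (hFG : ∀ x, c ≤ x → F x = G x) : funCalc A F = funCalc A G := by
  have hG : IsBddSymbol G c C :=
    ⟨hF.cont.congr fun x hx => (hFG x hx).symm, fun x hx => hFG x hx ▸ hF.bound x hx⟩
  refine h.ext_of_dense fun f => ?_
  rw [h.funCalc_apply hF, h.funCalc_apply hG]
  congr 1
  refine cfc_congr fun z hz => ?_
  obtain ⟨x, hx, rfl⟩ := h.spectrum_subset hz
  rcases hx.1.eq_or_lt with h0 | h0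
  · simp [resolventSymbol, ← h0]
  · simp only [resolventSymbol, Complex.ofReal_re]
    rw [hFG _ (le_inv_sub_one h.bound_nonneg h0 hx.2)]

theorem funCalc_sub (h : IsPosResolvent A c T) {D : ℝ} (hF : IsBddSymbol F c C)
    (hG : IsBddSymbol G c D) :
    funCalc A (fun x => F x - G x) = funCalc A F - funCalc A G := by
  have := h.funCalc_add hF (hG.const_mul (-1))
  rw [h.funCalc_const_mul hG] at this
  simp only [neg_mul, one_mul, neg_smul, one_smul, ← sub_eq_add_neg] at this
  exact this

theorem funCalc_comm (h : IsPosResolvent A c T) (hF : IsBddSymbol F c C) (f : H) :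
    funCalc A F (T f) = T (funCalc A F f) := by
  refine h.dense.induction_on (p := fun f => funCalc A F (T f) = T (funCalc A F f)) f
    (isClosed_eq (by fun_prop) (by fun_prop)) fun f => ?_
  have hN := h.isStarNormal
  rw [h.funCalc_apply hF, h.funCalc_apply hF]
  have : Commute (cfc (resolventSymbol F) T) T := by
    have := cfc_commute_cfc (resolventSymbol F) (fun z => z) T
    rwa [cfc_id' ℂ T] at this
  exact congrArg (fun B : H →L[ℂ] H => B f) this.eq

theorem inner_funCalc_right (h : IsPosResolvent A c T) (hF : IsBddSymbol F c C) (f g : H) :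
    ⟪f, funCalc A F g⟫_ℂ = ⟪funCalc A (fun x => star (F x)) f, g⟫_ℂ := by
  have hN := h.isStarNormal
  refine h.dense.induction_on
    (p := fun f => ⟪f, funCalc A F g⟫_ℂ = ⟪funCalc A (fun x => star (F x)) f, g⟫_ℂ) f
    (isClosed_eq (by fun_prop) (by fun_prop)) fun f => ?_
  rw [h.funCalc_apply hF.conj]
  have e1 : resolventSymbol (fun x => star (F x)) =ᶠ[𝓟 (spectrum ℂ T)]
      fun z => star (resolventSymbol F z) := by
    refine eventually_principal.2 fun z hz => ?_
    obtain ⟨x, -, rfl⟩ := h.spectrum_subset hz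
    simp [resolventSymbol]
  have hT : ∀ u v : H, ⟪T u, v⟫_ℂ = ⟪u, T v⟫_ℂ := fun u v => h.pos.isSymmetric u v
  rw [cfc_congr (eventually_principal.1 e1), cfc_star, hT, ← h.funCalc_comm hF,
    h.funCalc_apply hF]
  exact (ContinuousLinearMap.adjoint_inner_left _ _ _).symm

theorem inner_funCalc_left (h : IsPosResolvent A c T) (hF : IsBddSymbol F c C)
    (hr : ∀ x, star (F x) = F x) (f g : H) :
    ⟪funCalc A F f, g⟫_ℂ = ⟪f, funCalc A F g⟫_ℂ := by
  rw [h.inner_funCalc_right hF]; simp only [hr]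

open scoped ComplexOrder in
theorem re_inner_funCalc_nonneg (h : IsPosResolvent A c T) (hF : IsBddSymbol F c C)
    (h0 : ∀ x, c ≤ x → 0 ≤ F x) (f : H) : 0 ≤ RCLike.re ⟪f, funCalc A F f⟫_ℂ := by
  have hN := h.isStarNormal
  refine h.dense.induction_on (p := fun f => 0 ≤ RCLike.re ⟪f, funCalc A F f⟫_ℂ) f
    (isClosed_le (by fun_prop) (by fun_prop)) fun f => ?_
  have hT : ∀ u v : H, ⟪T u, v⟫_ℂ = ⟪u, T v⟫_ℂ := fun u v => h.pos.isSymmetric u v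
  rw [h.funCalc_apply hF, hT]
  have h1 : (0 : H →L[ℂ] H) ≤ T * cfc (resolventSymbol F) T := by
    conv_rhs => enter [1]; rw [← cfc_id' ℂ T]
    rw [← cfc_mul (fun z => z) _ T (by fun_prop) (h.continuousOn hF)]
    refine cfc_nonneg fun z hz => ?_
    obtain ⟨x, hx, rfl⟩ := h.spectrum_subset hz
    rcases hx.1.eq_or_lt with h2 | h2
    · simp [resolventSymbol, ← h2]
    · have h3 := h0 _ (le_inv_sub_one h.bound_nonneg h2 hx.2)
      have h4 : (0 : ℂ) ≤ (x : ℂ) := Complex.zero_le_real.2 hx.1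
      simp only [resolventSymbol, Complex.ofReal_re]
      exact mul_nonneg h4 (mul_nonneg h4 h3)
  exact ((ContinuousLinearMap.nonneg_iff_isPositive _).1 h1).re_inner_nonneg_right f

/-- If `T e = (1 + x)⁻¹ e` then `F(A) e = F(x) e`. -/
theorem funCalc_eigenvector (h : IsPosResolvent A c T) (hF : IsBddSymbol F c C) {x : ℝ}
    (hx : c ≤ x) {e : H} (he : T e = (((1 + x)⁻¹ : ℝ) : ℂ) • e) : funCalc A F e = F x • e := by
  have hx1 : 0 < 1 + x := by linarith [h.bound_nonneg]
  have hc1 : 0 < 1 + c := by linarith [h.bound_nonneg]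
  have hne : (((1 + x)⁻¹ : ℝ) : ℂ) ≠ 0 := by exact_mod_cast (inv_pos.2 hx1).ne'
  have h1 := h.funCalc_apply hF e
  rw [cfc_apply_of_eigenvector h.pos h.norm_le (hF.continuousOn_resolventSymbol h.bound_nonneg)
    (z := (((1 + x)⁻¹ : ℝ) : ℂ)) ⟨(1 + x)⁻¹, ⟨by positivity, by gcongr⟩, rfl⟩ he, he, map_smul]
    at h1
  simp only [resolventSymbol, Complex.ofReal_re, inv_inv, add_sub_cancel_left, mul_smul] at h1
  exact smul_right_injective _ hne h1

end IsPosResolvent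

/-- Strong resolvent convergence implies strong convergence of all bounded continuous functions
of the operators. -/
theorem tendsto_funCalc_apply {ι : Type*} {l : Filter ι} {A : ι → H →ₗ.[ℂ] H} {B : H →ₗ.[ℂ] H}
    {T : ι → H →L[ℂ] H} {S : H →L[ℂ] H} {c C : ℝ} (hT : ∀ᶠ i in l, IsPosResolvent (A i) c (T i))
    (hS : IsPosResolvent B c S) (hlim : ∀ f, Tendsto (fun i => T i f) l (𝓝 (S f)))
    {F : ℝ → ℂ} (hF : IsBddSymbol F c C) {g : ι → H} {g' : H} (hg : Tendsto g l (𝓝 g')) :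
    Tendsto (fun i => funCalc (A i) F (g i)) l (𝓝 (funCalc B F g')) := by
  -- on the range of `S` the convergence comes from the continuous functional calculus
  have h1 : ∀ f, Tendsto (fun i => funCalc (A i) F (S f)) l (𝓝 (funCalc B F (S f))) := by
    intro f
    have a1 := tendsto_cfc_apply (hT.mono fun i hi => ⟨hi.pos, hi.norm_le⟩) hS.pos hS.norm_le hlim
      (hF.continuousOn_resolventSymbol hS.bound_nonneg) f
    rw [← hS.funCalc_apply hF] at a1
    have a2 : Tendsto (fun i => funCalc (A i) F (S f - T i f)) l (𝓝 0) := by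
      refine squeeze_zero_norm' (hT.mono fun i hi => hi.norm_funCalc_le hF _) ?_
      simpa using ((hlim f).const_sub (S f)).norm.const_mul C
    have a3 := a1.add a2
    rw [add_zero] at a3
    refine a3.congr' (hT.mono fun i hi => ?_)
    rw [← hi.funCalc_apply hF, ← map_add]; congr 1; abel
  have h2 : ∀ f, Tendsto (fun i => funCalc (A i) F f) l (𝓝 (funCalc B F f)) := by
    intro f
    rw [Metric.tendsto_nhds]
    intro ε hε
    have hC := hF.nonneg
    obtain ⟨v, hv⟩ := Metric.denseRange_iff.1 hS.dense f (ε / (4 * (C + 1))) (by positivity)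
    rw [dist_eq_norm] at hv
    have hb : C * ‖f - S v‖ ≤ ε / 4 := by
      calc C * ‖f - S v‖ ≤ C * (ε / (4 * (C + 1))) := by gcongr
        _ ≤ ε / 4 := by
          rw [mul_div_assoc', div_le_div_iff₀ (by positivity) (by positivity)]; nlinarith
    filter_upwards [hT, Metric.tendsto_nhds.1 (h1 v) (ε / 4) (by positivity)] with i hi hi2
    rw [dist_eq_norm] at hi2 ⊢
    have e : funCalc (A i) F f - funCalc B F f = funCalc (A i) F (f - S v) +
      (funCalc (A i) F (S v) - funCalc B F (S v)) - funCalc B F (f - S v) := by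
      rw [map_sub, map_sub]; abel
    rw [e]
    have b1 := (hi.norm_funCalc_le hF (f - S v)).trans hb
    have b2 := (hS.norm_funCalc_le hF (f - S v)).trans hb
    have b3 := norm_sub_le (funCalc (A i) F (f - S v) +
      (funCalc (A i) F (S v) - funCalc B F (S v))) (funCalc B F (f - S v))
    have b4 := norm_add_le (funCalc (A i) F (f - S v))
      (funCalc (A i) F (S v) - funCalc B F (S v))
    linarith
  have h3 : Tendsto (fun i => funCalc (A i) F (g i - g')) l (𝓝 0) := by
    refine squeeze_zero_norm' (hT.mono fun i hi => hi.norm_funCalc_le hF _) ?_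
    simpa using (hg.sub_const g').norm.const_mul C
  have := h3.add (h2 g')
  simpa using this

end FunctionalCalculus

/-! ### Thermal scalar products -/

section Thermal

variable {H : Type*} [NormedAddCommGroup H] [InnerProductSpace ℂ H] [CompleteSpace H]

theorem isBddSymbol_evol (c μ t : ℝ) :
    IsBddSymbol (fun ε => Complex.exp (Complex.I * (t * (ε - μ) : ℝ))) c 1 :=
  ⟨by fun_prop, fun x _ => by rw [mul_comm, Complex.norm_exp_ofReal_mul_I]⟩

theorem exp_sub_one_pos {β x : ℝ} (hβ : 0 < β) (hx : 0 < x) : 0 < Real.exp (β * x) - 1 :=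
  sub_pos.2 (Real.one_lt_exp_iff.2 (mul_pos hβ hx))

theorem isBddSymbol_bose {β c μ : ℝ} (hβ : 0 < β) (hμ : μ < c) :
    IsBddSymbol (fun ε => (((Real.exp (β * (ε - μ)) - 1)⁻¹ : ℝ) : ℂ)) c
      (Real.exp (β * (c - μ)) - 1)⁻¹ := by
  refine ⟨Complex.continuous_ofReal.comp_continuousOn (ContinuousOn.inv₀ (by fun_prop)
    fun x hx => (exp_sub_one_pos hβ (by linarith [Set.mem_Ici.1 hx])).ne'), fun x hx => ?_⟩
  have h1 := exp_sub_one_pos hβ (x := c - μ) (by linarith)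
  have h2 := exp_sub_one_pos hβ (x := x - μ) (by linarith)
  rw [Complex.norm_real, Real.norm_of_nonneg (by positivity)]
  gcongr

theorem expBose_eq {β c μ : ℝ} (hβ : 0 < β) (hμ : μ < c) {x : ℝ} (hx : c ≤ x) :
    (1 : ℂ) + (((Real.exp (β * (x - μ)) - 1)⁻¹ : ℝ) : ℂ) =
      ((Real.exp (β * (x - μ)) * (Real.exp (β * (x - μ)) - 1)⁻¹ : ℝ) : ℂ) := by
  have h2 := exp_sub_one_pos hβ (x := x - μ) (by linarith)
  rw [← Complex.ofReal_one, ← Complex.ofReal_add]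
  congr 1
  field_simp
  ring

theorem isBddSymbol_expBose {β c μ : ℝ} (hβ : 0 < β) (hμ : μ < c) :
    IsBddSymbol (fun ε =>
      ((Real.exp (β * (ε - μ)) * (Real.exp (β * (ε - μ)) - 1)⁻¹ : ℝ) : ℂ)) c
      (‖(1 : ℂ)‖ + (Real.exp (β * (c - μ)) - 1)⁻¹) := by
  have h := (isBddSymbol_const 1 c).add (isBddSymbol_bose hβ hμ)
  exact ⟨h.cont.congr fun x hx => (expBose_eq hβ hμ hx).symm,
    fun x hx => expBose_eq hβ hμ hx ▸ h.bound x hx⟩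

namespace IsPosResolvent

variable {A : H →ₗ.[ℂ] H} {c : ℝ} {T : H →L[ℂ] H}

theorem expBoseOp_eq (h : IsPosResolvent A c T) {β μ : ℝ} (hβ : 0 < β) (hμ : μ < c) :
    expBoseOp A β μ = 1 + boseOp A β μ := by
  rw [← h.funCalc_one]
  refine Eq.trans ?_ (h.funCalc_add (isBddSymbol_const 1 c) (isBddSymbol_bose hβ hμ))
  exact (h.funCalc_congr ((isBddSymbol_const 1 c).add (isBddSymbol_bose hβ hμ))
    fun x hx => expBose_eq hβ hμ hx).symm

theorem evol_eq_smul (h : IsPosResolvent A c T) (μ ν t : ℝ) :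
    evol A μ t = Complex.exp (Complex.I * (t * (ν - μ) : ℝ)) • evol A ν t := by
  rw [evol, evol, ← h.funCalc_const_mul (isBddSymbol_evol c ν t)]
  congr 1
  ext x
  rw [← Complex.exp_add]
  congr 1
  push_cast
  ring

theorem continuous_evol (h : IsPosResolvent A c T) (μ : ℝ) (g : H) :
    Continuous fun t => evol A μ t g := by
  have hN := h.isStarNormal
  have hb : ∀ t, ∀ f, ‖evol A μ t f‖ ≤ ‖f‖ := fun t f =>
    (h.norm_funCalc_le (isBddSymbol_evol c μ t) f).trans_eq (one_mul _)
  -- on the range of the resolvent the evolution is Lipschitz in time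
  have hlip : ∀ f, ∀ t s, ‖evol A μ t (T f) - evol A μ s (T f)‖ ≤ (2 + |μ|) * ‖f‖ * |t - s| := by
    intro f t s
    have e : evol A μ t (T f) - evol A μ s (T f) = (cfc (fun z =>
        resolventSymbol (fun ε => Complex.exp (Complex.I * (t * (ε - μ) : ℝ))) z -
        resolventSymbol (fun ε => Complex.exp (Complex.I * (s * (ε - μ) : ℝ))) z) T) f := by
      rw [cfc_sub _ _ T (h.continuousOn (isBddSymbol_evol c μ t))
        (h.continuousOn (isBddSymbol_evol c μ s)), sub_apply, evol, evol,
        h.funCalc_apply (isBddSymbol_evol c μ t), h.funCalc_apply (isBddSymbol_evol c μ s)]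
    rw [e]
    refine (ContinuousLinearMap.le_opNorm _ _).trans ?_
    rw [mul_right_comm]
    refine mul_le_mul_of_nonneg_right ?_ (norm_nonneg f)
    refine norm_cfc_le (by positivity) fun z hz => ?_
    obtain ⟨x, hx, rfl⟩ := h.spectrum_subset hz
    have hx1 : x ≤ 1 := hx.2.trans (inv_le_one_of_one_le₀ (by linarith [h.bound_nonneg]))
    rcases hx.1.eq_or_lt with h0 | h0
    · simp only [resolventSymbol, ← h0]; simp; positivity
    · simp only [resolventSymbol, Complex.ofReal_re]
      rw [← mul_sub, norm_mul, Complex.norm_real, Real.norm_of_nonneg hx.1]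
      have e2 : ∀ a b : ℝ, ‖Complex.exp (Complex.I * (a : ℝ)) - Complex.exp (Complex.I * (b : ℝ))‖
          ≤ |a - b| := by
        intro a b
        have e3 : Complex.exp (Complex.I * (a : ℝ)) - Complex.exp (Complex.I * (b : ℝ)) =
          Complex.exp (Complex.I * (b : ℝ)) * (Complex.exp (Complex.I * ((a - b : ℝ) : ℂ)) - 1) := by
          rw [mul_sub, ← Complex.exp_add]; push_cast; ring_nf
        rw [e3, norm_mul, mul_comm Complex.I (b : ℂ), Complex.norm_exp_ofReal_mul_I, one_mul]
        exact Real.norm_exp_I_mul_ofReal_sub_one_le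
      refine (mul_le_mul_of_nonneg_left (e2 _ _) hx.1).trans ?_
      rw [← sub_mul, abs_mul, mul_left_comm, mul_comm]
      refine mul_le_mul_of_nonneg_right ?_ (abs_nonneg _)
      calc x * |x⁻¹ - 1 - μ| = |x * (x⁻¹ - 1 - μ)| := by rw [abs_mul, abs_of_pos h0]
        _ = |1 - x - x * μ| := by congr 1; field_simp
        _ ≤ |1 - x| + |x * μ| := abs_sub _ _
        _ ≤ 2 + |μ| := by
          rw [abs_mul, abs_of_pos h0, abs_of_nonneg (by linarith)]
          nlinarith [abs_nonneg μ]
  refine continuous_of_uniform_approx_of_continuous fun u hu => ?_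
  obtain ⟨ε, hε, hu⟩ := Metric.mem_uniformity_dist.1 hu
  obtain ⟨f, hf⟩ := Metric.denseRange_iff.1 h.dense g ε hε
  refine ⟨fun t => evol A μ t (T f), ?_, fun t => hu ?_⟩
  · refine (LipschitzWith.of_dist_le_mul (K := ⟨(2 + |μ|) * ‖f‖, by positivity⟩)
      fun t s => ?_).continuous
    rw [dist_eq_norm, Real.dist_eq]
    exact hlip f t s
  · rw [dist_eq_norm, ← map_sub]
    rw [dist_eq_norm] at hf
    exact (hb _ _).trans_lt hf

theorem thermal_eq (h : IsPosResolvent A c T) {β μ : ℝ} (hβ : 0 < β) (hμ : μ < c) (f g : H) :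
    thermal A β μ f g =
      (1 / 2) * (⟪f, g⟫_ℂ + ⟪f, boseOp A β μ g⟫_ℂ + ⟪g, boseOp A β μ f⟫_ℂ) := by
  rw [thermal, h.expBoseOp_eq hβ hμ, add_apply, one_apply_eq_self, inner_add_right]

theorem thermal_self (h : IsPosResolvent A c T) {β μ : ℝ} (hβ : 0 < β) (hμ : μ < c) (f : H) :
    thermal A β μ f f = ((‖f‖ ^ 2 / 2 + RCLike.re ⟪f, boseOp A β μ f⟫_ℂ : ℝ) : ℂ) := by
  have h1 : ⟪f, boseOp A β μ f⟫_ℂ = ((RCLike.re ⟪f, boseOp A β μ f⟫_ℂ : ℝ) : ℂ) := by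
    refine (RCLike.conj_eq_iff_re.1 ?_).symm
    rw [inner_conj_symm]
    exact h.inner_funCalc_left (isBddSymbol_bose hβ hμ) (fun x => Complex.conj_ofReal _) f f
  rw [h.thermal_eq hβ hμ, inner_self_eq_norm_sq_to_K]
  conv_lhs => rw [h1]
  push_cast
  ring_nf
  exact add_comm _ _

end IsPosResolvent

/-- The thermodynamic limit of thermal two-point functions, for Hamiltonians that converge in the
strong resolvent sense. -/
theorem tendsto_thermal {ι : Type*} {l : Filter ι} {A : ι → H →ₗ.[ℂ] H} {B : H →ₗ.[ℂ] H}
    {T : ι → H →L[ℂ] H} {S : H →L[ℂ] H} (hT : ∀ᶠ i in l, IsPosResolvent (A i) 0 (T i))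
    (hS : IsPosResolvent B 0 S) (hlim : ∀ f, Tendsto (fun i => T i f) l (𝓝 (S f)))
    {β μ : ℝ} (hβ : 0 < β) (hμ : μ < 0) (t : ℝ) (f g : H) :
    Tendsto (fun i => thermal (A i) β μ f (evol (A i) μ t g)) l
      (𝓝 (thermal B β μ f (evol B μ t g))) := by
  have h1 : Tendsto (fun i => evol (A i) μ t g) l (𝓝 (evol B μ t g)) :=
    tendsto_funCalc_apply hT hS hlim (isBddSymbol_evol 0 μ t) tendsto_const_nhds
  have h2 : Tendsto (fun i => expBoseOp (A i) β μ (evol (A i) μ t g)) l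
      (𝓝 (expBoseOp B β μ (evol B μ t g))) :=
    tendsto_funCalc_apply hT hS hlim (isBddSymbol_expBose hβ hμ) h1
  have h3 : Tendsto (fun i => boseOp (A i) β μ f) l (𝓝 (boseOp B β μ f)) :=
    tendsto_funCalc_apply hT hS hlim (isBddSymbol_bose hβ hμ) tendsto_const_nhds
  exact ((tendsto_const_nhds.inner h2).add (h1.inner h3)).const_mul _

end Thermal

/-! ### Operators with compact resolvent: the ground state and its spectral gap -/

section CompactResolvent

variable {H : Type*} [NormedAddCommGroup H] [InnerProductSpace ℂ H]

theorem mem_eigenspace_iff {A : H →ₗ.[ℂ] H} {T : H →L[ℂ] H} (h : IsResolventAt A (-1) T) {x : ℝ}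
    (hx : 1 + x ≠ 0) {u : H} : u ∈ eigenspace A x ↔ T u = (((1 + x)⁻¹ : ℝ) : ℂ) • u := by
  have hx' : (1 + (x : ℂ)) ≠ 0 := by exact_mod_cast hx
  have e0 : u ∈ eigenspace A x ↔ ∃ y : A.domain, (y : H) = u ∧ A y = (x : ℂ) • u := by
    rw [eigenspace, Submodule.mem_comap, LinearPMap.mem_graph_iff]; rfl
  rw [e0]
  constructor
  · rintro ⟨y, rfl, hy⟩
    have h2 := h.2 y
    rw [hy, ← sub_smul, map_smul] at h2
    have : ((x : ℂ) - -1) = 1 + x := by ring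
    rw [this] at h2
    conv_rhs => rw [← h2]
    rw [smul_smul]
    push_cast
    rw [inv_mul_cancel₀ hx', one_smul]
  · intro hu
    obtain ⟨h1, h2⟩ := h.1 ((1 + (x : ℂ)) • u)
    have e1 : T ((1 + (x : ℂ)) • u) = u := by
      rw [map_smul, hu, smul_smul]
      push_cast
      rw [mul_inv_cancel₀ hx', one_smul]
    refine ⟨⟨_, h1⟩, e1, ?_⟩
    rw [sub_eq_iff_eq_add.1 h2, e1]
    module

/-- The resolvent identity: `A - x` is invertible if `1 - (1 + x) (A + 1)⁻¹` is. -/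
theorem notMem_realSpectrum {A : H →ₗ.[ℂ] H} {T : H →L[ℂ] H} (h : IsResolventAt A (-1) T) {x : ℝ}
    (hx : IsUnit (1 - (1 + (x : ℂ)) • T)) : x ∉ realSpectrum A := by
  obtain ⟨U, hU⟩ := hx
  set S : H →L[ℂ] H := ((U⁻¹ : (H →L[ℂ] H)ˣ) : H →L[ℂ] H) with hS
  have h1 : ∀ f, S f - (1 + (x : ℂ)) • T (S f) = f := fun f => by
    have := congrArg (fun B : H →L[ℂ] H => B f) (U.mul_inv)
    rw [hU] at this
    simpa using this
  have h2 : ∀ f, S (f - (1 + (x : ℂ)) • T f) = f := fun f => by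
    have := congrArg (fun B : H →L[ℂ] H => B f) (U.inv_mul)
    rw [hU] at this
    simpa using this
  have h3 : ∀ f, S (T f) = T (S f) := by
    intro f
    conv_lhs => rw [← h1 f]
    have e : T (S f - (1 + (x : ℂ)) • T (S f)) = T (S f) - (1 + (x : ℂ)) • T (T (S f)) := by
      rw [map_sub, map_smul]
    rw [e, h2]
  refine fun hn => hn ⟨T * S, fun f => ?_, fun u => ?_⟩
  · obtain ⟨ha, hb⟩ := h.1 (S f)
    refine ⟨ha, ?_⟩
    have hb' := sub_eq_iff_eq_add.1 hb
    change A ⟨T (S f), ha⟩ - (x : ℂ) • T (S f) = f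
    rw [hb']
    conv_rhs => rw [← h1 f]
    module
  · have hb := h.2 u
    change T (S (A u - (x : ℂ) • (u : H))) = u
    rw [← h3]
    have e : T (A u - (x : ℂ) • (u : H)) = u - (1 + (x : ℂ)) • T u := by
      conv_rhs => enter [1]; rw [← hb]
      rw [map_sub, map_sub, map_smul, map_smul]
      module
    rw [e, h2]

namespace IsPosResolvent

variable {A : H →ₗ.[ℂ] H} {c : ℝ} {T : H →L[ℂ] H}

theorem injective (h : IsPosResolvent A c T) {f : H} (hf : T f = 0) : f = 0 := by
  have : ∀ g, ⟪g, f⟫_ℂ = 0 := fun g =>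
    h.dense.induction_on (p := fun g => ⟪g, f⟫_ℂ = 0) g (isClosed_eq (by fun_prop) (by fun_prop))
      fun g => by
        have : ⟪T g, f⟫_ℂ = ⟪g, T f⟫_ℂ := h.pos.isSymmetric g f
        rw [this, hf, inner_zero_right]
  exact inner_self_eq_zero.1 (this f)

theorem norm_pos [Nontrivial H] (h : IsPosResolvent A c T) : 0 < ‖T‖ := by
  rw [norm_pos_iff]
  rintro rfl
  obtain ⟨f, hf⟩ := exists_ne (0 : H)
  exact hf (h.injective rfl)

theorem norm_le_one (h : IsPosResolvent A c T) : ‖T‖ ≤ 1 :=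
  h.norm_le.trans (inv_le_one_of_one_le₀ (by linarith [h.bound_nonneg]))

/-- The norm of the resolvent gives the best lower bound, `A ≥ ‖(A + 1)⁻¹‖⁻¹ - 1`. -/
theorem optimal [Nontrivial H] (h : IsPosResolvent A c T) : IsPosResolvent A (‖T‖⁻¹ - 1) T :=
  ⟨h.resolvent, h.pos, h.dense, sub_nonneg.2 (one_le_inv₀ h.norm_pos |>.2 h.norm_le_one), by simp⟩

theorem mem_groundSpace_iff [Nontrivial H] (h : IsPosResolvent A c T) {u : H} :
    u ∈ eigenspace A (‖T‖⁻¹ - 1) ↔ T u = ((‖T‖ : ℝ) : ℂ) • u := by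
  rw [mem_eigenspace_iff h.resolvent (by simpa using h.norm_pos.ne')]
  simp

theorem isClosed_groundSpace [Nontrivial H] (h : IsPosResolvent A c T) :
    IsClosed (eigenspace A (‖T‖⁻¹ - 1) : Set H) := by
  have : (eigenspace A (‖T‖⁻¹ - 1) : Set H) = {u | T u = ((‖T‖ : ℝ) : ℂ) • u} := by
    ext u; exact h.mem_groundSpace_iff
  rw [this]
  exact isClosed_eq (by fun_prop) (by fun_prop)

end IsPosResolvent

variable [CompleteSpace H]

/-- The norm of a positive compact operator is an eigenvalue. -/
theorem exists_eigenvector_norm {T : H →L[ℂ] H} (hT : T.IsPositive) (hc : IsCompactOperator T)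
    (h0 : 0 < ‖T‖) : ∃ e : H, e ≠ 0 ∧ T e = ((‖T‖ : ℝ) : ℂ) • e := by
  have : Nontrivial (H →L[ℂ] H) := ⟨T, 0, norm_pos_iff.1 h0⟩
  have h1 : ‖T‖ ∈ spectrum ℝ T := CStarAlgebra.norm_mem_spectrum_of_nonneg
    (ha := (ContinuousLinearMap.nonneg_iff_isPositive T).2 hT)
  have h2 : ((‖T‖ : ℝ) : ℂ) ∈ spectrum ℂ T := spectrum.algebraMap_mem ℂ h1
  have h3 := (hc.hasEigenvalue_iff_mem_spectrum (by exact_mod_cast h0.ne')).2 h2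
  obtain ⟨e, he⟩ := h3.exists_hasEigenvector
  exact ⟨e, he.2, Module.End.mem_eigenspace_iff.1 he.1⟩

namespace IsPosResolvent

variable {A : H →ₗ.[ℂ] H} {c : ℝ} {T : H →L[ℂ] H}

theorem groundEnergy_eq [Nontrivial H] (h : IsPosResolvent A c T) (hc : IsCompactOperator T) :
    groundEnergy A = ‖T‖⁻¹ - 1 := by
  have h0 := h.norm_pos
  refine IsLeast.csInf_eq ⟨?_, fun x hx => ?_⟩
  · rintro ⟨R, hR⟩
    obtain ⟨e, he0, he⟩ := exists_eigenvector_norm h.pos hc h0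
    have hm : e ∈ eigenspace A (‖T‖⁻¹ - 1) := by
      rw [mem_eigenspace_iff h.resolvent (by simpa using h0.ne')]
      simpa using he
    obtain ⟨y, hy, hy2⟩ : ∃ y : A.domain, (y : H) = e ∧ A y = ((‖T‖⁻¹ - 1 : ℝ) : ℂ) • e := by
      rw [eigenspace, Submodule.mem_comap, LinearPMap.mem_graph_iff] at hm; exact hm
    have := hR.2 y
    rw [hy2, hy, sub_self, map_zero] at this
    exact he0 this.symm
  · by_contra hlt
    push Not at hlt
    refine notMem_realSpectrum h.resolvent ?_ hx
    by_cases h1 : 1 + x = 0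
    · have : (1 + (x : ℂ)) = 0 := by exact_mod_cast h1
      simp [this]
    have h1' : (1 + (x : ℂ)) ≠ 0 := by exact_mod_cast h1
    -- `(1 + x)⁻¹` lies outside `[0, ‖T‖]`
    have h2 : (((1 + x)⁻¹ : ℝ) : ℂ) ∉ spectrum ℂ T := by
      intro hm
      obtain ⟨y, hy, hy2⟩ := h.optimal.spectrum_subset hm
      have hy3 : y = (1 + x)⁻¹ := by exact_mod_cast hy2
      subst hy3
      have h3 : 0 < 1 + x := by
        rcases lt_or_gt_of_ne h1 with h4 | h4
        · exact absurd hy.1 (not_le.2 (inv_lt_zero.2 h4))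
        · exact h4
      have h5 := hy.2
      simp only [add_sub_cancel, inv_inv] at h5
      rw [inv_le_comm₀ h3 h0] at h5
      linarith
    rw [spectrum.notMem_iff] at h2
    have h6 : (1 - (1 + (x : ℂ)) • T) = (Units.mk0 _ h1') •
        (algebraMap ℂ (H →L[ℂ] H) (((1 + x)⁻¹ : ℝ) : ℂ) - T) := by
      rw [Units.smul_mk0, smul_sub, Algebra.algebraMap_eq_smul_one, smul_smul]
      push_cast
      rw [mul_inv_cancel₀ h1', one_smul]
    rw [h6]
    exact h2.smul _

theorem range_one_sub_groundProj [Nontrivial H] (h : IsPosResolvent A c T)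
    (hc : IsCompactOperator T) :
    LinearMap.range (1 - groundProj A).toLinearMap = (eigenspace A (‖T‖⁻¹ - 1))ᗮ := by
  have := Submodule.starProjection_orthogonal' (eigenspace A (groundEnergy A)).topologicalClosure
  rw [groundProj, ← this, Submodule.range_starProjection, Submodule.orthogonal_closure,
    h.groundEnergy_eq hc]

/-- The spectral gap: away from the ground states, the resolvent is strictly smaller than its
norm. -/
theorem exists_gap [Nontrivial H] (h : IsPosResolvent A c T) (hc : IsCompactOperator T) :
    ∃ r < ‖T‖, 0 ≤ r ∧ ∀ f ∈ (eigenspace A (‖T‖⁻¹ - 1))ᗮ, RCLike.re ⟪f, T f⟫_ℂ ≤ r * ‖f‖ ^ 2 := by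
  set W := eigenspace A (‖T‖⁻¹ - 1) with hW
  set Q := Wᗮ.starProjection with hQ
  have hsymm : ∀ u v : H, ⟪T u, v⟫_ℂ = ⟪u, T v⟫_ℂ := fun u v => h.pos.isSymmetric u v
  have hinv : ∀ f ∈ Wᗮ, T f ∈ Wᗮ := by
    intro f hf
    rw [Submodule.mem_orthogonal] at hf ⊢
    intro e he
    rw [← hsymm, h.mem_groundSpace_iff.1 he, inner_smul_left, hf e he, mul_zero]
  have hQf : ∀ f ∈ Wᗮ, Q f = f := fun f hf => Submodule.starProjection_eq_self_iff.2 hf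
  have hQm : ∀ f, Q f ∈ Wᗮ := fun f => Submodule.starProjection_apply_mem _ f
  have hQs : IsSelfAdjoint Q := isSelfAdjoint_starProjection _
  set S := Q * T * Q with hS
  have hSpos : S.IsPositive := by
    have := h.pos.conj_adjoint Q
    rwa [← ContinuousLinearMap.star_eq_adjoint, hQs.star_eq] at this
  have hSc : IsCompactOperator S := (hc.clm_comp Q).comp_clm Q
  have hSle : ‖S‖ ≤ ‖T‖ := by
    have h1 : ‖Q‖ ≤ 1 := Submodule.starProjection_norm_le _
    calc ‖S‖ ≤ ‖Q‖ * ‖T‖ * ‖Q‖ := (norm_mul_le _ _).trans (by gcongr; exact norm_mul_le _ _)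
      _ ≤ 1 * ‖T‖ * 1 := by gcongr
      _ = ‖T‖ := by ring
  refine ⟨‖S‖, lt_of_le_of_ne hSle fun heq => ?_, norm_nonneg _, fun f hf => ?_⟩
  · obtain ⟨e, he0, he⟩ := exists_eigenvector_norm hSpos hSc (heq ▸ h.norm_pos)
    rw [heq] at he
    have hne : ((‖T‖ : ℝ) : ℂ) ≠ 0 := by exact_mod_cast h.norm_pos.ne'
    have h1 : e ∈ Wᗮ := by
      have : e = ((‖T‖ : ℝ) : ℂ)⁻¹ • S e := by rw [he, smul_smul, inv_mul_cancel₀ hne, one_smul]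
      rw [this]
      exact Submodule.smul_mem _ _ (hQm _)
    have h2 : T e = ((‖T‖ : ℝ) : ℂ) • e := by
      have : S e = T e := by
        change Q (T (Q e)) = T e
        rw [hQf e h1, hQf _ (hinv e h1)]
      rw [← this, he]
    have h3 : e ∈ W := h.mem_groundSpace_iff.2 h2
    exact he0 (inner_self_eq_zero.1 ((Submodule.mem_orthogonal _ _).1 h1 e h3))
  · have : S f = T f := by
      change Q (T (Q f)) = T f
      rw [hQf f hf, hQf _ (hinv f hf)]
    rw [← this]
    calc RCLike.re ⟪f, S f⟫_ℂ ≤ ‖⟪f, S f⟫_ℂ‖ := RCLike.re_le_norm _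
      _ ≤ ‖f‖ * (‖S‖ * ‖f‖) := (norm_inner_le_norm _ _).trans (by gcongr; exact S.le_opNorm f)
      _ = ‖S‖ * ‖f‖ ^ 2 := by ring

end IsPosResolvent

end CompactResolvent

/-! ### Operators with compact resolvent: the limit of maximal chemical potential -/

section CompactResolvent

variable {H : Type*} [NormedAddCommGroup H] [InnerProductSpace ℂ H] [CompleteSpace H]

/-- The Bose functions converge, uniformly on `[x₀, ∞)`, as `μ` increases to `e < x₀`. -/
theorem abs_bose_sub_bose_le {β e μ x₀ x : ℝ} (hβ : 0 < β) (hμ : μ ≤ e) (he : e < x₀)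
    (hx : x₀ ≤ x) :
    |(Real.exp (β * (x - μ)) - 1)⁻¹ - (Real.exp (β * (x - e)) - 1)⁻¹| ≤
      (Real.exp (β * (e - μ)) - 1) *
        (1 + (Real.exp (β * (x₀ - e)) - 1)⁻¹) * (Real.exp (β * (x₀ - e)) - 1)⁻¹ := by
  have h1 := exp_sub_one_pos hβ (x := x₀ - e) (by linarith)
  have h2 := exp_sub_one_pos hβ (x := x - e) (by linarith)
  have h3 := exp_sub_one_pos hβ (x := x - μ) (by linarith)
  have h4 : 1 ≤ Real.exp (β * (e - μ)) := Real.one_le_exp (by nlinarith)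
  have h5 : Real.exp (β * (x - μ)) = Real.exp (β * (e - μ)) * Real.exp (β * (x - e)) := by
    rw [← Real.exp_add]; ring_nf
  have h6 : Real.exp (β * (x₀ - e)) - 1 ≤ Real.exp (β * (x - e)) - 1 := by
    gcongr
  have h7 : Real.exp (β * (x - e)) - 1 ≤ Real.exp (β * (x - μ)) - 1 := by
    gcongr
  set X := Real.exp (β * (x - e))
  set Y := Real.exp (β * (x - μ))
  set R := Real.exp (β * (e - μ))
  have e1 : (X - 1)⁻¹ - (Y - 1)⁻¹ = (R - 1) * (1 + (X - 1)⁻¹) * (Y - 1)⁻¹ := by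
    have := h2.ne'; have := h3.ne'
    field_simp
    rw [h5]; ring
  have e2 : 0 ≤ (X - 1)⁻¹ - (Y - 1)⁻¹ := sub_nonneg.2 (by gcongr)
  rw [abs_sub_comm, abs_of_nonneg e2, e1]
  have h8 : 0 ≤ R - 1 := by linarith
  gcongr
  linarith

namespace IsPosResolvent

variable {A : H →ₗ.[ℂ] H} {c C : ℝ} {T : H →L[ℂ] H} {F : ℝ → ℂ}

theorem funCalc_groundState [Nontrivial H] (h : IsPosResolvent A c T)
    (hF : IsBddSymbol F (‖T‖⁻¹ - 1) C) {e : H} (he : e ∈ eigenspace A (‖T‖⁻¹ - 1)) :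
    funCalc A F e = F (‖T‖⁻¹ - 1) • e :=
  h.optimal.funCalc_eigenvector hF le_rfl (by simpa using h.mem_groundSpace_iff.1 he)

theorem funCalc_mem_orthogonal [Nontrivial H] (h : IsPosResolvent A c T)
    (hF : IsBddSymbol F (‖T‖⁻¹ - 1) C) {f : H} (hf : f ∈ (eigenspace A (‖T‖⁻¹ - 1))ᗮ) :
    funCalc A F f ∈ (eigenspace A (‖T‖⁻¹ - 1))ᗮ := by
  rw [Submodule.mem_orthogonal] at hf ⊢
  intro e he
  rw [h.optimal.inner_funCalc_right hF, h.funCalc_groundState hF.conj he, inner_smul_left, hf e he,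
    mul_zero]

open scoped ComplexOrder in
/-- Above a spectral gap, a function of `A` which vanishes on `[x₀, ∞)` acts as zero on vectors
orthogonal to the ground states. -/
theorem funCalc_eq_zero [Nontrivial H] (h : IsPosResolvent A c T)
    (hF : IsBddSymbol F (‖T‖⁻¹ - 1) C) {r x₀ : ℝ} (hx₀ : ‖T‖⁻¹ - 1 ≤ x₀) (hr : r < (1 + x₀)⁻¹)
    (hgap : ∀ f ∈ (eigenspace A (‖T‖⁻¹ - 1))ᗮ, RCLike.re ⟪f, T f⟫_ℂ ≤ r * ‖f‖ ^ 2)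
    (h0 : ∀ x, x₀ ≤ x → F x = 0) {f : H} (hf : f ∈ (eigenspace A (‖T‖⁻¹ - 1))ᗮ) :
    funCalc A F f = 0 := by
  have hN := h.isStarNormal
  have hx1 : 0 < 1 + x₀ := by linarith [h.optimal.bound_nonneg]
  set k := resolventSymbol F with hk
  have hkc : ContinuousOn k (spectrum ℂ T) := h.optimal.continuousOn hF
  set u := cfc k T f with hu
  -- the vector `u = T F(A) f` only sees the part of the spectrum of `T` above `(1 + x₀)⁻¹`,
  have h1 : (1 + x₀)⁻¹ * ‖u‖ ^ 2 ≤ RCLike.re ⟪u, T u⟫_ℂ := by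
    have h2 : (0 : H →L[ℂ] H) ≤ star (cfc k T) * ((T - (((1 + x₀)⁻¹ : ℝ) : ℂ) • 1) * cfc k T) := by
      have e1 : T - (((1 + x₀)⁻¹ : ℝ) : ℂ) • 1 = cfc (fun z => z - (((1 + x₀)⁻¹ : ℝ) : ℂ)) T := by
        rw [cfc_sub (fun z => z) _ T, cfc_id' ℂ T, cfc_const _ T, Algebra.algebraMap_eq_smul_one]
      rw [e1, ← cfc_star, ← cfc_mul _ _ T (by fun_prop) hkc,
        ← cfc_mul (fun z => star (k z)) (fun z => (z - (((1 + x₀)⁻¹ : ℝ) : ℂ)) * k z) T hkc.star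
          ((by fun_prop : Continuous fun z : ℂ => z - (((1 + x₀)⁻¹ : ℝ) : ℂ)).continuousOn.mul hkc)]
      refine cfc_nonneg fun z hz => ?_
      obtain ⟨x, hx, rfl⟩ := h.optimal.spectrum_subset hz
      rcases hx.1.eq_or_lt with h2 | h2
      · simp [hk, resolventSymbol, ← h2]
      by_cases h3 : x₀ ≤ x⁻¹ - 1
      · simp [hk, resolventSymbol, h0 _ h3]
      · push Not at h3
        have h4 : (1 + x₀)⁻¹ ≤ x := by
          rw [inv_le_comm₀ hx1 h2]; linarith
        rw [mul_left_comm, Complex.star_def, Complex.conj_mul', ← Complex.ofReal_sub]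
        refine mul_nonneg (Complex.zero_le_real.2 (by linarith)) ?_
        exact_mod_cast sq_nonneg ‖k x‖
    have h3 := ((ContinuousLinearMap.nonneg_iff_isPositive _).1 h2).re_inner_nonneg_right f
    change 0 ≤ RCLike.re ⟪f, ContinuousLinearMap.adjoint (cfc k T)
      (T u - (((1 + x₀)⁻¹ : ℝ) : ℂ) • u)⟫_ℂ at h3
    rw [ContinuousLinearMap.adjoint_inner_right, inner_sub_right, inner_smul_right,
      inner_self_eq_norm_sq_to_K, map_sub] at h3
    have h4 : RCLike.re ((((1 + x₀)⁻¹ : ℝ) : ℂ) * ((‖u‖ : ℂ)) ^ 2) = (1 + x₀)⁻¹ * ‖u‖ ^ 2 := by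
      rw [← Complex.ofReal_pow, ← Complex.ofReal_mul]; exact Complex.ofReal_re _
    change 0 ≤ _ - RCLike.re ((((1 + x₀)⁻¹ : ℝ) : ℂ) * ((‖u‖ : ℂ)) ^ 2) at h3
    rw [h4] at h3
    linarith
  -- where there is nothing orthogonal to the ground states
  have h5 : T (funCalc A F f) = u := by rw [← h.optimal.funCalc_comm hF, h.optimal.funCalc_apply hF]
  have h6 : u ∈ (eigenspace A (‖T‖⁻¹ - 1))ᗮ := by
    rw [← h5]
    have h7 := h.funCalc_mem_orthogonal hF hf
    rw [Submodule.mem_orthogonal] at h7 ⊢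
    intro e he
    have hsymm : ⟪T e, funCalc A F f⟫_ℂ = ⟪e, T (funCalc A F f)⟫_ℂ := h.pos.isSymmetric _ _
    rw [← hsymm, h.mem_groundSpace_iff.1 he, inner_smul_left, h7 e he, mul_zero]
  have h8 := hgap u h6
  have h9 : ‖u‖ ^ 2 ≤ 0 := by
    by_contra hlt
    push Not at hlt
    nlinarith
  have h10 : u = 0 := norm_eq_zero.1 (pow_eq_zero_iff two_ne_zero |>.1 (le_antisymm h9 (sq_nonneg _)))
  exact h.injective (h5.trans h10)

/-- Above the spectral gap the operators `(e^{β(A - μ)} - 1)⁻¹` have a strong limit at the ground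
state energy. -/
theorem exists_tendsto_boseOp [Nontrivial H] (h : IsPosResolvent A c T)
    (hc : IsCompactOperator T) {β : ℝ} (hβ : 0 < β) :
    ∃ B : H →L[ℂ] H, ∀ f ∈ (eigenspace A (‖T‖⁻¹ - 1))ᗮ,
      Tendsto (fun μ => boseOp A β μ f) (𝓝[<] (‖T‖⁻¹ - 1)) (𝓝 (B f)) := by
  obtain ⟨r, hr, hr0, hgap⟩ := h.exists_gap hc
  set e₁ := ‖T‖⁻¹ - 1 with he₁
  have hT := h.norm_pos
  obtain ⟨r', hr1, hr2⟩ := exists_between hr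
  have hr'0 : 0 < r' := hr0.trans_lt hr1
  set x₀ := r'⁻¹ - 1 with hx₀
  have hx₀e : e₁ < x₀ := by
    have := inv_strictAnti₀ hr'0 hr2
    linarith
  have hrx : r < (1 + x₀)⁻¹ := by simpa [hx₀] using hr1
  let b : ℝ → ℝ → ℂ := fun μ ε => (((Real.exp (β * (ε - μ)) - 1)⁻¹ : ℝ) : ℂ)
  have hb : ∀ μ ≤ e₁, IsBddSymbol (fun ε => b μ (max x₀ ε)) e₁
      (Real.exp (β * (x₀ - μ)) - 1)⁻¹ := by
    intro μ hμ
    have := isBddSymbol_bose hβ (hμ.trans_lt hx₀e)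
    exact ⟨this.cont.comp (by fun_prop) (fun x _ => Set.mem_Ici.2 (le_max_left _ _)),
      fun x _ => this.bound _ (le_max_left _ _)⟩
  refine ⟨funCalc A (fun ε => b e₁ (max x₀ ε)), fun f hf => ?_⟩
  have h1 : ∀ μ < e₁, boseOp A β μ f = funCalc A (fun ε => b μ (max x₀ ε)) f := by
    intro μ hμ
    have h2 := isBddSymbol_bose hβ hμ
    rw [← sub_eq_zero, ← sub_apply, boseOp, ← h.optimal.funCalc_sub h2 (hb μ hμ.le)]
    have h3 := h2.add ((hb μ hμ.le).const_mul (-1))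
    simp only [neg_mul, one_mul, ← sub_eq_add_neg] at h3
    refine h.funCalc_eq_zero h3 hx₀e.le hrx hgap (fun x hx => ?_) hf
    rw [max_eq_right hx, sub_self]
  rw [tendsto_iff_norm_sub_tendsto_zero]
  let δ : ℝ → ℝ := fun μ => (Real.exp (β * (e₁ - μ)) - 1) *
    (1 + (Real.exp (β * (x₀ - e₁)) - 1)⁻¹) * (Real.exp (β * (x₀ - e₁)) - 1)⁻¹
  have hδ : Tendsto (fun μ => δ μ * ‖f‖) (𝓝[<] e₁) (𝓝 0) := by
    have : Continuous fun μ => δ μ * ‖f‖ := by simp only [δ]; fun_prop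
    have h2 := this.tendsto e₁
    simp only [δ, sub_self, mul_zero, Real.exp_zero, zero_mul] at h2
    exact h2.mono_left nhdsWithin_le_nhds
  refine squeeze_zero' (Eventually.of_forall fun _ => norm_nonneg _) ?_ hδ
  filter_upwards [self_mem_nhdsWithin] with μ hμ
  have hμ : μ < e₁ := hμ
  rw [h1 μ hμ, ← sub_apply, ← h.optimal.funCalc_sub (hb μ hμ.le) (hb e₁ le_rfl)]
  have h3 := (hb μ hμ.le).add ((hb e₁ le_rfl).const_mul (-1))
  simp only [neg_mul, one_mul, ← sub_eq_add_neg] at h3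
  refine h.optimal.norm_funCalc_le ⟨h3.cont, fun x _ => ?_⟩ f
  rw [← Complex.ofReal_sub, Complex.norm_real, Real.norm_eq_abs]
  exact abs_bose_sub_bose_le hβ hμ.le hx₀e (le_max_left _ _)

/-- If the chemical potential reaches a ground state energy with a spectral gap above it, then
the thermal two-point functions converge off the ground states and diverge on them. -/
theorem hasCriticalLimits [Nontrivial H] (h : IsPosResolvent A c T) (hc : IsCompactOperator T) :
    HasCriticalLimits A (groundEnergy A) (LinearMap.range (1 - groundProj A).toLinearMap) := by
  rw [h.groundEnergy_eq hc, h.range_one_sub_groundProj hc]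
  set e₁ := ‖T‖⁻¹ - 1 with he₁
  have hs : ∀ μ t : ℝ, ∀ f ∈ (eigenspace A e₁)ᗮ, evol A μ t f ∈ (eigenspace A e₁)ᗮ :=
    fun μ t f hf => h.funCalc_mem_orthogonal (isBddSymbol_evol _ μ t) hf
  refine ⟨hs 0, fun β hβ f hf g hg => ?_, fun β hβ f hf => ⟨fun μ hμ => ?_, ?_⟩⟩
  · obtain ⟨B, hB⟩ := h.exists_tendsto_boseOp hc hβ
    have hcont := h.continuous_evol e₁ g
    refine ⟨fun t => (1 / 2) * (⟪f, evol A e₁ t g⟫_ℂ + ⟪f, B (evol A e₁ t g)⟫_ℂ +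
      ⟪evol A e₁ t g, B f⟫_ℂ), by fun_prop, fun t => ?_⟩
    -- the dependence of the evolution on `μ` is a phase
    let p : ℝ → ℂ := fun μ => Complex.exp (Complex.I * (t * (e₁ - μ) : ℝ))
    have hp : Tendsto p (𝓝[<] e₁) (𝓝 1) := by
      have : Continuous p := by simp only [p]; fun_prop
      have h2 := this.tendsto e₁
      simp only [p, sub_self, mul_zero, Complex.ofReal_zero, Complex.exp_zero] at h2
      exact h2.mono_left nhdsWithin_le_nhds
    have h1 : Tendsto (fun μ => p μ • evol A e₁ t g) (𝓝[<] e₁) (𝓝 (evol A e₁ t g)) := by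
      simpa using hp.smul_const (evol A e₁ t g)
    have h2 : Tendsto (fun μ => p μ • boseOp A β μ (evol A e₁ t g)) (𝓝[<] e₁)
        (𝓝 (B (evol A e₁ t g))) := by
      simpa using hp.smul (hB _ (hs e₁ t g hg))
    have h3 := (((tendsto_const_nhds (x := f)).inner h1 (𝕜 := ℂ)).add
      ((tendsto_const_nhds (x := f)).inner h2 (𝕜 := ℂ))).add (h1.inner (hB f hf) (𝕜 := ℂ))
    refine (h3.const_mul (1 / 2 : ℂ)).congr' ?_
    filter_upwards [self_mem_nhdsWithin] with μ hμ
    rw [h.optimal.thermal_eq hβ hμ, h.evol_eq_smul μ e₁ t, smul_apply, map_smul]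
  · rw [h.optimal.thermal_self hβ hμ]
    exact Complex.ofReal_im _
  · have : CompleteSpace (eigenspace A e₁) := h.isClosed_groundSpace.completeSpace_coe
    obtain ⟨e, he, d, hd, rfl⟩ := (eigenspace A e₁).exists_add_mem_mem_orthogonal f
    have he0 : e ≠ 0 := by
      rintro rfl
      exact hf (by simpa using hd)
    have key : ∀ μ < e₁, (Real.exp (β * (e₁ - μ)) - 1)⁻¹ * ‖e‖ ^ 2 ≤
        (thermal A β μ (e + d) (e + d)).re := by
      intro μ hμ
      have hbs := isBddSymbol_bose hβ hμ
      have h1 : boseOp A β μ e = (((Real.exp (β * (e₁ - μ)) - 1)⁻¹ : ℝ) : ℂ) • e :=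
        h.funCalc_groundState hbs he
      have h2 : boseOp A β μ d ∈ (eigenspace A e₁)ᗮ := h.funCalc_mem_orthogonal hbs hd
      have h3 : 0 ≤ RCLike.re ⟪d, boseOp A β μ d⟫_ℂ := by
        refine h.optimal.re_inner_funCalc_nonneg (hbs.const_mul 1) (fun x hx => ?_) d |>.trans_eq ?_
        · have := exp_sub_one_pos hβ (x := x - μ) (by linarith)
          rw [one_mul, Complex.zero_le_real]
          positivity
        · simp only [one_mul]; rfl
      rw [h.optimal.thermal_self hβ hμ, Complex.ofReal_re, map_add, h1, inner_add_left,
        inner_add_right, inner_add_right, inner_smul_right, inner_smul_right,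
        (Submodule.mem_orthogonal _ _).1 h2 e he, (Submodule.mem_orthogonal' _ _).1 hd e he,
        inner_self_eq_norm_sq_to_K, mul_zero, add_zero, zero_add, map_add]
      have h4 : RCLike.re ((((Real.exp (β * (e₁ - μ)) - 1)⁻¹ : ℝ) : ℂ) * ((‖e‖ : ℂ)) ^ 2) =
          (Real.exp (β * (e₁ - μ)) - 1)⁻¹ * ‖e‖ ^ 2 := by
        rw [← Complex.ofReal_pow, ← Complex.ofReal_mul]; exact Complex.ofReal_re _
      change _ ≤ _ + (RCLike.re ((((Real.exp (β * (e₁ - μ)) - 1)⁻¹ : ℝ) : ℂ) * ((‖e‖ : ℂ)) ^ 2) + _)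
      rw [h4]
      nlinarith [sq_nonneg ‖e + d‖]
    have hlim : Tendsto (fun μ => (Real.exp (β * (e₁ - μ)) - 1)⁻¹ * ‖e‖ ^ 2) (𝓝[<] e₁) atTop := by
      refine Tendsto.atTop_mul_const (by positivity) (tendsto_inv_nhdsGT_zero.comp ?_)
      refine tendsto_nhdsWithin_iff.2 ⟨?_, ?_⟩
      · have : Continuous fun μ => Real.exp (β * (e₁ - μ)) - 1 := by fun_prop
        have h2 := this.tendsto e₁
        simp only [sub_self, mul_zero, Real.exp_zero] at h2
        exact h2.mono_left nhdsWithin_le_nhds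
      · filter_upwards [self_mem_nhdsWithin] with μ hμ
        exact exp_sub_one_pos hβ (sub_pos.2 hμ)
    refine tendsto_atTop_mono' _ ?_ hlim
    filter_upwards [self_mem_nhdsWithin] with μ hμ using key μ hμ

end IsPosResolvent

end CompactResolvent

/-! ### Multiplication operators and the quadratic form of `P² + V` -/

section Multiplication

variable {s : ℕ}

/-- `g` is the product of `f` with the function `φ`. -/
def IsMulBy (φ : Space s → ℂ) (f g : L2 s) : Prop := g =ᵐ[volume] fun x => φ x * f x

/-- The Fourier transform on `L²`. -/
abbrev fourierL2 (s : ℕ) : L2 s ≃ₗᵢ[ℂ] L2 s := Lp.fourierTransformₗᵢ (Space s) ℂ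

/-- Multiplication operators are closed, also under pointwise convergence of the multipliers. -/
theorem IsMulBy.of_tendsto {φ : ℕ → Space s → ℂ} {ψ : Space s → ℂ} {f g : ℕ → L2 s} {f' g' : L2 s}
    (h : ∀ n, IsMulBy (φ n) (f n) (g n)) (hφ : ∀ x, Tendsto (fun n => φ n x) atTop (𝓝 (ψ x)))
    (hf : Tendsto f atTop (𝓝 f')) (hg : Tendsto g atTop (𝓝 g')) : IsMulBy ψ f' g' := by
  obtain ⟨n₁, hn₁, h₁⟩ := (tendstoInMeasure_of_tendsto_Lp hf).exists_seq_tendsto_ae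
  obtain ⟨n₂, hn₂, h₂⟩ :=
    (tendstoInMeasure_of_tendsto_Lp (hg.comp hn₁.tendsto_atTop)).exists_seq_tendsto_ae
  have h₃ : ∀ᵐ x ∂(volume : Measure (Space s)), ∀ n, g n x = φ n x * f n x := ae_all_iff.2 h
  filter_upwards [h₁, h₂, h₃] with x a₁ a₂ a₃
  have hsub := hn₁.tendsto_atTop.comp hn₂.tendsto_atTop
  refine tendsto_nhds_unique a₂ ?_
  refine Tendsto.congr (fun n => (a₃ (n₁ (n₂ n))).symm) ?_
  exact ((hφ x).comp hsub).mul (a₁.comp hn₂.tendsto_atTop)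

theorem mem_graph_positionFn {w : Space s → ℝ} {f g : L2 s} :
    (f, g) ∈ (positionFn w).graph ↔ IsMulBy (fun x => (w x : ℂ)) f g := by
  rw [LinearPMap.mem_graph_iff]
  constructor
  · rintro ⟨y, rfl, hy⟩
    have hy : positionFn w y = g := hy
    rw [← hy]
    exact MemLp.coeFn_toLp (mem_positionDomain.mp y.2)
  · intro h
    have hm : f ∈ positionDomain w := mem_positionDomain.2 ((Lp.memLp g).ae_eq h)
    refine ⟨⟨f, hm⟩, rfl, ?_⟩
    refine Lp.ext ?_
    exact (MemLp.coeFn_toLp (mem_positionDomain.mp hm)).trans h.symm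

theorem mem_graph_momentumFn {w : Space s → ℝ} {f g : L2 s} :
    (f, g) ∈ (momentumFn w).graph ↔
      IsMulBy (fun ξ => (w ((2 * Real.pi) • ξ) : ℂ)) (fourierL2 s f) (fourierL2 s g) := by
  rw [← mem_graph_positionFn, LinearPMap.mem_graph_iff, LinearPMap.mem_graph_iff]
  constructor
  · rintro ⟨y, rfl, hy⟩
    have hy : (fourierL2 s).symm (positionFn (fun ξ => w ((2 * Real.pi) • ξ))
      ⟨fourierL2 s y, y.2⟩) = g := hy
    refine ⟨⟨fourierL2 s y, y.2⟩, rfl, ?_⟩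
    rw [← hy, LinearIsometryEquiv.apply_symm_apply]
  · rintro ⟨⟨y, hy'⟩, hy1, hy2⟩
    have hy1 : y = fourierL2 s f := hy1
    subst hy1
    refine ⟨⟨f, hy'⟩, rfl, ?_⟩
    change (fourierL2 s).symm (positionFn (fun ξ => w ((2 * Real.pi) • ξ))
      ⟨fourierL2 s f, hy'⟩) = g
    rw [hy2, LinearIsometryEquiv.symm_apply_apply]

theorem isClosed_graph_positionFn (w : Space s → ℝ) :
    IsClosed ((positionFn w).graph : Set (L2 s × L2 s)) := by
  refine IsSeqClosed.isClosed fun p q hp hq => ?_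
  obtain ⟨f, g⟩ := q
  have h1 : ∀ n, IsMulBy (fun x => (w x : ℂ)) (p n).1 (p n).2 := fun n =>
    mem_graph_positionFn.1 (hp n)
  exact mem_graph_positionFn.2 (IsMulBy.of_tendsto h1 (fun _ => tendsto_const_nhds)
    ((continuous_fst.tendsto _).comp hq) ((continuous_snd.tendsto _).comp hq))

theorem isClosed_graph_momentumFn (w : Space s → ℝ) :
    IsClosed ((momentumFn w).graph : Set (L2 s × L2 s)) := by
  refine IsSeqClosed.isClosed fun p q hp hq => ?_
  obtain ⟨f, g⟩ := q
  have h1 : ∀ n, IsMulBy (fun ξ => (w ((2 * Real.pi) • ξ) : ℂ)) (fourierL2 s (p n).1)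
    (fourierL2 s (p n).2) := fun n => mem_graph_momentumFn.1 (hp n)
  exact mem_graph_momentumFn.2 (IsMulBy.of_tendsto h1 (fun _ => tendsto_const_nhds)
    (((fourierL2 s).continuous.tendsto _).comp ((continuous_fst.tendsto _).comp hq))
    (((fourierL2 s).continuous.tendsto _).comp ((continuous_snd.tendsto _).comp hq)))

/-- `⟨w g, w f⟩ = ⟨g, w² f⟩`. -/
theorem IsMulBy.inner_eq {w : Space s → ℝ} {f g a b p : L2 s}
    (ha : IsMulBy (fun x => (w x : ℂ)) f a) (hb : IsMulBy (fun x => (w x : ℂ)) g b)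
    (hp : IsMulBy (fun x => ((w x ^ 2 : ℝ) : ℂ)) f p) : ⟪b, a⟫_ℂ = ⟪g, p⟫_ℂ := by
  rw [L2.inner_def, L2.inner_def]
  refine integral_congr_ae ?_
  filter_upwards [ha, hb, hp] with x h1 h2 h3
  simp only [h1, h2, h3, RCLike.inner_apply, map_mul, Complex.conj_ofReal]
  push_cast
  ring

end Multiplication

section Resolvent

variable {s : ℕ} (V : Space s → ℝ)

/-- The Hilbert space `L² ⊕ L² ⊕ L²` in which the form domain of `P² + V(Q)` is embedded by
`u ↦ (u, |P| u, √V u)`. -/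
abbrev FormSpace (s : ℕ) : Type := PiLp 2 (fun _ : Fin 3 => L2 s)

/-- The form domain of `P² + V(Q)`: all vectors `(u, |P| u, √V u)`. The norm of `FormSpace`
induces the form norm on it. -/
def formDomain : Submodule ℂ (FormSpace s) :=
  (absP s).graph.comap
      ((PiLp.projₗ 2 (fun _ : Fin 3 => L2 s) 0).prod (PiLp.projₗ 2 (fun _ : Fin 3 => L2 s) 1)) ⊓
    (sqrtV V).graph.comap
      ((PiLp.projₗ 2 (fun _ : Fin 3 => L2 s) 0).prod (PiLp.projₗ 2 (fun _ : Fin 3 => L2 s) 2))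

variable {V}

theorem mem_formDomain {k : FormSpace s} :
    k ∈ formDomain V ↔ (k 0, k 1) ∈ (absP s).graph ∧ (k 0, k 2) ∈ (sqrtV V).graph := Iff.rfl

theorem isClosed_formDomain : IsClosed (formDomain V : Set (FormSpace s)) := by
  have h : (formDomain V : Set (FormSpace s)) =
      (fun k : FormSpace s => (k 0, k 1)) ⁻¹' ((absP s).graph : Set (L2 s × L2 s)) ∩
      (fun k : FormSpace s => (k 0, k 2)) ⁻¹' ((sqrtV V).graph : Set (L2 s × L2 s)) := rfl
  rw [h]
  exact ((isClosed_graph_momentumFn _).preimage (by fun_prop)).inter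
    ((isClosed_graph_positionFn _).preimage (by fun_prop))

instance : CompleteSpace (formDomain V) := isClosed_formDomain.completeSpace_coe

theorem mem_hamiltonianGraph {u w : L2 s} : (u, w) ∈ hamiltonianGraph V ↔
    ∃ k ∈ formDomain V, k 0 = u ∧ ∀ l ∈ formDomain V, ⟪l 1, k 1⟫_ℂ + ⟪l 2, k 2⟫_ℂ = ⟪l 0, w⟫_ℂ := by
  constructor
  · rintro ⟨h₁, h₂, h⟩
    refine ⟨!₂[u, absP s ⟨u, h₁⟩, sqrtV V ⟨u, h₂⟩],
      mem_formDomain.2 ⟨(absP s).mem_graph ⟨u, h₁⟩, (sqrtV V).mem_graph ⟨u, h₂⟩⟩, rfl,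
      fun l hl => ?_⟩
    obtain ⟨hl1, hl2⟩ := mem_formDomain.1 hl
    have d1 := LinearPMap.mem_domain_of_mem_graph hl1
    have d2 := LinearPMap.mem_domain_of_mem_graph hl2
    have := h (l 0) d1 d2
    rw [← (LinearPMap.image_iff d1).2 hl1, ← (LinearPMap.image_iff d2).2 hl2] at this
    exact this
  · rintro ⟨k, hk, rfl, h⟩
    obtain ⟨hk1, hk2⟩ := mem_formDomain.1 hk
    have d1 := LinearPMap.mem_domain_of_mem_graph hk1
    have d2 := LinearPMap.mem_domain_of_mem_graph hk2
    refine ⟨d1, d2, fun v k₁ k₂ => ?_⟩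
    have := h !₂[v, absP s ⟨v, k₁⟩, sqrtV V ⟨v, k₂⟩]
      (mem_formDomain.2 ⟨(absP s).mem_graph ⟨v, k₁⟩, (sqrtV V).mem_graph ⟨v, k₂⟩⟩)
    rw [(LinearPMap.image_iff d1).2 hk1, (LinearPMap.image_iff d2).2 hk2] at this
    exact this

/-- The embedding of `L²` as the first summand of `FormSpace`. -/
def formEmbedding (s : ℕ) : L2 s →L[ℂ] FormSpace s :=
  ((PiLp.continuousLinearEquiv 2 ℂ (fun _ : Fin 3 => L2 s)).symm : _ →L[ℂ] FormSpace s) ∘L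
    ContinuousLinearMap.single ℂ (fun _ : Fin 3 => L2 s) 0

theorem inner_formEmbedding (l : FormSpace s) (f : L2 s) :
    ⟪l, formEmbedding s f⟫_ℂ = ⟪l 0, f⟫_ℂ := by
  rw [PiLp.inner_apply, Fin.sum_univ_three]
  simp [formEmbedding]

theorem norm_formEmbedding (f : L2 s) : ‖formEmbedding s f‖ = ‖f‖ := by
  have h := inner_formEmbedding (formEmbedding s f) f
  have h2 : (formEmbedding s f) 0 = f := by simp [formEmbedding]
  rw [h2, inner_self_eq_norm_sq_to_K, inner_self_eq_norm_sq_to_K] at h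
  have h3 : ‖formEmbedding s f‖ ^ 2 = ‖f‖ ^ 2 := by exact_mod_cast h
  exact (sq_eq_sq₀ (norm_nonneg _) (norm_nonneg _)).1 h3

variable (V) in
/-- The vector `(u, |P| u, √V u)` for `u = (P² + V + 1)⁻¹ f`: the Riesz representative of `f` in
the form domain, obtained as the projection of `(f, 0, 0)`. -/
def formSolution (f : L2 s) : FormSpace s := (formDomain V).starProjection (formEmbedding s f)

theorem formSolution_mem (f : L2 s) : formSolution V f ∈ formDomain V :=
  Submodule.starProjection_apply_mem _ _

theorem norm_formSolution_le (f : L2 s) (i : Fin 3) : ‖formSolution V f i‖ ≤ ‖f‖ := by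
  refine (PiLp.norm_apply_le (formSolution V f) i).trans ?_
  rw [← norm_formEmbedding f]
  have h := (formDomain V).starProjection_norm_le
  exact (ContinuousLinearMap.le_opNorm _ _).trans (mul_le_of_le_one_left (norm_nonneg _) h)

theorem inner_formSolution (f : L2 s) {l : FormSpace s} (hl : l ∈ formDomain V) :
    ⟪l 1, formSolution V f 1⟫_ℂ + ⟪l 2, formSolution V f 2⟫_ℂ = ⟪l 0, f - formSolution V f 0⟫_ℂ := by
  have h := Submodule.sub_starProjection_mem_orthogonal (K := formDomain V) (formEmbedding s f)
  have h2 := (Submodule.mem_orthogonal _ _).1 h l hl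
  change ⟪l, formEmbedding s f - formSolution V f⟫_ℂ = 0 at h2
  rw [inner_sub_right, inner_formEmbedding, PiLp.inner_apply, Fin.sum_univ_three] at h2
  rw [inner_sub_right]
  linear_combination -h2

theorem formSolution_eq {u w : L2 s} (h : (u, w) ∈ hamiltonianGraph V) :
    formSolution V (w + u) 0 = u := by
  obtain ⟨k, hk, rfl, hr⟩ := mem_hamiltonianGraph.1 h
  have : formSolution V (w + k 0) = k := by
    refine (Submodule.eq_starProjection_of_mem_orthogonal hk ?_)
    rw [Submodule.mem_orthogonal]
    intro l hl
    have h1 := hr l hl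
    rw [inner_sub_right, inner_formEmbedding, PiLp.inner_apply, Fin.sum_univ_three,
      inner_add_right]
    linear_combination -h1
  rw [this]

variable (V) in
/-- The operator `(P² + V + 1)⁻¹`. -/
def resolvent : L2 s →L[ℂ] L2 s :=
  ContinuousLinearMap.adjoint (formEmbedding s) ∘L (formDomain V).starProjection ∘L formEmbedding s

theorem resolvent_apply (f : L2 s) : resolvent V f = formSolution V f 0 := by
  refine ext_inner_left ℂ fun g => ?_
  change ⟪g, ContinuousLinearMap.adjoint (formEmbedding s) (formSolution V f)⟫_ℂ = _
  rw [ContinuousLinearMap.adjoint_inner_right, ← inner_conj_symm, inner_formEmbedding,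
    inner_conj_symm]

/-- `P² + V` is a positive self-adjoint operator, with resolvent `resolvent V`, as soon as its
form domain is dense. -/
theorem isPosResolvent_hamiltonian (hd : Dense {u : L2 s | ∃ k ∈ formDomain V, k 0 = u}) :
    IsPosResolvent (hamiltonian V) 0 (resolvent V) := by
  have hzero : ∀ w : L2 s, (∀ l ∈ formDomain V, ⟪l 0, w⟫_ℂ = 0) → w = 0 := by
    intro w hw
    refine hd.eq_zero_of_inner_right (𝕜 := ℂ) ?_
    rintro _ ⟨k, hk, rfl⟩
    exact hw k hk
  have hfun : ∀ p ∈ hamiltonianGraph V, p.1 = 0 → p.2 = 0 := by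
    rintro ⟨u, w⟩ hp hu
    have hu : u = 0 := hu
    subst hu
    obtain ⟨k, hk, hk0, h⟩ := mem_hamiltonianGraph.1 hp
    obtain ⟨h1, h2⟩ := mem_formDomain.1 hk
    have e1 := LinearPMap.graph_fst_eq_zero_snd _ h1 hk0
    have e2 := LinearPMap.graph_fst_eq_zero_snd _ h2 hk0
    refine hzero w fun l hl => ?_
    rw [← h l hl, e1, e2, inner_zero_right, inner_zero_right, add_zero]
  have hgraph : (hamiltonian V).graph = hamiltonianGraph V :=
    Submodule.toLinearPMap_graph_eq _ hfun
  have hmem : ∀ f, (resolvent V f, f - resolvent V f) ∈ (hamiltonian V).graph := by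
    intro f
    rw [hgraph, mem_hamiltonianGraph, resolvent_apply]
    exact ⟨formSolution V f, formSolution_mem f, rfl, fun l hl => inner_formSolution f hl⟩
  have hpos : (resolvent V).IsPositive :=
    (ContinuousLinearMap.IsPositive.of_isStarProjection
      (isStarProjection_starProjection)).adjoint_conj _
  refine ⟨⟨fun f => ?_, fun u => ?_⟩, hpos, ?_, le_rfl, ?_⟩
  · have d := LinearPMap.mem_domain_of_mem_graph (hmem f)
    refine ⟨d, ?_⟩
    rw [← (LinearPMap.image_iff d).2 (hmem f)]
    module
  · have h := (hamiltonian V).mem_graph u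
    rw [hgraph] at h
    have := formSolution_eq h
    rw [← resolvent_apply] at this
    rwa [neg_one_smul, sub_neg_eq_add]
  · have h : (LinearMap.range (resolvent V).toLinearMap).topologicalClosure = ⊤ := by
      rw [Submodule.topologicalClosure_eq_top_iff, Submodule.eq_bot_iff]
      intro f hf
      have h0 : resolvent V f = 0 := by
        refine ext_inner_left ℂ fun g => ?_
        have h1 : ⟪resolvent V g, f⟫_ℂ = ⟪g, resolvent V f⟫_ℂ := hpos.isSymmetric g f
        rw [← h1, inner_zero_right]
        exact (Submodule.mem_orthogonal _ _).1 hf _ ⟨g, rfl⟩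
      have h2 := hmem f
      rw [h0, sub_zero] at h2
      exact LinearPMap.graph_fst_eq_zero_snd _ h2 rfl
    exact (Submodule.dense_iff_topologicalClosure_eq_top.2 h)
  · rw [add_zero, inv_one]
    refine ContinuousLinearMap.opNorm_le_bound _ zero_le_one fun f => ?_
    rw [one_mul, resolvent_apply]
    exact norm_formSolution_le f 0

end Resolvent

/-! ### Cutoffs, and a core of the kinetic operator -/

section Cutoff

open scoped SchwartzMap ContDiff

variable {s : ℕ}

/-- A smooth function with compact support which is `1` on the unit ball. -/
def bump (s : ℕ) : ContDiffBump (0 : Space s) := ⟨1, 2, one_pos, one_lt_two⟩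

theorem contDiff_bump : ContDiff ℝ ∞ (bump s : Space s → ℝ) := (bump s).contDiff

theorem bump_eq_one {x : Space s} (hx : ‖x‖ ≤ 1) : bump s x = 1 :=
  (bump s).one_of_mem_closedBall (by simpa [bump] using hx)

theorem contDiff_one_sub_bump : ContDiff ℝ ∞ (fun x : Space s => 1 - bump s x) :=
  contDiff_const.sub contDiff_bump

/-- The derivatives of `1 - bump` vanish near the origin and are bounded. -/
theorem exists_norm_iteratedFDeriv_bump_le (i : ℕ) : ∃ C : ℝ, 0 ≤ C ∧ ∀ x : Space s,
    ‖iteratedFDeriv ℝ i (fun x : Space s => 1 - bump s x) x‖ ≤ C * ‖x‖ := by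
  have hcont : Continuous (iteratedFDeriv ℝ i (bump s : Space s → ℝ)) :=
    (contDiff_bump (s := s)).continuous_iteratedFDeriv (mod_cast le_top)
  obtain ⟨C, hC⟩ := hcont.bounded_above_of_compact_support
    ((bump s).hasCompactSupport.iteratedFDeriv i)
  have hC0 : 0 ≤ C := (norm_nonneg _).trans (hC 0)
  refine ⟨1 + C, by linarith, fun x => ?_⟩
  rcases lt_or_ge ‖x‖ 1 with hx | hx
  · have h1 : (fun x : Space s => 1 - bump s x) =ᶠ[𝓝 x] fun _ => 0 := by
      have : ∀ᶠ y in 𝓝 x, ‖y‖ < 1 := continuous_norm.continuousAt.eventually (gt_mem_nhds hx)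
      filter_upwards [this] with y hy
      rw [bump_eq_one hy.le, sub_self]
    rw [(h1.iteratedFDeriv ℝ i).eq_of_nhds]
    simp
    positivity
  · have h2 : ‖iteratedFDeriv ℝ i (fun _ : Space s => (1 : ℝ)) x‖ ≤ 1 := by
      rcases eq_or_ne i 0 with rfl | hi
      · simp
      · simp [iteratedFDeriv_const_of_ne hi]
    have h3 : iteratedFDeriv ℝ i (fun x : Space s => 1 - bump s x) x =
        iteratedFDeriv ℝ i (fun _ : Space s => (1 : ℝ)) x - iteratedFDeriv ℝ i (bump s) x :=
      fun_iteratedFDeriv_sub_apply contDiff_const.contDiffAt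
        ((contDiff_bump (s := s)).of_le (mod_cast le_top)).contDiffAt
    rw [h3]
    have := norm_sub_le (iteratedFDeriv ℝ i (fun _ : Space s => (1 : ℝ)) x)
      (iteratedFDeriv ℝ i (bump s) x)
    nlinarith [hC x]

theorem hasTemperateGrowth_bump (a : ℝ) (ha : a ≠ 0) :
    (fun x : Space s => bump s (a • x)).HasTemperateGrowth :=
  HasCompactSupport.hasTemperateGrowth
    ((bump s).hasCompactSupport.comp_homeomorph (Homeomorph.smulOfNeZero a ha))
    (contDiff_bump.comp (contDiff_const_smul a))

/-- The cutoff `x ↦ bump (x / (n + 1)) u(x)` of a Schwartz function. -/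
def cutoff (n : ℕ) (u : 𝓢(Space s, ℂ)) : 𝓢(Space s, ℂ) :=
  SchwartzMap.smulLeftCLM ℂ (fun x : Space s => bump s ((n + 1 : ℝ)⁻¹ • x)) u

theorem cutoff_apply (n : ℕ) (u : 𝓢(Space s, ℂ)) (x : Space s) :
    cutoff n u x = bump s ((n + 1 : ℝ)⁻¹ • x) • u x :=
  SchwartzMap.smulLeftCLM_apply_apply (hasTemperateGrowth_bump _ (by positivity)) u x

theorem hasCompactSupport_cutoff (n : ℕ) (u : 𝓢(Space s, ℂ)) : HasCompactSupport (cutoff n u) := by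
  have h : HasCompactSupport (fun x : Space s => bump s ((n + 1 : ℝ)⁻¹ • x)) :=
    (bump s).hasCompactSupport.comp_homeomorph
      (Homeomorph.smulOfNeZero ((n + 1 : ℝ)⁻¹) (by positivity))
  have e : (cutoff n u : Space s → ℂ) = (fun x : Space s => bump s ((n + 1 : ℝ)⁻¹ • x)) • u := by
    ext x; exact cutoff_apply n u x
  rw [e]
  exact h.smul_right

/-- The cutoffs converge in every Schwartz seminorm: the derivatives of `1 - bump (x / (n + 1))` are
bounded by a multiple of `‖x‖ / (n + 1)`. -/
theorem tendsto_cutoff (u : 𝓢(Space s, ℂ)) : Tendsto (fun n => cutoff n u) atTop (𝓝 u) := by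
  rw [(schwartz_withSeminorms ℝ (Space s) ℂ).tendsto_nhds]
  rintro ⟨k, m⟩ ε hε
  choose C hC0 hC using fun i => exists_norm_iteratedFDeriv_bump_le (s := s) i
  set M : ℝ := ∑ i ∈ Finset.range (m + 1),
    (m.choose i : ℝ) * C i * SchwartzMap.seminorm ℝ (k + 1) (m - i) u with hM
  have hM0 : 0 ≤ M := Finset.sum_nonneg fun i _ => by
    have := hC0 i
    have := apply_nonneg (SchwartzMap.seminorm ℝ (k + 1) (m - i)) u
    positivity
  have key : ∀ n : ℕ, SchwartzMap.seminorm ℝ k m (cutoff n u - u) ≤ (n + 1 : ℝ)⁻¹ * M := by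
    intro n
    set a : ℝ := (n + 1 : ℝ)⁻¹ with ha
    have ha0 : 0 < a := by positivity
    have ha1 : a ≤ 1 := inv_le_one_of_one_le₀ (by linarith [(Nat.cast_nonneg n : (0 : ℝ) ≤ n)])
    have e : cutoff n u - u = -(u - cutoff n u) := by abel
    rw [e, map_neg_eq_map]
    refine SchwartzMap.seminorm_le_bound ℝ k m _ (by positivity) fun x => ?_
    have e1 : ((u - cutoff n u : 𝓢(Space s, ℂ)) : Space s → ℂ) =
        fun x => (fun y : Space s => 1 - bump s (a • y)) x • u x := by
      ext y
      rw [sub_apply, cutoff_apply, sub_smul, one_smul]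
    rw [e1]
    have hψ : ContDiff ℝ ∞ (fun y : Space s => 1 - bump s (a • y)) :=
      contDiff_one_sub_bump.comp (contDiff_const_smul a)
    have h1 := norm_iteratedFDeriv_smul_le hψ u.smooth' x (n := m) (mod_cast le_top)
    have h2 : ∀ i, ‖iteratedFDeriv ℝ i (fun y : Space s => 1 - bump s (a • y)) x‖ ≤
        a * (C i * ‖x‖) := by
      intro i
      have := congrFun (iteratedFDeriv_comp_const_smul (i := i) a
        ((contDiff_one_sub_bump (s := s)).of_le (mod_cast le_top))) x
      rw [this, norm_smul, norm_pow, Real.norm_of_nonneg ha0.le]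
      have h3 := hC i (a • x)
      rw [norm_smul, Real.norm_of_nonneg ha0.le] at h3
      have h4 : a ^ i ≤ 1 := pow_le_one₀ ha0.le ha1
      calc a ^ i * _ ≤ 1 * (C i * (a * ‖x‖)) := by
            gcongr
        _ = a * (C i * ‖x‖) := by ring
    calc ‖x‖ ^ k * _ ≤ ‖x‖ ^ k * ∑ i ∈ Finset.range (m + 1), (m.choose i : ℝ) *
          (a * (C i * ‖x‖)) * ‖iteratedFDeriv ℝ (m - i) u x‖ := by
          gcongr
          exact h1.trans (Finset.sum_le_sum fun i _ => mul_le_mul_of_nonneg_right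
            (mul_le_mul_of_nonneg_left (h2 i) (Nat.cast_nonneg _)) (norm_nonneg _))
      _ = a * ∑ i ∈ Finset.range (m + 1), (m.choose i : ℝ) * C i *
          (‖x‖ ^ (k + 1) * ‖iteratedFDeriv ℝ (m - i) u x‖) := by
          rw [Finset.mul_sum, Finset.mul_sum]
          exact Finset.sum_congr rfl fun i _ => by ring
      _ ≤ a * M := by
          refine mul_le_mul_of_nonneg_left (Finset.sum_le_sum fun i _ => ?_) ha0.le
          exact mul_le_mul_of_nonneg_left (SchwartzMap.le_seminorm ℝ (k + 1) (m - i) u x)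
            (mul_nonneg (Nat.cast_nonneg _) (hC0 i))
  have hlim : Tendsto (fun n : ℕ => (n + 1 : ℝ)⁻¹ * M) atTop (𝓝 0) := by
    have := (tendsto_one_div_add_atTop_nhds_zero_nat (𝕜 := ℝ)).mul_const M
    simpa using this
  filter_upwards [hlim.eventually (gt_mem_nhds hε)] with n hn
  exact (key n).trans_lt hn

/-- The kinetic operator `1 + P²` on Schwartz functions. -/
def oneAddKinetic (s : ℕ) : 𝓢(Space s, ℂ) →L[ℂ] 𝓢(Space s, ℂ) :=
  SchwartzMap.fourierMultiplierCLM ℂ (fun ξ : Space s => ((1 + ‖(2 * Real.pi) • ξ‖ ^ 2 : ℝ) : ℂ))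

theorem hasTemperateGrowth_kinetic (r : ℝ) : (fun ξ : Space s =>
    (((1 + ‖(2 * Real.pi) • ξ‖ ^ 2) ^ r : ℝ) : ℂ)).HasTemperateGrowth := by
  have h1 := Function.hasTemperateGrowth_one_add_norm_sq_rpow (Space s) r
  have h2 : (fun ξ : Space s => (2 * Real.pi) • ξ).HasTemperateGrowth :=
    ((2 * Real.pi) • ContinuousLinearMap.id ℝ (Space s)).hasTemperateGrowth
  exact Function.Complex.hasTemperateGrowth_ofReal.comp (h1.comp h2)

theorem oneAddKinetic_eq : oneAddKinetic s = SchwartzMap.fourierMultiplierCLM ℂ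
    (fun ξ : Space s => (((1 + ‖(2 * Real.pi) • ξ‖ ^ 2) ^ (1 : ℝ) : ℝ) : ℂ)) := by
  simp only [Real.rpow_one]; rfl

/-- The inverse of `1 + P²` is the Fourier multiplier with the reciprocal symbol, which has temperate
growth as well. -/
theorem oneAddKinetic_surjective : Function.Surjective (oneAddKinetic s) := by
  intro g
  refine ⟨SchwartzMap.fourierMultiplierCLM ℂ (fun ξ : Space s =>
    (((1 + ‖(2 * Real.pi) • ξ‖ ^ 2) ^ (-1 : ℝ) : ℝ) : ℂ)) g, ?_⟩
  rw [oneAddKinetic_eq, SchwartzMap.fourierMultiplierCLM_fourierMultiplierCLM_apply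
    (hasTemperateGrowth_kinetic _) (hasTemperateGrowth_kinetic _)]
  have : ((fun ξ : Space s => (((1 + ‖(2 * Real.pi) • ξ‖ ^ 2) ^ (1 : ℝ) : ℝ) : ℂ)) *
      fun ξ : Space s => (((1 + ‖(2 * Real.pi) • ξ‖ ^ 2) ^ (-1 : ℝ) : ℝ) : ℂ)) = fun _ => 1 := by
    ext ξ
    have hpos : (0 : ℝ) < 1 + ‖(2 * Real.pi) • ξ‖ ^ 2 := by positivity
    rw [Pi.mul_apply, ← Complex.ofReal_mul, ← Real.rpow_add hpos]
    simp
  rw [this, SchwartzMap.fourierMultiplierCLM_const]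
  simp

/-- The test functions form a core of the kinetic operator: the functions `(1 + P²) v`, with `v`
smooth of compact support, are dense. -/
theorem dense_oneAddKinetic_compactSupport : Dense {f : L2 s | ∃ v : 𝓢(Space s, ℂ),
    HasCompactSupport v ∧ (oneAddKinetic s v).toLp 2 = f} := by
  set D := {f : L2 s | ∃ v : 𝓢(Space s, ℂ),
    HasCompactSupport v ∧ (oneAddKinetic s v).toLp 2 = f}
  have h1 : ∀ u : 𝓢(Space s, ℂ), (oneAddKinetic s u).toLp 2 volume ∈ closure D := by
    intro u
    have hc : Continuous fun u : 𝓢(Space s, ℂ) => (oneAddKinetic s u).toLp 2 volume :=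
      (SchwartzMap.toLpCLM ℂ (E := Space s) ℂ 2 volume).continuous.comp
        (oneAddKinetic s).continuous
    exact mem_closure_of_tendsto ((hc.tendsto u).comp (tendsto_cutoff u))
      (Eventually.of_forall fun n => ⟨cutoff n u, hasCompactSupport_cutoff n u, rfl⟩)
  have h2 : DenseRange (SchwartzMap.toLpCLM ℂ (E := Space s) ℂ 2 volume) :=
    SchwartzMap.denseRange_toLpCLM ENNReal.ofNat_ne_top
  rw [← dense_closure]
  refine h2.mono ?_
  rintro _ ⟨g, rfl⟩
  obtain ⟨u, rfl⟩ := oneAddKinetic_surjective g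
  exact h1 u

theorem dense_toLp_compactSupport : Dense {f : L2 s | ∃ v : 𝓢(Space s, ℂ),
    HasCompactSupport v ∧ v.toLp 2 = f} := by
  have h2 : DenseRange (SchwartzMap.toLpCLM ℂ (E := Space s) ℂ 2 volume) :=
    SchwartzMap.denseRange_toLpCLM ENNReal.ofNat_ne_top
  rw [← dense_closure]
  refine h2.mono ?_
  rintro _ ⟨u, rfl⟩
  have hc := (SchwartzMap.toLpCLM ℂ (E := Space s) ℂ 2 volume).continuous
  exact mem_closure_of_tendsto ((hc.tendsto u).comp (tendsto_cutoff u))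
    (Eventually.of_forall fun n => ⟨cutoff n u, hasCompactSupport_cutoff n u, rfl⟩)

end Cutoff

/-! ### Strong resolvent convergence of the trapped Hamiltonians -/

section StrongResolventConvergence

open scoped SchwartzMap ContDiff

variable {s : ℕ}

theorem hasTemperateGrowth_norm_sq : (fun ξ : Space s =>
    ((1 + ‖(2 * Real.pi) • ξ‖ ^ 2 : ℝ) : ℂ)).HasTemperateGrowth := by
  have := hasTemperateGrowth_kinetic (s := s) 1
  simpa only [Real.rpow_one] using this

theorem fourier_oneAddKinetic (v : 𝓢(Space s, ℂ)) (ξ : Space s) :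
    (𝓕 (oneAddKinetic s v)) ξ = ((1 + ‖(2 * Real.pi) • ξ‖ ^ 2 : ℝ) : ℂ) * (𝓕 v) ξ := by
  rw [oneAddKinetic, SchwartzMap.fourierMultiplierCLM_apply, FourierTransform.fourier_fourierInv_eq,
    SchwartzMap.smulLeftCLM_apply_apply hasTemperateGrowth_norm_sq, smul_eq_mul]

/-- `P² v ∈ L²` for a Schwartz function `v`. -/
theorem isMulBy_kinetic (v : 𝓢(Space s, ℂ)) :
    IsMulBy (fun ξ => ((‖(2 * Real.pi) • ξ‖ ^ 2 : ℝ) : ℂ)) (fourierL2 s (v.toLp 2 volume))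
      (fourierL2 s ((oneAddKinetic s v).toLp 2 volume - v.toLp 2 volume)) := by
  have e1 : fourierL2 s (v.toLp 2 volume) = (𝓕 v).toLp 2 volume := SchwartzMap.toLp_fourier_eq v
  have e2 : fourierL2 s ((oneAddKinetic s v).toLp 2 volume) =
    (𝓕 (oneAddKinetic s v)).toLp 2 volume := SchwartzMap.toLp_fourier_eq _
  rw [map_sub, e1, e2, IsMulBy]
  filter_upwards [Lp.coeFn_sub ((𝓕 (oneAddKinetic s v)).toLp 2 volume) ((𝓕 v).toLp 2 volume),
    (𝓕 v).coeFn_toLp 2 volume, (𝓕 (oneAddKinetic s v)).coeFn_toLp 2 volume] with ξ h1 h2 h3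
  rw [h1, Pi.sub_apply, h2, h3, fourier_oneAddKinetic]
  push_cast
  ring

/-- `|P| v ∈ L²` for a Schwartz function `v`. -/
theorem exists_isMulBy_absP (v : 𝓢(Space s, ℂ)) : ∃ a : L2 s,
    IsMulBy (fun ξ => (‖(2 * Real.pi) • ξ‖ : ℂ)) (fourierL2 s (v.toLp 2 volume))
      (fourierL2 s a) := by
  have hm : MemLp (fun ξ => (‖(2 * Real.pi) • ξ‖ : ℂ) * (𝓕 v) ξ) 2 volume := by
    refine ((𝓕 (oneAddKinetic s v)).memLp 2 volume).mono ?_ (Eventually.of_forall fun ξ => ?_)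
    · have : Continuous fun ξ => (‖(2 * Real.pi) • ξ‖ : ℂ) * (𝓕 v) ξ :=
        (Complex.continuous_ofReal.comp (by fun_prop)).mul (𝓕 v).continuous
      exact this.aestronglyMeasurable
    · rw [fourier_oneAddKinetic, norm_mul, norm_mul, Complex.norm_real, Complex.norm_real,
        Real.norm_of_nonneg (norm_nonneg _), Real.norm_of_nonneg (by positivity)]
      gcongr
      nlinarith [sq_nonneg (‖(2 * Real.pi) • ξ‖ - 1), norm_nonneg ((2 * Real.pi) • ξ)]
  refine ⟨(fourierL2 s).symm hm.toLp, ?_⟩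
  have e1 : fourierL2 s (v.toLp 2 volume) = (𝓕 v).toLp 2 volume := SchwartzMap.toLp_fourier_eq v
  rw [LinearIsometryEquiv.apply_symm_apply, e1, IsMulBy]
  filter_upwards [hm.coeFn_toLp, (𝓕 v).coeFn_toLp 2 volume] with ξ h1 h2
  rw [h1, h2]

theorem exists_isMulBy_of_compactSupport {w : Space s → ℝ} (hw : Continuous w)
    {v : 𝓢(Space s, ℂ)} (hv : HasCompactSupport v) :
    ∃ b : L2 s, IsMulBy (fun x => (w x : ℂ)) (v.toLp 2 volume) b := by
  have hm : MemLp (fun x => (w x : ℂ) * v x) 2 volume := by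
    refine Continuous.memLp_of_hasCompactSupport ?_ hv.mul_left
    exact (Complex.continuous_ofReal.comp hw).mul v.continuous
  refine ⟨hm.toLp, ?_⟩
  rw [IsMulBy]
  filter_upwards [hm.coeFn_toLp, v.coeFn_toLp 2 volume] with ξ h1 h2
  rw [h1, h2]

/-- Test functions lie in the form domain. -/
theorem exists_mem_formDomain {V : Space s → ℝ} (hV : Continuous V) {v : 𝓢(Space s, ℂ)}
    (hv : HasCompactSupport v) : ∃ k ∈ formDomain V, k 0 = v.toLp 2 volume := by
  obtain ⟨a, ha⟩ := exists_isMulBy_absP v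
  obtain ⟨b, hb⟩ := exists_isMulBy_of_compactSupport (w := fun x => √(V x)) (by fun_prop) hv
  exact ⟨!₂[v.toLp 2 volume, a, b],
    mem_formDomain.2 ⟨mem_graph_momentumFn.2 ha, mem_graph_positionFn.2 hb⟩, rfl⟩

/-- For continuous `V` the operator `P² + V` is positive and self-adjoint: test functions are dense
and lie in the form domain. -/
theorem isPosResolvent {V : Space s → ℝ} (hV : Continuous V) :
    IsPosResolvent (hamiltonian V) 0 (resolvent V) := by
  refine isPosResolvent_hamiltonian (dense_toLp_compactSupport.mono ?_)
  rintro _ ⟨v, hv, rfl⟩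
  exact exists_mem_formDomain hV hv

/-- On test functions, `P² + V` is the sum of `P²` and multiplication by `V`. -/
theorem resolvent_test {V : Space s → ℝ} (hV : Continuous V) (hV0 : ∀ x, 0 ≤ V x)
    {v : 𝓢(Space s, ℂ)} (hv : HasCompactSupport v) {p : L2 s}
    (hp : IsMulBy (fun x => (V x : ℂ)) (v.toLp 2 volume) p) :
    resolvent V ((oneAddKinetic s v).toLp 2 volume + p) = v.toLp 2 volume := by
  obtain ⟨a, ha⟩ := exists_isMulBy_absP v
  obtain ⟨b, hb⟩ := exists_isMulBy_of_compactSupport (w := fun x => √(V x)) (by fun_prop) hv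
  have hg : (v.toLp 2 volume, (oneAddKinetic s v).toLp 2 volume - v.toLp 2 volume + p) ∈
      hamiltonianGraph V := by
    refine mem_hamiltonianGraph.2 ⟨!₂[v.toLp 2 volume, a, b],
      mem_formDomain.2 ⟨mem_graph_momentumFn.2 ha, mem_graph_positionFn.2 hb⟩, rfl,
      fun l hl => ?_⟩
    obtain ⟨h1, h2⟩ := mem_formDomain.1 hl
    have e1 : ⟪l 1, a⟫_ℂ = ⟪l 0, (oneAddKinetic s v).toLp 2 volume - v.toLp 2 volume⟫_ℂ := by
      rw [← (fourierL2 s).inner_map_map (l 1), ← (fourierL2 s).inner_map_map (l 0)]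
      exact IsMulBy.inner_eq ha (mem_graph_momentumFn.1 h1) (isMulBy_kinetic v)
    have e2 : ⟪l 2, b⟫_ℂ = ⟪l 0, p⟫_ℂ := by
      refine IsMulBy.inner_eq hb (mem_graph_positionFn.1 h2) ?_
      simpa only [Real.sq_sqrt (hV0 _)] using hp
    rw [inner_add_right, ← e1, ← e2]
    rfl
  have := formSolution_eq hg
  rw [← resolvent_apply] at this
  convert! this using 2
  abel

theorem resolvent_oneAddKinetic {v : 𝓢(Space s, ℂ)} (hv : HasCompactSupport v) :
    resolvent (fun _ => 0) ((oneAddKinetic s v).toLp 2 volume) = v.toLp 2 volume := by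
  have h := resolvent_test (V := fun _ : Space s => 0) continuous_const (fun _ => le_rfl) hv
    (p := 0) (by
      rw [IsMulBy]
      filter_upwards [Lp.coeFn_zero ℂ 2 (volume : Measure (Space s))] with x hx
      rw [hx]; simp)
  rwa [add_zero] at h

theorem continuous_scaledV {V : Space s → ℝ} (hV : Continuous V) (L : ℝ) :
    Continuous (scaledV V L) := by
  unfold scaledV; fun_prop

theorem scaledV_nonneg {V : Space s → ℝ} (hV0 : ∀ x, 0 ≤ V x) (L : ℝ) (x : Space s) :
    0 ≤ scaledV V L x := mul_nonneg (by positivity) (hV0 _)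

/-- On a fixed test function the scaled potential tends to zero. -/
theorem exists_norm_scaledV_mul_le {V : Space s → ℝ} (hV : Continuous V) (hV0 : ∀ x, 0 ≤ V x)
    {v : 𝓢(Space s, ℂ)} (hv : HasCompactSupport v) : ∃ C : ℝ, ∀ L : ℝ, 1 ≤ L → ∀ p : L2 s,
      IsMulBy (fun x => (scaledV V L x : ℂ)) (v.toLp 2 volume) p → ‖p‖ ≤ (L ^ 2)⁻¹ * C := by
  obtain ⟨R, hR⟩ := hv.isBounded.subset_closedBall (0 : Space s)
  obtain ⟨M, hM⟩ := (isCompact_closedBall (0 : Space s) R).bddAbove_image hV.continuousOn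
  refine ⟨M * ‖v.toLp 2 volume‖, fun L hL p hp => ?_⟩
  rw [← mul_assoc]
  have hL0 : 0 < L := by linarith
  refine Lp.norm_le_mul_norm_of_ae_le_mul ?_
  filter_upwards [hp, v.coeFn_toLp 2 volume] with x h1 h2
  rw [h1, h2, norm_mul]
  by_cases hx : v x = 0
  · simp [hx]
  gcongr
  rw [Complex.norm_real, Real.norm_of_nonneg (scaledV_nonneg hV0 L x), scaledV]
  gcongr
  refine hM ⟨L⁻¹ • x, ?_, rfl⟩
  have h3 : x ∈ Metric.closedBall (0 : Space s) R := hR (subset_tsupport _ hx)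
  rw [mem_closedBall_zero_iff] at h3 ⊢
  rw [norm_smul, Real.norm_of_nonneg (by positivity)]
  exact (mul_le_of_le_one_left (norm_nonneg _) (inv_le_one_of_one_le₀ hL)).trans h3

/-- Strong resolvent convergence `h_L → P²` in the thermodynamic limit. -/
theorem tendsto_resolvent {V : Space s → ℝ} (hV : Continuous V) (hV0 : ∀ x, 0 ≤ V x) (f : L2 s) :
    Tendsto (fun L => resolvent (scaledV V L) f) atTop
      (𝓝 (resolvent (fun _ : Space s => 0) f)) := by
  have hbd : ∀ W : Space s → ℝ, Continuous W → ∀ g, ‖resolvent W g‖ ≤ ‖g‖ := fun W hW g => by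
    have h1 := (isPosResolvent hW).norm_le_one
    exact (ContinuousLinearMap.le_opNorm _ _).trans (mul_le_of_le_one_left (norm_nonneg _) h1)
  have hcore : ∀ v : 𝓢(Space s, ℂ), HasCompactSupport v →
      Tendsto (fun L => resolvent (scaledV V L) ((oneAddKinetic s v).toLp 2 volume)) atTop
        (𝓝 (resolvent (fun _ : Space s => 0) ((oneAddKinetic s v).toLp 2 volume))) := by
    intro v hv
    obtain ⟨C, hC⟩ := exists_norm_scaledV_mul_le hV hV0 hv
    rw [resolvent_oneAddKinetic hv, tendsto_iff_norm_sub_tendsto_zero]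
    have hlim : Tendsto (fun L : ℝ => (L ^ 2)⁻¹ * C) atTop (𝓝 0) := by
      have := (tendsto_pow_atTop (α := ℝ) two_ne_zero).inv_tendsto_atTop.mul_const C
      simpa using this
    refine squeeze_zero' (Eventually.of_forall fun _ => norm_nonneg _) ?_ hlim
    filter_upwards [eventually_ge_atTop (1 : ℝ)] with L hL
    obtain ⟨p, hp⟩ := exists_isMulBy_of_compactSupport (continuous_scaledV hV L) hv
    have h1 := resolvent_test (continuous_scaledV hV L) (scaledV_nonneg hV0 L) hv hp
    rw [map_add] at h1
    have h2 : resolvent (scaledV V L) ((oneAddKinetic s v).toLp 2 volume) - v.toLp 2 volume =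
        -resolvent (scaledV V L) p := by
      rw [← h1]; abel
    rw [h2, norm_neg]
    exact (hbd _ (continuous_scaledV hV L) p).trans (hC L hL p hp)
  rw [Metric.tendsto_nhds]
  intro ε hε
  obtain ⟨_, hfv, ⟨v, hv, rfl⟩⟩ := Metric.dense_iff.1
    (dense_oneAddKinetic_compactSupport (s := s)) f (ε / 3) (by positivity)
  rw [Metric.mem_ball, dist_comm, dist_eq_norm] at hfv
  set g : L2 s := (oneAddKinetic s v).toLp 2 volume
  filter_upwards [Metric.tendsto_nhds.1 (hcore v hv) (ε / 3) (by positivity)] with L hL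
  rw [dist_eq_norm] at hL ⊢
  have e : resolvent (scaledV V L) f - resolvent (fun _ : Space s => 0) f =
      resolvent (scaledV V L) (f - g) +
      (resolvent (scaledV V L) g - resolvent (fun _ : Space s => 0) g) -
      resolvent (fun _ : Space s => 0) (f - g) := by
    rw [map_sub, map_sub]; abel
  rw [e]
  have a1 := hbd _ (continuous_scaledV hV L) (f - g)
  have a2 := hbd (fun _ : Space s => 0) continuous_const (f - g)
  have a3 := norm_sub_le (resolvent (scaledV V L) (f - g) +
      (resolvent (scaledV V L) g - resolvent (fun _ : Space s => 0) g))
      (resolvent (fun _ : Space s => 0) (f - g))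
  have a4 := norm_add_le (resolvent (scaledV V L) (f - g))
      (resolvent (scaledV V L) g - resolvent (fun _ : Space s => 0) g)
  linarith

end StrongResolventConvergence

/-! ### Compactness of the resolvent for a confining potential -/

section HilbertSchmidt

variable {H : Type*} [NormedAddCommGroup H] [NormedSpace ℂ H] {s : ℕ}

/-- The operator `f ↦ (x ↦ Φ(x) f)` given by a square integrable family `Φ` of functionals. -/
def kernelOp (Φ : Lp (H →L[ℂ] ℂ) 2 (volume : Measure (Space s))) : H →L[ℂ] L2 s :=
  ((ContinuousLinearMap.apply ℂ ℂ : H →L[ℂ] (H →L[ℂ] ℂ) →L[ℂ] ℂ).compLpL₂ 2 volume).flip Φ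

theorem coeFn_kernelOp (Φ : Lp (H →L[ℂ] ℂ) 2 (volume : Measure (Space s))) (f : H) :
    kernelOp Φ f =ᵐ[volume] fun x => Φ x f :=
  ContinuousLinearMap.coeFn_compLp' (ContinuousLinearMap.apply ℂ ℂ f) Φ

/-- Hilbert–Schmidt operators are compact: simple functions `Φ` give finite rank operators. -/
theorem isCompactOperator_kernelOp (Φ : Lp (H →L[ℂ] ℂ) 2 (volume : Measure (Space s))) :
    IsCompactOperator (kernelOp Φ) := by
  refine Lp.induction (by norm_num) (fun Φ => IsCompactOperator (kernelOp Φ)) ?_ ?_ ?_ Φ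
  · intro c S hS hμS
    have e : kernelOp (Lp.simpleFunc.indicatorConst 2 hS hμS.ne c : Lp (H →L[ℂ] ℂ) 2 volume) =
        (ContinuousLinearMap.toSpanSingleton ℂ (indicatorConstLp 2 hS hμS.ne (1 : ℂ)) :
          ℂ →L[ℂ] L2 s) ∘L c := by
      ext1 f
      refine Lp.ext ?_
      rw [Lp.simpleFunc.coe_indicatorConst]
      change _ =ᵐ[volume] (c f • (indicatorConstLp 2 hS hμS.ne (1 : ℂ) : L2 s) : L2 s)
      filter_upwards [coeFn_kernelOp (indicatorConstLp 2 hS hμS.ne c) f,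
        indicatorConstLp_coeFn (p := 2) (hs := hS) (hμs := hμS.ne) (c := c),
        indicatorConstLp_coeFn (p := 2) (hs := hS) (hμs := hμS.ne) (c := (1 : ℂ)),
        Lp.coeFn_smul (c f) (indicatorConstLp 2 hS hμS.ne (1 : ℂ) : L2 s)] with x h1 h2 h3 h4
      rw [h1, h2, h4, Pi.smul_apply, h3]
      by_cases hx : x ∈ S <;> simp [hx]
    rw [e]
    have hc : IsCompactOperator (c : H →L[ℂ] ℂ) := isCompactOperator_of_locallyCompactSpace_dom c
    exact hc.clm_comp (ContinuousLinearMap.toSpanSingleton ℂ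
      (indicatorConstLp 2 hS hμS.ne (1 : ℂ) : L2 s))
  · intro f g hf hg _ h1 h2
    have e : kernelOp (hf.toLp f + hg.toLp g) = kernelOp (hf.toLp f) + kernelOp (hg.toLp g) :=
      map_add (((ContinuousLinearMap.apply ℂ ℂ :
        H →L[ℂ] (H →L[ℂ] ℂ) →L[ℂ] ℂ).compLpL₂ 2 volume).flip) _ _
    rw [e]
    exact h1.add h2
  · exact isClosed_setOfPred_isCompactOperator.preimage
      (((ContinuousLinearMap.apply ℂ ℂ :
        H →L[ℂ] (H →L[ℂ] ℂ) →L[ℂ] ℂ).compLpL₂ 2 volume).flip).continuous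

end HilbertSchmidt

section Compactness

open scoped SchwartzMap ContDiff

variable {s : ℕ}

theorem IsMulBy.norm_le {φ : Space s → ℂ} {f g : L2 s} (h : IsMulBy φ f g) {C : ℝ}
    (hC : ∀ x, ‖φ x‖ ≤ C) : ‖g‖ ≤ C * ‖f‖ := by
  refine Lp.norm_le_mul_norm_of_ae_le_mul ?_
  filter_upwards [h] with x hx
  rw [hx, norm_mul]
  gcongr
  exact hC x

theorem IsMulBy.sub {φ : Space s → ℂ} {f g f' g' : L2 s} (h : IsMulBy φ f g)
    (h' : IsMulBy φ f' g') : IsMulBy φ (f - f') (g - g') := by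
  rw [IsMulBy] at *
  filter_upwards [h, h', Lp.coeFn_sub f f', Lp.coeFn_sub g g'] with x h1 h2 h3 h4
  rw [h4, Pi.sub_apply, h1, h2, h3, Pi.sub_apply, mul_sub]

theorem exists_isMulBy {φ : Space s → ℂ} (hφ : Continuous φ) {C : ℝ} (hC : ∀ x, ‖φ x‖ ≤ C)
    (f : L2 s) : ∃ g, IsMulBy φ f g := by
  have hm : MemLp (fun x => φ x * f x) 2 volume := by
    refine MemLp.of_le_mul (c := C) (Lp.memLp f)
      (hφ.aestronglyMeasurable.mul (Lp.aestronglyMeasurable f)) (Eventually.of_forall fun x => ?_)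
    rw [norm_mul]
    gcongr
    exact hC x
  exact ⟨hm.toLp, hm.coeFn_toLp⟩

theorem hasCompactSupport_bump_smul {a : ℝ} (ha : a ≠ 0) :
     HasCompactSupport (fun x : Space s => bump s (a • x)) :=
  (bump s).hasCompactSupport.comp_homeomorph (Homeomorph.smulOfNeZero a ha)

/-- The function `ξ ↦ bump (a ξ) e^{-2πi x·ξ}`. -/
def wave (a : ℝ) (x ξ : Space s) : ℂ :=
  (bump s (a • ξ) : ℂ) * Complex.exp (-(2 * Real.pi * ⟪x, ξ⟫_ℝ : ℝ) * Complex.I)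

theorem memLp_wave {a : ℝ} (ha : a ≠ 0) (x : Space s) : MemLp (wave a x) 2 volume := by
  refine Continuous.memLp_of_hasCompactSupport ?_ ?_
  · unfold wave
    have := (contDiff_bump (s := s)).continuous
    fun_prop
  · refine HasCompactSupport.mul_right ?_
    exact (hasCompactSupport_bump_smul ha).comp_left (g := fun r : ℝ => (r : ℂ)) Complex.ofReal_zero

/-- The functions `wave a x` depend on `x` in a Lipschitz continuous way, in the norm of `L²`. -/
theorem continuous_wave {a : ℝ} (ha : a ≠ 0) :
    Continuous fun x : Space s => (memLp_wave ha x).toLp (wave a x) := by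
  have hm : MemLp (fun ξ : Space s => 2 * Real.pi * ‖ξ‖ * bump s (a • ξ)) 2 volume := by
    refine Continuous.memLp_of_hasCompactSupport ?_ (hasCompactSupport_bump_smul ha).mul_left
    have := (contDiff_bump (s := s)).continuous
    fun_prop
  refine LipschitzWith.continuous (K := ‖hm.toLp‖₊) (LipschitzWith.of_dist_le_mul fun x y => ?_)
  rw [dist_eq_norm, dist_eq_norm, ← MemLp.toLp_sub, mul_comm, coe_nnnorm]
  refine Lp.norm_le_mul_norm_of_ae_le_mul ?_
  filter_upwards [((memLp_wave ha x).sub (memLp_wave ha y)).coeFn_toLp, hm.coeFn_toLp] with ξ h1 h2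
  rw [h1, h2, Pi.sub_apply, wave, wave, ← mul_sub, norm_mul, Complex.norm_real, norm_mul]
  have h3 : ∀ p q : ℝ, ‖Complex.exp (-(p : ℂ) * Complex.I) - Complex.exp (-(q : ℂ) * Complex.I)‖ ≤
      |p - q| := fun p q => by
    have e : Complex.exp (-(p : ℂ) * Complex.I) - Complex.exp (-(q : ℂ) * Complex.I) =
        Complex.exp ((-q : ℝ) * Complex.I) * (Complex.exp (Complex.I * (q - p : ℝ)) - 1) := by
      rw [mul_sub, mul_one, ← Complex.exp_add]
      push_cast; ring_nf
    rw [e, norm_mul, Complex.norm_exp_ofReal_mul_I, one_mul, abs_sub_comm]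
    exact Real.norm_exp_I_mul_ofReal_sub_one_le
  have h4 := h3 (2 * Real.pi * ⟪x, ξ⟫_ℝ) (2 * Real.pi * ⟪y, ξ⟫_ℝ)
  have h5 : |2 * Real.pi * ⟪x, ξ⟫_ℝ - 2 * Real.pi * ⟪y, ξ⟫_ℝ| ≤
      2 * Real.pi * (‖x - y‖ * ‖ξ‖) := by
    rw [← mul_sub, ← inner_sub_left, abs_mul, abs_of_pos Real.two_pi_pos]
    gcongr
    exact abs_real_inner_le_norm _ _
  have h6 : ‖2 * Real.pi * ‖ξ‖‖ = 2 * Real.pi * ‖ξ‖ := by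
    rw [Real.norm_of_nonneg (by positivity)]
  rw [h6]
  calc _ ≤ ‖bump s (a • ξ)‖ * (2 * Real.pi * (‖x - y‖ * ‖ξ‖)) := by
        gcongr
        exact h4.trans h5
    _ = _ := by ring

variable {a : ℝ} (ha : a ≠ 0)

/-- The family of functionals `h ↦ bump (a x) ∫ bump (a ξ) e^{2πi x·ξ} h(ξ) dξ`. -/
def cutoffKernel (a : ℝ) (ha : a ≠ 0) (x : Space s) : L2 s →L[ℂ] ℂ :=
  (bump s (a • x) : ℂ) • innerSL ℂ ((memLp_wave ha x).toLp (wave a x))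

theorem memLp_cutoffKernel : MemLp (cutoffKernel (s := s) a ha) 2 volume := by
  refine Continuous.memLp_of_hasCompactSupport ?_ ?_
  · unfold cutoffKernel
    have := (contDiff_bump (s := s)).continuous
    exact (Complex.continuous_ofReal.comp (this.comp (continuous_const_smul a))).smul
      ((innerSL ℂ).continuous.comp (continuous_wave ha))
  · refine (hasCompactSupport_bump_smul (s := s) ha).mono fun x hx h0 => hx ?_
    rw [cutoffKernel, show bump s (a • x) = 0 from h0, Complex.ofReal_zero]
    exact zero_smul ℂ (innerSL ℂ ((memLp_wave ha x).toLp (wave a x)))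

/-- The operator `χ(aQ) χ(aP / 2π)` with the cutoff function `χ = bump`. -/
def phaseCutoff (a : ℝ) (ha : a ≠ 0) : L2 s →L[ℂ] L2 s :=
  kernelOp (memLp_cutoffKernel (s := s) ha).toLp ∘L
    ((fourierL2 s).toContinuousLinearEquiv : L2 s →L[ℂ] L2 s)

theorem isCompactOperator_phaseCutoff : IsCompactOperator (phaseCutoff (s := s) a ha) :=
  (isCompactOperator_kernelOp (memLp_cutoffKernel (s := s) ha).toLp).comp_clm _

theorem norm_bump_le (x : Space s) : ‖(bump s x : ℂ)‖ ≤ 1 := by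
  rw [Complex.norm_real, Real.norm_of_nonneg (bump s).nonneg]
  exact (bump s).le_one

/-- On a Schwartz function `f`, `phaseCutoff a` is `bump (a x)` times the inverse Fourier transform of
`bump (a ξ) (𝓕 f)(ξ)`, because this inverse transform is a convergent integral. -/
theorem isMulBy_phaseCutoff_toLp (f : 𝓢(Space s, ℂ)) {g : L2 s}
    (hg : IsMulBy (fun ξ => (bump s (a • ξ) : ℂ)) (fourierL2 s (f.toLp 2 volume)) g) :
    IsMulBy (fun x => (bump s (a • x) : ℂ)) ((fourierL2 s).symm g)
      (phaseCutoff a ha (f.toLp 2 volume)) := by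
  set w : 𝓢(Space s, ℂ) := SchwartzMap.smulLeftCLM ℂ (fun ξ : Space s => bump s (a • ξ)) (𝓕 f)
    with hw
  have hwa : ∀ ξ, w ξ = (bump s (a • ξ) : ℂ) * (𝓕 f) ξ := fun ξ => by
    rw [hw, SchwartzMap.smulLeftCLM_apply_apply (hasTemperateGrowth_bump a ha)]
    rfl
  have e1 : fourierL2 s (f.toLp 2 volume) = (𝓕 f).toLp 2 volume := SchwartzMap.toLp_fourier_eq f
  have e2 : g = w.toLp 2 volume := by
    refine Lp.ext ?_
    rw [e1] at hg
    filter_upwards [hg, (𝓕 f).coeFn_toLp 2 volume, w.coeFn_toLp 2 volume] with ξ h1 h2 h3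
    rw [h1, h2, h3, hwa]
  have e3 : (fourierL2 s).symm g = (𝓕⁻ w).toLp 2 volume := by
    rw [e2]; exact SchwartzMap.toLp_fourierInv_eq w
  rw [e3]
  have e4 : phaseCutoff a ha (f.toLp 2 volume) =
      kernelOp (memLp_cutoffKernel (s := s) ha).toLp ((𝓕 f).toLp 2 volume) := by
    rw [← e1]; rfl
  rw [e4, IsMulBy]
  filter_upwards [coeFn_kernelOp (memLp_cutoffKernel (s := s) ha).toLp ((𝓕 f).toLp 2 volume),
    (memLp_cutoffKernel (s := s) ha).coeFn_toLp, (𝓕⁻ w).coeFn_toLp 2 volume] with x h1 h2 h3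
  rw [h1, h2, h3, cutoffKernel, smul_apply, smul_eq_mul, innerSL_apply_apply,
    SchwartzMap.fourierInv_coe, Real.fourierInv_eq', L2.inner_def]
  congr 1
  refine integral_congr_ae ?_
  filter_upwards [(memLp_wave ha x).coeFn_toLp, (𝓕 f).coeFn_toLp 2 volume] with ξ k1 k2
  rw [k1, k2, hwa, wave, RCLike.inner_apply, map_mul, Complex.conj_ofReal, ← Complex.exp_conj,
    map_mul, Complex.conj_I, smul_eq_mul, real_inner_comm]
  simp only [map_neg, Complex.conj_ofReal, neg_mul_neg]
  ring

theorem isMulBy_phaseCutoff {f g : L2 s}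
    (hg : IsMulBy (fun ξ => (bump s (a • ξ) : ℂ)) (fourierL2 s f) g) :
    IsMulBy (fun x => (bump s (a • x) : ℂ)) ((fourierL2 s).symm g) (phaseCutoff a ha f) := by
  have hd : f ∈ closure (Set.range fun v : 𝓢(Space s, ℂ) => (v.toLp 2 volume : L2 s)) :=
    (dense_toLp_compactSupport.mono (Set.image_subset_range _ _)) f
  obtain ⟨u, hu, hlim⟩ := mem_closure_iff_seq_limit.1 hd
  choose v hv using hu
  have hc := (contDiff_bump (s := s)).continuous
  choose G hG using fun n => exists_isMulBy (φ := fun ξ : Space s => (bump s (a • ξ) : ℂ))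
    (by fun_prop) (C := 1) (fun ξ => norm_bump_le _) (fourierL2 s ((v n).toLp 2 volume))
  have hlim' : Tendsto (fun n => (v n).toLp 2 volume) atTop (𝓝 f) := hlim.congr fun n => (hv n).symm
  have hGg : Tendsto G atTop (𝓝 g) := by
    rw [tendsto_iff_norm_sub_tendsto_zero] at hlim' ⊢
    refine squeeze_zero (fun _ => norm_nonneg _) (fun n => ?_) hlim'
    have := ((hG n).sub hg).norm_le (C := 1) (fun ξ => norm_bump_le _)
    rwa [one_mul, ← map_sub, LinearIsometryEquiv.norm_map] at this
  exact IsMulBy.of_tendsto (fun n => isMulBy_phaseCutoff_toLp ha (v n) (hG n))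
    (fun _ => tendsto_const_nhds) (((fourierL2 s).symm.continuous.tendsto _).comp hGg)
    (((phaseCutoff a ha).continuous.tendsto _).comp hlim')

/-- A vector `u` with small `(1 - χ(aQ)) u` and small `(1 - χ(aP / 2π)) u` is little changed by
`phaseCutoff`. -/
theorem norm_sub_phaseCutoff_le {u p q : L2 s} {δ η : ℝ}
    (hp : IsMulBy (fun ξ => (1 - bump s (a • ξ) : ℂ)) (fourierL2 s u) p)
    (hq : IsMulBy (fun x => (1 - bump s (a • x) : ℂ)) u q) (hpδ : ‖p‖ ≤ δ) (hqη : ‖q‖ ≤ η) :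
    ‖u - phaseCutoff a ha u‖ ≤ δ + η := by
  have h1 : IsMulBy (fun ξ => (bump s (a • ξ) : ℂ)) (fourierL2 s u) (fourierL2 s u - p) := by
    rw [IsMulBy] at *
    filter_upwards [hp, Lp.coeFn_sub (fourierL2 s u) p] with x h1 h2
    rw [h2, Pi.sub_apply, h1]; ring
  have h2 := isMulBy_phaseCutoff ha h1
  rw [map_sub, LinearIsometryEquiv.symm_apply_apply] at h2
  have h3 : IsMulBy (fun x => (bump s (a • x) : ℂ)) ((fourierL2 s).symm p)
      (u - phaseCutoff a ha u - q) := by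
    rw [IsMulBy] at *
    filter_upwards [h2, hq, Lp.coeFn_sub (u - phaseCutoff a ha u) q,
      Lp.coeFn_sub u (phaseCutoff a ha u), Lp.coeFn_sub u ((fourierL2 s).symm p)]
      with x h1 h2 h3 h4 h5
    rw [h3, Pi.sub_apply, h4, Pi.sub_apply, h1, h2, h5, Pi.sub_apply]; ring
  have h4 := h3.norm_le (C := 1) (fun ξ => norm_bump_le _)
  rw [one_mul, LinearIsometryEquiv.norm_map] at h4
  have h5 : u - phaseCutoff a ha u = (u - phaseCutoff a ha u - q) + q := by abel
  rw [h5]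
  exact (norm_add_le _ _).trans (add_le_add (h4.trans hpδ) hqη)

end Compactness

section CompactResolvent

variable {s : ℕ}

theorem norm_one_sub_bump_le (x : Space s) : ‖(1 - bump s x : ℂ)‖ ≤ 1 := by
  have e : (1 - bump s x : ℂ) = ((1 - bump s x : ℝ) : ℂ) := by push_cast; rfl
  rw [e, Complex.norm_real, Real.norm_of_nonneg (sub_nonneg.2 (bump s).le_one)]
  linarith [(bump s).nonneg (x := x)]

/-- Chebyshev's inequality for the part of `f` outside a ball. -/
theorem IsMulBy.norm_one_sub_bump_le {a M : ℝ} {w : Space s → ℝ} {f g q : L2 s} (hM : 0 < M)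
    (hw : ∀ x, 1 < ‖a • x‖ → M ≤ |w x|) (hg : IsMulBy (fun x => (w x : ℂ)) f g)
    (hq : IsMulBy (fun x => (1 - bump s (a • x) : ℂ)) f q) : ‖q‖ ≤ M⁻¹ * ‖g‖ := by
  refine Lp.norm_le_mul_norm_of_ae_le_mul ?_
  filter_upwards [hg, hq] with x h1 h2
  rw [h1, h2, norm_mul, norm_mul, Complex.norm_real, Real.norm_eq_abs, ← mul_assoc]
  gcongr
  rcases le_or_gt ‖a • x‖ 1 with h | h
  · rw [bump_eq_one h]
    simp
    positivity
  · refine (BoseGas.norm_one_sub_bump_le _).trans ?_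
    rw [← div_eq_inv_mul, one_le_div hM]
    exact hw x h

/-- For a confining potential `V`, the operator `P² + V(Q)` has compact resolvent. -/
theorem isCompactOperator_resolvent {V : Space s → ℝ}
    (hVinf : Tendsto V (cocompact (Space s)) atTop) : IsCompactOperator (resolvent V) := by
  -- For `u = (P² + V + 1)⁻¹ f` both `‖|P| u‖` and `‖√V u‖` are at most `‖f‖`. Outside the balls in
  -- which the cutoff functions equal `1`, `|P|` and `√V` are at least `M = 2 / ε`, so that the cutoff
  -- changes `u` by at most `2 ‖f‖ / M = ε ‖f‖`.
  have key : ∀ ε : ℝ, 0 < ε → ∃ K : L2 s →L[ℂ] L2 s, IsCompactOperator K ∧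
      ‖resolvent V - K‖ ≤ ε := by
    intro ε hε
    set M : ℝ := 2 / ε
    have hM : 0 < M := by positivity
    have hVM : ∀ᶠ x in cocompact (Space s), M ^ 2 ≤ V x := hVinf.eventually_ge_atTop _
    obtain ⟨R, hR⟩ : ∃ R : ℝ, ∀ x : Space s, R < ‖x‖ → M ^ 2 ≤ V x := by
      rw [← Metric.cobounded_eq_cocompact, ← comap_norm_atTop, eventually_comap] at hVM
      obtain ⟨R, hR⟩ := eventually_atTop.1 hVM
      exact ⟨R, fun x hx => hR _ hx.le x rfl⟩
    set R' : ℝ := max 1 (max R M)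
    have hR'0 : 0 < R' := by positivity
    have hR'R : R ≤ R' := (le_max_left _ _).trans (le_max_right _ _)
    have hR'M : M ≤ R' := (le_max_right _ _).trans (le_max_right _ _)
    have ha : R'⁻¹ ≠ 0 := by positivity
    have hlt : ∀ x : Space s, 1 < ‖R'⁻¹ • x‖ → R' < ‖x‖ := fun x hx => by
      rwa [norm_smul, Real.norm_of_nonneg (by positivity), ← div_eq_inv_mul, one_lt_div hR'0] at hx
    refine ⟨phaseCutoff R'⁻¹ ha ∘L resolvent V, (isCompactOperator_phaseCutoff ha).comp_clm _,
      ContinuousLinearMap.opNorm_le_bound _ hε.le fun f => ?_⟩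
    have hc := (contDiff_bump (s := s)).continuous
    obtain ⟨p, hp⟩ := exists_isMulBy (φ := fun ξ : Space s => (1 - bump s (R'⁻¹ • ξ) : ℂ))
      (by fun_prop) (C := 1) (fun ξ => norm_one_sub_bump_le _) (fourierL2 s (resolvent V f))
    obtain ⟨q, hq⟩ := exists_isMulBy (φ := fun ξ : Space s => (1 - bump s (R'⁻¹ • ξ) : ℂ))
      (by fun_prop) (C := 1) (fun ξ => norm_one_sub_bump_le _) (resolvent V f)
    obtain ⟨h1, h2⟩ := mem_formDomain.1 (formSolution_mem (V := V) f)
    rw [← resolvent_apply] at h1 h2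
    have hp' := (mem_graph_momentumFn.1 h1).norm_one_sub_bump_le hM (fun ξ hξ => by
      have h3 := hlt ξ hξ
      have h4 := Real.pi_gt_three
      rw [abs_norm, norm_smul, Real.norm_of_nonneg (by positivity)]
      nlinarith [norm_nonneg ξ]) hp
    have hq' := (mem_graph_positionFn.1 h2).norm_one_sub_bump_le hM (fun x hx => by
      rw [abs_of_nonneg (Real.sqrt_nonneg _)]
      exact Real.le_sqrt_of_sq_le (hR x (hR'R.trans_lt (hlt x hx)))) hq
    rw [LinearIsometryEquiv.norm_map] at hp'
    have hb := fun i => mul_le_mul_of_nonneg_left (norm_formSolution_le (V := V) f i)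
      (inv_pos.2 hM).le
    refine (norm_sub_phaseCutoff_le ha hp hq (hp'.trans (hb 1)) (hq'.trans (hb 2))).trans ?_
    have e : M⁻¹ = ε / 2 := inv_div _ _
    rw [e]
    linarith
  choose K hK hle using fun n : ℕ => key (1 / (n + 1)) (by positivity)
  refine isCompactOperator_of_tendsto (F := K) (l := atTop) ?_ (Eventually.of_forall hK)
  rw [tendsto_iff_norm_sub_tendsto_zero]
  refine squeeze_zero (fun _ => norm_nonneg _) (fun n => ?_)
    tendsto_one_div_add_atTop_nhds_zero_nat
  rw [norm_sub_rev]
  exact hle n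

theorem tendsto_scaledV_cocompact {V : Space s → ℝ} (hVinf : Tendsto V (cocompact (Space s)) atTop)
    {L : ℝ} (hL : 0 < L) : Tendsto (scaledV V L) (cocompact (Space s)) atTop := by
  have h1 : Tendsto (fun x : Space s => L⁻¹ • x) (cocompact _) (cocompact _) :=
    (Homeomorph.smulOfNeZero L⁻¹ (by positivity)).isClosedEmbedding.tendsto_cocompact
  exact (hVinf.comp h1).const_mul_atTop (by positivity)

end CompactResolvent

/-! ### Functions of `P²` in the momentum representation -/

section FreeCalculus

open scoped SchwartzMap

variable {s : ℕ}

/-- The symbol `|p|²` of the free Hamiltonian, in the variable `ξ = p / 2π` of the Fourier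
transform. -/
def kinetic (ξ : Space s) : ℝ := ‖(2 * Real.pi) • ξ‖ ^ 2

theorem continuous_kinetic : Continuous (kinetic (s := s)) := by
  unfold kinetic; fun_prop

theorem kinetic_nonneg (ξ : Space s) : 0 ≤ kinetic ξ := sq_nonneg _

theorem isPosResolvent_freeH : IsPosResolvent (freeH s) 0 (resolvent (fun _ : Space s => 0)) :=
  isPosResolvent continuous_const

theorem isMulBy_resolvent (f : L2 s) :
    IsMulBy (fun ξ => (((1 + kinetic ξ)⁻¹ : ℝ) : ℂ)) (fourierL2 s f)
      (fourierL2 s (resolvent (fun _ => 0) f)) := by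
  obtain ⟨u, hu, hlim⟩ := mem_closure_iff_seq_limit.1
    ((dense_oneAddKinetic_compactSupport (s := s)) f)
  have h1 : ∀ n, IsMulBy (fun ξ => (((1 + kinetic ξ)⁻¹ : ℝ) : ℂ)) (fourierL2 s (u n))
      (fourierL2 s (resolvent (fun _ => 0) (u n))) := by
    intro n
    obtain ⟨v, hv, hvu⟩ := hu n
    have hvu : (oneAddKinetic s v).toLp 2 volume = u n := hvu
    rw [← hvu, resolvent_oneAddKinetic hv]
    have e1 : fourierL2 s (v.toLp 2 volume) = (𝓕 v).toLp 2 volume := SchwartzMap.toLp_fourier_eq v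
    have e2 : fourierL2 s ((oneAddKinetic s v).toLp 2 volume) =
      (𝓕 (oneAddKinetic s v)).toLp 2 volume := SchwartzMap.toLp_fourier_eq _
    rw [e1, e2, IsMulBy]
    filter_upwards [(𝓕 v).coeFn_toLp 2 volume, (𝓕 (oneAddKinetic s v)).coeFn_toLp 2 volume]
      with ξ h2 h3
    have h4 : (1 + kinetic ξ) ≠ 0 := by have := kinetic_nonneg ξ; positivity
    rw [h2, h3, fourier_oneAddKinetic, ← mul_assoc]
    change _ = (((1 + kinetic ξ)⁻¹ : ℝ) : ℂ) * ((1 + kinetic ξ : ℝ) : ℂ) * _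
    rw [← Complex.ofReal_mul, inv_mul_cancel₀ h4, Complex.ofReal_one, one_mul]
  exact IsMulBy.of_tendsto h1 (fun _ => tendsto_const_nhds)
    (((fourierL2 s).continuous.tendsto _).comp hlim)
    (((fourierL2 s).continuous.tendsto _).comp
      (((resolvent (fun _ : Space s => 0)).continuous.tendsto _).comp hlim))

theorem isMulBy_aeval (q : Polynomial ℂ) (f : L2 s) :
    IsMulBy (fun ξ => q.eval (((1 + kinetic ξ)⁻¹ : ℝ) : ℂ)) (fourierL2 s f)
      (fourierL2 s (Polynomial.aeval (resolvent (fun _ : Space s => 0)) q f)) := by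
  set T := resolvent (fun _ : Space s => 0)
  induction q using Polynomial.induction_on with
  | C a =>
    have e : Polynomial.aeval T (Polynomial.C a) f = a • f := by
      simp [Algebra.algebraMap_eq_smul_one]
    rw [e, map_smul, IsMulBy]
    filter_upwards [Lp.coeFn_smul a (fourierL2 s f)] with ξ h
    rw [h, Polynomial.eval_C, Pi.smul_apply, smul_eq_mul]
  | add p q hp hq =>
    rw [map_add, add_apply, map_add, IsMulBy]
    filter_upwards [hp, hq, Lp.coeFn_add (fourierL2 s (Polynomial.aeval T p f))
      (fourierL2 s (Polynomial.aeval T q f))] with ξ h1 h2 h3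
    rw [h3, Pi.add_apply, h1, h2, Polynomial.eval_add, add_mul]
  | monomial n a h =>
    have e : Polynomial.aeval T (Polynomial.C a * Polynomial.X ^ (n + 1)) f =
        T (Polynomial.aeval T (Polynomial.C a * Polynomial.X ^ n) f) := by
      have e' : Polynomial.C a * Polynomial.X ^ (n + 1) =
        Polynomial.X * (Polynomial.C a * Polynomial.X ^ n) := by ring
      rw [e', map_mul, Polynomial.aeval_X, mul_apply_eq_comp]
    rw [e, IsMulBy]
    filter_upwards [h, isMulBy_resolvent (Polynomial.aeval T (Polynomial.C a * Polynomial.X ^ n) f)]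
      with ξ h1 h2
    rw [h2, h1, Polynomial.eval_mul, Polynomial.eval_mul, Polynomial.eval_pow, Polynomial.eval_pow,
      Polynomial.eval_X]
    ring

theorem inv_one_add_kinetic_mem (ξ : Space s) :
    (((1 + kinetic ξ)⁻¹ : ℝ) : ℂ) ∈ resolventInterval 0 := by
  have := kinetic_nonneg ξ
  refine ⟨_, ⟨by positivity, ?_⟩, rfl⟩
  rw [add_zero, inv_one]
  exact inv_le_one_of_one_le₀ (by linarith)

theorem isMulBy_cfc {G : ℂ → ℂ} (hG : ContinuousOn G (resolventInterval 0)) (f : L2 s) :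
    IsMulBy (fun ξ => G (((1 + kinetic ξ)⁻¹ : ℝ) : ℂ)) (fourierL2 s f)
      (fourierL2 s (cfc G (resolvent (fun _ : Space s => 0)) f)) := by
  have hT := isPosResolvent_freeH (s := s)
  have hε : ∀ n : ℕ, (0 : ℝ) < 1 / (n + 1) := fun n => by positivity
  choose q hq using fun n => exists_polynomial_near hG (hε n)
  refine IsMulBy.of_tendsto (fun n => isMulBy_aeval (q n) f) (fun ξ => ?_)
    (tendsto_const_nhds (x := fourierL2 s f)) (((fourierL2 s).continuous.tendsto _).comp ?_)
  · rw [tendsto_iff_norm_sub_tendsto_zero]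
    refine squeeze_zero (fun _ => norm_nonneg _) (fun n => ?_)
      tendsto_one_div_add_atTop_nhds_zero_nat
    rw [norm_sub_rev]
    exact hq n _ (inv_one_add_kinetic_mem ξ)
  · rw [tendsto_iff_norm_sub_tendsto_zero]
    have h0 : Tendsto (fun n : ℕ => 1 / ((n : ℝ) + 1) * ‖f‖) atTop (𝓝 0) := by
      simpa using (tendsto_one_div_add_atTop_nhds_zero_nat (𝕜 := ℝ)).mul_const ‖f‖
    refine squeeze_zero (fun _ => norm_nonneg _) (fun n => ?_) h0
    rw [norm_sub_rev, ← sub_apply]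
    refine (ContinuousLinearMap.le_opNorm _ _).trans ?_
    gcongr
    exact norm_cfc_sub_aeval_le hT.pos hT.norm_le hG (hε n).le (hq n)

/-- In the momentum representation, `F(P²)` is multiplication by `F(|p|²)`. -/
theorem isMulBy_funCalc {F : ℝ → ℂ} {C : ℝ} (hF : IsBddSymbol F 0 C) (f : L2 s) :
    IsMulBy (fun ξ => F (kinetic ξ)) (fourierL2 s f) (fourierL2 s (funCalc (freeH s) F f)) := by
  have hT := isPosResolvent_freeH (s := s)
  obtain ⟨u, hu, hlim⟩ := mem_closure_iff_seq_limit.1 (hT.dense f)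
  refine IsMulBy.of_tendsto (f := fun n => fourierL2 s (u n))
    (g := fun n => fourierL2 s (funCalc (freeH s) F (u n))) (fun n => ?_)
    (fun _ => tendsto_const_nhds)
    (((fourierL2 s).continuous.tendsto _).comp hlim)
    (((fourierL2 s).continuous.tendsto _).comp
      (((funCalc (freeH s) F).continuous.tendsto _).comp hlim))
  obtain ⟨v, hv⟩ := hu n
  rw [← hv, hT.funCalc_apply hF, IsMulBy]
  filter_upwards [isMulBy_cfc (hF.continuousOn_resolventSymbol le_rfl) v, isMulBy_resolvent v]
    with ξ h1 h2
  rw [h1, h2, resolventSymbol, Complex.ofReal_re, inv_inv, add_sub_cancel_left]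
  ring

end FreeCalculus

/-! ### The limit of maximal chemical potential of the free Hamiltonian -/

section FreeCriticalLimits

open scoped ComplexConjugate

variable {s : ℕ}

theorem mem_domain_absPInv {f : L2 s} : f ∈ (absPInv s).domain ↔
    ∃ a : L2 s, IsMulBy (fun ξ => ((‖(2 * Real.pi) • ξ‖⁻¹ : ℝ) : ℂ)) (fourierL2 s f) a := by
  rw [LinearPMap.mem_domain_iff]
  constructor
  · rintro ⟨y, hy⟩
    exact ⟨fourierL2 s y, mem_graph_momentumFn.1 hy⟩
  · rintro ⟨a, ha⟩
    refine ⟨(fourierL2 s).symm a, mem_graph_momentumFn.2 ?_⟩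
    rwa [LinearIsometryEquiv.apply_symm_apply]

theorem isMulBy_evol (μ t : ℝ) (f : L2 s) :
    IsMulBy (fun ξ => Complex.exp (Complex.I * (t * (kinetic ξ - μ) : ℝ))) (fourierL2 s f)
      (fourierL2 s (evol (freeH s) μ t f)) :=
  isMulBy_funCalc (isBddSymbol_evol 0 μ t) f

theorem isMulBy_boseOp {β μ : ℝ} (hβ : 0 < β) (hμ : μ < 0) (f : L2 s) :
    IsMulBy (fun ξ => (((Real.exp (β * (kinetic ξ - μ)) - 1)⁻¹ : ℝ) : ℂ)) (fourierL2 s f)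
      (fourierL2 s (boseOp (freeH s) β μ f)) :=
  isMulBy_funCalc (isBddSymbol_bose hβ hμ) f

theorem evol_mem_domain_absPInv (t : ℝ) {f : L2 s} (hf : f ∈ (absPInv s).domain) :
    evol (freeH s) 0 t f ∈ (absPInv s).domain := by
  obtain ⟨a, ha⟩ := mem_domain_absPInv.1 hf
  have hc := continuous_kinetic (s := s)
  obtain ⟨b, hb⟩ := exists_isMulBy
    (φ := fun ξ => Complex.exp (Complex.I * (t * (kinetic ξ - 0) : ℝ))) (by fun_prop) (C := 1)
    (fun ξ => by rw [mul_comm, Complex.norm_exp_ofReal_mul_I]) a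
  refine mem_domain_absPInv.2 ⟨b, ?_⟩
  rw [IsMulBy] at *
  filter_upwards [ha, hb, isMulBy_evol 0 t f] with ξ h1 h2 h3
  rw [h2, h1, h3]; ring

/-- The function `m ↦ m / (e^{β(m - μ)} - 1)`, which stays bounded as `μ ↗ 0`. -/
def boseWeight (β μ m : ℝ) : ℝ := m * (Real.exp (β * (m - μ)) - 1)⁻¹

theorem norm_boseWeight_le {β μ m : ℝ} (hβ : 0 < β) (hμ : μ ≤ 0) (hm : 0 ≤ m) :
    ‖boseWeight β μ m‖ ≤ β⁻¹ := by
  rcases hm.eq_or_lt with rfl | hm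
  · simp [boseWeight, hβ.le]
  have h1 : β * m ≤ Real.exp (β * (m - μ)) - 1 := by
    nlinarith [Real.add_one_le_exp (β * (m - μ))]
  have h2 : 0 < β * m := by positivity
  have h3 : 0 < Real.exp (β * (m - μ)) - 1 := h2.trans_le h1
  rw [boseWeight, Real.norm_of_nonneg (by positivity), ← div_eq_mul_inv, div_le_iff₀ h3,
    inv_mul_eq_div, le_div_iff₀ hβ]
  linarith

theorem measurable_boseWeight (β μ : ℝ) : Measurable (boseWeight β μ) := by
  unfold boseWeight; fun_prop

theorem tendsto_boseWeight {β m : ℝ} (hβ : 0 < β) (hm : 0 < m) :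
    Tendsto (fun μ => boseWeight β μ m) (𝓝[<] 0) (𝓝 (boseWeight β 0 m)) := by
  refine Tendsto.mono_left ?_ nhdsWithin_le_nhds
  have : ContinuousAt (fun μ => boseWeight β μ m) 0 := by
    unfold boseWeight
    refine continuousAt_const.mul (ContinuousAt.inv₀ (by fun_prop) ?_)
    exact (exp_sub_one_pos hβ (by linarith)).ne'
  exact this

/-- The form `⟨f, (e^{β(P² - μ)} - 1)⁻¹ e^{itP²} g⟩` in terms of `a = |P|⁻¹ f` and `b = |P|⁻¹ g`,
in the momentum representation. -/
def boseForm (β : ℝ) (a b : L2 s) (μ t : ℝ) : ℂ :=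
  ∫ ξ, conj (a ξ) * ((boseWeight β μ (kinetic ξ) : ℝ) : ℂ) *
    Complex.exp (Complex.I * (t * kinetic ξ : ℝ)) * b ξ

theorem aestronglyMeasurable_boseForm (β : ℝ) (a b : L2 s) (μ t : ℝ) : AEStronglyMeasurable
    (fun ξ => conj (a ξ) * ((boseWeight β μ (kinetic ξ) : ℝ) : ℂ) *
      Complex.exp (Complex.I * (t * kinetic ξ : ℝ)) * b ξ) volume := by
  have hc := continuous_kinetic (s := s)
  refine ((AEStronglyMeasurable.mul ?_ ?_).mul ?_).mul (Lp.aestronglyMeasurable b)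
  · exact Complex.continuous_conj.comp_aestronglyMeasurable (Lp.aestronglyMeasurable a)
  · exact (Complex.measurable_ofReal.comp
      ((measurable_boseWeight β μ).comp hc.measurable)).aestronglyMeasurable
  · exact Continuous.aestronglyMeasurable (by fun_prop)

theorem norm_boseForm_integrand_le {β μ : ℝ} (hβ : 0 < β) (hμ : μ ≤ 0) (a b : L2 s) (t : ℝ)
    (ξ : Space s) : ‖conj (a ξ) * ((boseWeight β μ (kinetic ξ) : ℝ) : ℂ) *
      Complex.exp (Complex.I * (t * kinetic ξ : ℝ)) * b ξ‖ ≤ β⁻¹ * (‖a ξ‖ * ‖b ξ‖) := by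
  rw [norm_mul, norm_mul, norm_mul, RCLike.norm_conj, Complex.norm_real,
    mul_comm Complex.I, Complex.norm_exp_ofReal_mul_I, mul_one]
  have := norm_boseWeight_le hβ hμ (kinetic_nonneg ξ)
  calc _ ≤ ‖a ξ‖ * β⁻¹ * ‖b ξ‖ := by gcongr
    _ = _ := by ring

theorem integrable_norm_mul_norm (a b : L2 s) (c : ℝ) :
    Integrable (fun ξ => c * (‖a ξ‖ * ‖b ξ‖)) volume :=
  ((Lp.memLp a).norm.integrable_mul (Lp.memLp b).norm).const_mul c

theorem continuous_boseForm {β : ℝ} (hβ : 0 < β) (a b : L2 s) :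
    Continuous (boseForm β a b 0) :=
  continuous_of_dominated (fun t => aestronglyMeasurable_boseForm β a b 0 t)
    (fun t => Eventually.of_forall (norm_boseForm_integrand_le hβ le_rfl a b t))
    (integrable_norm_mul_norm a b β⁻¹) (Eventually.of_forall fun ξ => by fun_prop)

/-- `⟨f, (e^{β(P² - μ)} - 1)⁻¹ f⟩` in the momentum representation. -/
theorem re_inner_boseOp {β μ : ℝ} (hβ : 0 < β) (hμ : μ < 0) (f : L2 s) :
    ENNReal.ofReal (RCLike.re ⟪f, boseOp (freeH s) β μ f⟫_ℂ) =
      ∫⁻ ξ, ENNReal.ofReal ((Real.exp (β * (kinetic ξ - μ)) - 1)⁻¹ * ‖fourierL2 s f ξ‖ ^ 2) := by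
  have h1 : ∀ᵐ ξ : Space s, RCLike.re ⟪fourierL2 s f ξ, fourierL2 s (boseOp (freeH s) β μ f) ξ⟫_ℂ =
      (Real.exp (β * (kinetic ξ - μ)) - 1)⁻¹ * ‖fourierL2 s f ξ‖ ^ 2 := by
    filter_upwards [isMulBy_boseOp hβ hμ f] with ξ h
    rw [h, RCLike.inner_apply, mul_assoc, RCLike.mul_conj]
    norm_cast
    exact (Complex.re_ofReal_mul _ _).trans (congrArg _ (Complex.ofReal_re _))
  have hint := (L2.integrable_inner (𝕜 := ℂ) (fourierL2 s f)
    (fourierL2 s (boseOp (freeH s) β μ f)))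
  rw [← (fourierL2 s).inner_map_map, L2.inner_def, ← integral_re hint,
    ofReal_integral_eq_lintegral_ofReal hint.re]
  · refine lintegral_congr_ae ?_
    filter_upwards [h1] with ξ h
    rw [h]
  · filter_upwards [h1] with ξ h
    have := exp_sub_one_pos hβ (x := kinetic ξ - μ) (by linarith [kinetic_nonneg ξ])
    rw [Pi.zero_apply, h]
    positivity

theorem re_inner_boseOp_mono {β μ ν : ℝ} (hβ : 0 < β) (hμν : μ ≤ ν) (hν : ν < 0) (f : L2 s) :
    RCLike.re ⟪f, boseOp (freeH s) β μ f⟫_ℂ ≤ RCLike.re ⟪f, boseOp (freeH s) β ν f⟫_ℂ := by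
  have hnn : 0 ≤ RCLike.re ⟪f, boseOp (freeH s) β ν f⟫_ℂ := by
    refine isPosResolvent_freeH.re_inner_funCalc_nonneg (isBddSymbol_bose hβ hν) (fun x hx => ?_) f
    have := exp_sub_one_pos hβ (x := x - ν) (by linarith)
    exact_mod_cast inv_nonneg.2 this.le
  rw [← ENNReal.ofReal_le_ofReal_iff hnn, re_inner_boseOp hβ (hμν.trans_lt hν),
    re_inner_boseOp hβ hν]
  refine lintegral_mono fun ξ => ENNReal.ofReal_le_ofReal ?_
  have := exp_sub_one_pos hβ (x := kinetic ξ - ν) (by linarith [kinetic_nonneg ξ])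
  gcongr

variable [Nonempty (Fin s)]

theorem ae_norm_pos : ∀ᵐ ξ : Space s, 0 < ‖(2 * Real.pi) • ξ‖ := by
  filter_upwards [Measure.ae_ne volume (0 : Space s)] with ξ hξ
  rw [norm_pos_iff]
  exact smul_ne_zero Real.two_pi_pos.ne' hξ

theorem tendsto_boseForm {β : ℝ} (hβ : 0 < β) (a b : L2 s) (t : ℝ) :
    Tendsto (fun μ => boseForm β a b μ t) (𝓝[<] 0) (𝓝 (boseForm β a b 0 t)) := by
  refine tendsto_integral_filter_of_dominated_convergence (fun ξ => β⁻¹ * (‖a ξ‖ * ‖b ξ‖))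
    (Eventually.of_forall fun μ => aestronglyMeasurable_boseForm β a b μ t) ?_
    (integrable_norm_mul_norm a b β⁻¹) ?_
  · filter_upwards [self_mem_nhdsWithin] with μ hμ
    exact Eventually.of_forall (norm_boseForm_integrand_le hβ (le_of_lt hμ) a b t)
  · filter_upwards [ae_norm_pos (s := s)] with ξ hξ
    have h := (Complex.continuous_ofReal.tendsto _).comp
      (tendsto_boseWeight hβ (m := kinetic ξ) (by unfold kinetic; positivity))
    exact (((tendsto_const_nhds (x := conj (a ξ))).mul h).mul_const _).mul_const _

theorem inner_boseOp_evol {β μ : ℝ} (hβ : 0 < β) (hμ : μ < 0) {f g a b : L2 s}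
    (ha : IsMulBy (fun ξ => ((‖(2 * Real.pi) • ξ‖⁻¹ : ℝ) : ℂ)) (fourierL2 s f) a)
    (hb : IsMulBy (fun ξ => ((‖(2 * Real.pi) • ξ‖⁻¹ : ℝ) : ℂ)) (fourierL2 s g) b) (t : ℝ) :
    ⟪f, boseOp (freeH s) β μ (evol (freeH s) 0 t g)⟫_ℂ = boseForm β a b μ t := by
  rw [← (fourierL2 s).inner_map_map, L2.inner_def, boseForm]
  refine integral_congr_ae ?_
  filter_upwards [ha, hb, isMulBy_boseOp hβ hμ (evol (freeH s) 0 t g), isMulBy_evol 0 t g,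
    ae_norm_pos (s := s)] with ξ h1 h2 h3 h4 h5
  have h6 : (‖(2 * Real.pi) • ξ‖ : ℂ) ≠ 0 := by exact_mod_cast h5.ne'
  rw [RCLike.inner_apply, h3, h4, h1, h2, map_mul, Complex.conj_ofReal, boseWeight, sub_zero,
    kinetic]
  push_cast
  field_simp

theorem exists_tendsto_thermal_freeH {β : ℝ} (hβ : 0 < β) {f g : L2 s}
    (hf : f ∈ (absPInv s).domain) (hg : g ∈ (absPInv s).domain) :
    ∃ ℓ : ℝ → ℂ, Continuous ℓ ∧ ∀ t : ℝ, Tendsto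
      (fun μ : ℝ => thermal (freeH s) β μ f (evol (freeH s) μ t g)) (𝓝[<] 0) (𝓝 (ℓ t)) := by
  have h := isPosResolvent_freeH (s := s)
  obtain ⟨a, ha⟩ := mem_domain_absPInv.1 hf
  obtain ⟨b, hb⟩ := mem_domain_absPInv.1 hg
  have hz := continuous_boseForm hβ a b
  refine ⟨fun t => (1 / 2) * (⟪f, evol (freeH s) 0 t g⟫_ℂ + boseForm β a b 0 t +
    conj (boseForm β a b 0 t)), ?_, fun t => ?_⟩
  · have he := h.continuous_evol 0 g
    have hz' := Complex.continuous_conj.comp hz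
    exact continuous_const.mul (((continuous_const.inner he).add hz).add hz')
  · have hphase : Tendsto (fun μ : ℝ => Complex.exp (Complex.I * (t * (0 - μ) : ℝ))) (𝓝[<] 0)
        (𝓝 1) := by
      refine Tendsto.mono_left ?_ nhdsWithin_le_nhds
      have : Continuous fun μ : ℝ => Complex.exp (Complex.I * (t * (0 - μ) : ℝ)) := by fun_prop
      simpa using this.tendsto 0
    have hlim := hphase.mul (tendsto_boseForm hβ a b t)
    rw [one_mul] at hlim
    have hconj := (Complex.continuous_conj.tendsto _).comp hlim
    have hfirst := hphase.mul_const ⟪f, evol (freeH s) 0 t g⟫_ℂ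
    rw [one_mul] at hfirst
    refine (((hfirst.add hlim).add hconj).const_mul (1 / 2)).congr' ?_
    filter_upwards [self_mem_nhdsWithin] with μ hμ
    have hsa := h.inner_funCalc_left (isBddSymbol_bose hβ hμ) (fun x => Complex.conj_ofReal _)
      (evol (freeH s) 0 t g) f
    change ⟪boseOp (freeH s) β μ (evol (freeH s) 0 t g), f⟫_ℂ =
      ⟪evol (freeH s) 0 t g, boseOp (freeH s) β μ f⟫_ℂ at hsa
    rw [h.thermal_eq hβ hμ, h.evol_eq_smul μ 0 t, smul_apply, map_smul, inner_smul_right,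
      inner_smul_right, inner_smul_left, ← hsa, ← inner_conj_symm _ f,
      inner_boseOp_evol hβ hμ ha hb, Function.comp_apply, map_mul]

theorem inv_le_add_inv_exp_sub_one {y : ℝ} (hy : 0 < y) : y⁻¹ ≤ 1 + (Real.exp y - 1)⁻¹ := by
  have h1 : 0 < Real.exp y - 1 := sub_pos.2 (Real.one_lt_exp_iff.2 hy)
  have h2 : 1 + (Real.exp y - 1)⁻¹ = Real.exp y / (Real.exp y - 1) := by field_simp; ring
  rw [h2, le_div_iff₀ h1, inv_mul_le_iff₀ hy]
  have h3 := Real.add_one_le_exp (-y)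
  have h4 : Real.exp (-y) * Real.exp y = 1 := by rw [← Real.exp_add]; simp
  nlinarith [Real.exp_pos y]

/-- If `⟨f, (e^{β(P² - μ)} - 1)⁻¹ f⟩` stays bounded as `μ ↗ 0`, then `|P|⁻¹ f ∈ L²`. -/
theorem mem_domain_absPInv_of_bounded {β M : ℝ} (hβ : 0 < β) {f : L2 s}
    (hM : ∀ μ : ℝ, μ < 0 → RCLike.re ⟪f, boseOp (freeH s) β μ f⟫_ℂ ≤ M) :
    f ∈ (absPInv s).domain := by
  set F : Space s → ℂ := ((fourierL2 s f : L2 s) : Space s → ℂ)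
  have hFm : AEStronglyMeasurable F volume := Lp.aestronglyMeasurable _
  have hcK := continuous_kinetic (s := s)
  set μ : ℕ → ℝ := fun n => -(1 / ((n : ℝ) + 1))
  have hμ : ∀ n, μ n < 0 := fun n => neg_neg_of_pos (by positivity)
  have hμ0 : Tendsto μ atTop (𝓝 0) := by
    simpa [μ] using (tendsto_one_div_add_atTop_nhds_zero_nat (𝕜 := ℝ)).neg
  have hmeas : ∀ ν : ℝ, AEMeasurable (fun ξ =>
      (Real.exp (β * (kinetic ξ - ν)) - 1)⁻¹ * ‖F ξ‖ ^ 2) volume := fun ν => by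
    have : Measurable fun ξ : Space s => (Real.exp (β * (kinetic ξ - ν)) - 1)⁻¹ :=
      Measurable.inv (by fun_prop)
    exact this.aemeasurable.mul (hFm.norm.aemeasurable.pow_const 2)
  -- Fatou's lemma bounds the weighted norm at `μ = 0`.
  have hfatou : ∫⁻ ξ, ENNReal.ofReal ((Real.exp (β * (kinetic ξ - 0)) - 1)⁻¹ * ‖F ξ‖ ^ 2) ≤
      ENNReal.ofReal M := by
    calc _ = ∫⁻ ξ, liminf (fun n => ENNReal.ofReal
          ((Real.exp (β * (kinetic ξ - μ n)) - 1)⁻¹ * ‖F ξ‖ ^ 2)) atTop := by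
          refine lintegral_congr_ae ?_
          filter_upwards [ae_norm_pos (s := s)] with ξ hξ
          refine (Tendsto.liminf_eq ?_).symm
          have hk : 0 < kinetic ξ := by unfold kinetic; positivity
          refine (ENNReal.continuous_ofReal.tendsto _).comp (Tendsto.mul_const _ ?_)
          have : ContinuousAt (fun ν => (Real.exp (β * (kinetic ξ - ν)) - 1)⁻¹) 0 :=
            ContinuousAt.inv₀ (by fun_prop) (exp_sub_one_pos hβ (by linarith)).ne'
          exact this.tendsto.comp hμ0
      _ ≤ liminf (fun n => ∫⁻ ξ, ENNReal.ofReal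
          ((Real.exp (β * (kinetic ξ - μ n)) - 1)⁻¹ * ‖F ξ‖ ^ 2)) atTop :=
          lintegral_liminf_le' fun n => (hmeas (μ n)).ennreal_ofReal
      _ ≤ liminf (fun _ : ℕ => ENNReal.ofReal M) atTop := by
          refine liminf_le_liminf (Eventually.of_forall fun n => ?_)
          rw [← re_inner_boseOp hβ (hμ n)]
          exact ENNReal.ofReal_le_ofReal (hM _ (hμ n))
      _ = _ := liminf_const _
  have hpos : ∀ᵐ ξ : Space s, 0 ≤ (Real.exp (β * (kinetic ξ - 0)) - 1)⁻¹ * ‖F ξ‖ ^ 2 := by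
    refine Eventually.of_forall fun ξ => mul_nonneg (inv_nonneg.2 (sub_nonneg.2 ?_)) (by positivity)
    exact Real.one_le_exp (mul_nonneg hβ.le (by linarith [kinetic_nonneg ξ]))
  have hint : Integrable (fun ξ => (Real.exp (β * (kinetic ξ - 0)) - 1)⁻¹ * ‖F ξ‖ ^ 2) volume :=
    ⟨(hmeas 0).aestronglyMeasurable,
      (hasFiniteIntegral_iff_ofReal hpos).2 (hfatou.trans_lt ENNReal.ofReal_lt_top)⟩
  have hF2 : Integrable (fun ξ => ‖F ξ‖ ^ 2) volume := (Lp.memLp (fourierL2 s f)).integrable_norm_pow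
    two_ne_zero
  have hm : AEStronglyMeasurable (fun ξ : Space s => ((‖(2 * Real.pi) • ξ‖⁻¹ : ℝ) : ℂ) * F ξ)
      volume := by
    refine AEStronglyMeasurable.mul ?_ hFm
    have : Measurable fun ξ : Space s => ‖(2 * Real.pi) • ξ‖⁻¹ := Measurable.inv (by fun_prop)
    exact (Complex.measurable_ofReal.comp this).aestronglyMeasurable
  have hL : MemLp (fun ξ : Space s => ((‖(2 * Real.pi) • ξ‖⁻¹ : ℝ) : ℂ) * F ξ) 2 volume := by
    rw [memLp_two_iff_integrable_sq_norm hm]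
    refine ((hF2.add hint).const_mul β).mono' (hm.norm.pow 2) ?_
    filter_upwards [ae_norm_pos (s := s)] with ξ hξ
    have hk : 0 < kinetic ξ := by unfold kinetic; positivity
    have h1 := inv_le_add_inv_exp_sub_one (mul_pos hβ hk)
    have h2 : (kinetic ξ)⁻¹ ≤ β * (1 + (Real.exp (β * kinetic ξ) - 1)⁻¹) := by
      rw [mul_inv, inv_mul_le_iff₀ hβ] at h1
      exact h1
    rw [Real.norm_of_nonneg (by positivity), norm_mul, mul_pow, Complex.norm_real, norm_inv,
      norm_norm, inv_pow]
    change (kinetic ξ)⁻¹ * ‖F ξ‖ ^ 2 ≤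
      β * (‖F ξ‖ ^ 2 + (Real.exp (β * (kinetic ξ - 0)) - 1)⁻¹ * ‖F ξ‖ ^ 2)
    rw [sub_zero]
    calc _ ≤ β * (1 + (Real.exp (β * kinetic ξ) - 1)⁻¹) * ‖F ξ‖ ^ 2 := by gcongr
      _ = _ := by ring
  exact mem_domain_absPInv.2 ⟨hL.toLp, hL.coeFn_toLp⟩

/-- The limit `μ ↗ 0` for the free Bose gas. -/
theorem hasCriticalLimits_freeH : HasCriticalLimits (freeH s) 0 (absPInv s).domain where
  stable t f hf := evol_mem_domain_absPInv t hf
  tendsto β hβ f hf g hg := exists_tendsto_thermal_freeH hβ hf hg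
  diverges β hβ f hf := by
    have h := isPosResolvent_freeH (s := s)
    refine ⟨fun μ hμ => by rw [h.thermal_self hβ hμ, Complex.ofReal_im], ?_⟩
    rw [tendsto_atTop]
    intro M
    obtain ⟨ν, hν, hMν⟩ : ∃ ν : ℝ, ν < 0 ∧ M < RCLike.re ⟪f, boseOp (freeH s) β ν f⟫_ℂ := by
      by_contra! hcon
      exact hf (mem_domain_absPInv_of_bounded hβ hcon)
    filter_upwards [Ioo_mem_nhdsLT hν] with μ hμ
    rw [h.thermal_self hβ hμ.2, Complex.ofReal_re]
    have := re_inner_boseOp_mono hβ hμ.1.le hμ.2 f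
    have : 0 ≤ ‖f‖ ^ 2 / 2 := by positivity
    linarith

end FreeCriticalLimits

instance (s : ℕ) : Nontrivial (L2 s) := by
  have hb : volume (Metric.ball (0 : Space s) 1) ≠ ⊤ := measure_ball_lt_top.ne
  refine ⟨indicatorConstLp 2 measurableSet_ball hb (1 : ℂ), 0, fun h => ?_⟩
  have h1 := norm_indicatorConstLp (p := 2) (hs := measurableSet_ball) (hμs := hb) (c := (1 : ℂ))
    two_ne_zero ENNReal.ofNat_ne_top
  rw [h, norm_zero, norm_one, one_mul] at h1
  have h2 : 0 < volume.real (Metric.ball (0 : Space s) 1) :=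
    ENNReal.toReal_pos (Metric.measure_ball_pos volume _ one_pos).ne' hb
  exact (Real.rpow_pos_of_pos h2 _).ne h1

end BoseGas

end

open BoseGas in
theorem lemma3p1 (s : ℕ) (hs : 1 ≤ s) (V : Space s → ℝ) (hVc : Continuous V) (hV0 : ∀ x, 0 ≤ V x)
    (hVinf : Tendsto V (cocompact (Space s)) atTop)
    (hVmono : ∀ x, AntitoneOn (fun L : ℝ => scaledV V L x) (Set.Ioi 0)) :
    -- the thermodynamic limit
    (∀ β μ t : ℝ, 0 < β → μ < 0 → ∀ f g : L2 s,
      Tendsto (fun L : ℝ => thermal (trapH V L) β μ f (evol (trapH V L) μ t g)) atTop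
        (𝓝 (thermal (freeH s) β μ f (evol (freeH s) μ t g)))) ∧
    -- the limit of maximal chemical potential in a trap of finite size
    (∀ L : ℝ, 0 < L →
      HasCriticalLimits (trapH V L) (groundEnergy (trapH V L))
        (LinearMap.range (1 - groundProj (trapH V L)).toLinearMap)) ∧
    -- the limit of maximal chemical potential without a trap
    HasCriticalLimits (freeH s) 0 (absPInv s).domain := by
  have : Nonempty (Fin s) := ⟨⟨0, hs⟩⟩
  refine ⟨fun β μ t hβ hμ f g => ?_, fun L hL => ?_, hasCriticalLimits_freeH⟩
  · exact tendsto_thermal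
      (Eventually.of_forall fun L => isPosResolvent (continuous_scaledV hVc L))
      isPosResolvent_freeH (tendsto_resolvent hVc hV0) hβ hμ t f g
  · exact (isPosResolvent (continuous_scaledV hVc L)).hasCriticalLimits
      (isCompactOperator_resolvent (tendsto_scaledV_cocompact hVinf hL))
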